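/- An edge colouring of a finite simple graph $G$ is a function $c : E(G) \to \mathbb{N}$. A path is a rainbow path if no two of its edges have the same colour; $c$ is a rainbow colouring if every pair of vertices is joined by a rainbow path. The rainbow connection number $rc(G)$ of a connected graph $G$ is the minimum number of colours used by a rainbow colouring of $G$, and a rainbow colouring is optimal if it uses exactly $rc(G)$ colours. A split graph is a graph whose vertex set can be partitioned into a clique and an independent set. Polynomial time means running time on a (multi-stack) Turing machine bounded by a polynomial in the length of the input string, where a graph is given by its adjacency matrix, and a colouring is written as the matrix of the edge colours, with colours in unary. (i) For each fixed integer $k \ge 4$ there is a polynomial-time algorithm that, given a connected split graph $G$, decides whether $rc(G) \le k$. (ii) There is a polynomial-time algorithm that, given a connected split graph $G$, outputs an edge colouring of $G$ which is an optimal rainbow colouring of $G$ whenever $rc(G) \ge 4$. -/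

import Mathlib

namespace RainbowSplit

/-- `G` is a split graph: its vertex set is the disjoint union of a clique and an independent set
(either part may be empty). -/
def IsSplitGraph {V : Type*} (G : SimpleGraph V) : Prop :=
  ∃ K : Set V, G.IsClique K ∧ G.IsIndepSet Kᶜ

/-- An edge colouring assigns a natural number to every edge (adjacent edges may share a colour). -/
abbrev EdgeColouring {V : Type*} (G : SimpleGraph V) : Type _ := G.edgeSet → ℕ

/-- The walk `p` is a rainbow path: it is a path, and no two of its edges share a colour. -/
def IsRainbowPath {V : Type*} {G : SimpleGraph V} (c : EdgeColouring G) {u v : V}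
    (p : G.Walk u v) : Prop :=
  p.IsPath ∧ ∀ e f : G.edgeSet, e.1 ∈ p.edges → f.1 ∈ p.edges → c e = c f → e = f

/-- `c` is a rainbow colouring: every pair of vertices is joined by a rainbow path. -/
def IsRainbowColouring {V : Type*} {G : SimpleGraph V} (c : EdgeColouring G) : Prop :=
  ∀ u v : V, ∃ p : G.Walk u v, IsRainbowPath c p

/-- The number of colours that occur in `c`. -/
noncomputable def numColours {V : Type*} {G : SimpleGraph V} (c : EdgeColouring G) : ℕ :=
  (Set.range c).ncard

/-- The rainbow connection number of a finite connected graph: the least number of colours in a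
rainbow colouring. It is used for finite connected graphs only, which have a rainbow colouring by
`exists_isRainbowColouring`. -/
noncomputable def rc {V : Type*} (G : SimpleGraph V) : ℕ :=
  sInf {m : ℕ | ∃ c : EdgeColouring G, IsRainbowColouring c ∧ numColours c = m}

theorem exists_isRainbowColouring {V : Type*} [Finite V] (G : SimpleGraph V) (hG : G.Connected) :
    ∃ c : EdgeColouring G, IsRainbowColouring c := by
  obtain ⟨c, hc⟩ := exists_injective_nat G.edgeSet
  refine ⟨c, fun u v => ?_⟩
  obtain ⟨p, hp⟩ := hG.exists_isPath u v
  exact ⟨p, hp, fun e f _ _ h => hc h⟩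

/-- `c` is an optimal rainbow colouring: it uses the minimum possible number of colours. -/
def IsOptimalRainbowColouring {V : Type*} {G : SimpleGraph V} (c : EdgeColouring G) : Prop :=
  IsRainbowColouring c ∧ numColours c = rc G

/-- The inputs: finite connected split graphs, with vertices labelled `0, …, n - 1`. -/
structure ConnectedSplitGraph : Type where
  n : ℕ
  graph : SimpleGraph (Fin n)
  connected : graph.Connected
  isSplit : IsSplitGraph graph

open Classical in
/-- A graph as a string: the rows of its adjacency matrix in order, written in bits, each row
followed by the separator `none`. The length is `n * (n + 1)`. -/
noncomputable def encodeGraph {n : ℕ} (G : SimpleGraph (Fin n)) : List (Option Bool) :=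
  (List.finRange n).flatMap fun u =>
    (List.finRange n).map (fun v => some (decide (G.Adj u v))) ++ [none]

/-- The input string of a connected split graph. -/
noncomputable def ConnectedSplitGraph.encode (G : ConnectedSplitGraph) : List (Option Bool) :=
  encodeGraph G.graph

open Classical in
/-- An edge colouring as a string: the rows of the matrix of colours in order. The entry of an edge
of colour `i` is `i + 1` marks `some true`, that of a non-edge is empty; each entry is followed by
`some false`, each row by `none`. Colours being in unary, this is at least as long as
the corresponding string with colours in binary. -/
noncomputable def encodeColouring {n : ℕ} {G : SimpleGraph (Fin n)} (c : EdgeColouring G) :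
    List (Option Bool) :=
  (List.finRange n).flatMap fun u =>
    ((List.finRange n).flatMap fun v =>
      (if h : G.Adj u v then List.replicate (c ⟨s(u, v), h⟩ + 1) (some true) else []) ++
        [some false]) ++ [none]

end RainbowSplit

/-!
The proof has a combinatorial half, which describes the rainbow connection number and an optimal
colouring by first-order conditions on the graph, and a machine half, which evaluates such
conditions in polynomial time.

*Combinatorics.* Let `p` be the number of pendant vertices, and suppose that there are at least
three vertices. A rainbow path between two pendant vertices uses both pendant edges, so the pendant
edges have `p` different colours (`IsRainbowColouring.card_pendants_le`). Conversely, colour each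
pendant edge by its pendant vertex. If the remaining edges of the clique all get one more colour,
and every vertex outside uses two different colours on its edges to the clique, the colouring is
rainbow; the two colours may be pendant vertices if `p ≥ 2`, so that `p + 1` colours suffice
(`IsCore.painting_extra`). What is left is to decide when `p` colours suffice, for `p ≥ 4`. They do
in a star, and they do if four pendant vertices can be named whose labels colour all other edges.
This is possible if one vertex has three pendant neighbours or three vertices have pendant
neighbours, and the clique has three vertices that are not pendant (`WideTuple`), or if there are
two pairs of pendant vertices at two vertices with two common neighbours (`NarrowTuple`). The only
exceptions are double stars, and the graphs with two pairs of pendant vertices at two vertices with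
at most one common neighbour (`IsCore.hasTuple_or`). In these, the edge `ab` between the two
vertices with pendant neighbours cannot have the colour of a pendant edge, say at `a`: a rainbow
path from there to a pendant vertex at `b` avoids `ab`. In a double star there is no such path
(`IsDoubleStar.lt_numColours`). In the other graphs it takes the only common neighbour of `a` and
`b`, whose two edges cannot have colours that suit both of the pendant vertices at `b`
(`IsTight.lt_numColours`).

*First-order conditions.* A partition into a clique and an independent set is never searched for. If
some closed neighbourhood is a clique with independent complement, the least such one is taken;
otherwise the clique consists of the vertices with two nonadjacent neighbours (`isCore_inCore`).
Hence all notions above are first-order over the ordered graph, and so are the colours, which are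
labels of vertices or the number `n`: the colour of an edge is the number of the `t` that satisfy a
formula saying that `t` is smaller than the colour. As the colouring has to be built from one tuple
of pendant vertices, the formulas have a quantifier for the least witness, `Form.first`.

*Machines.* A small language `Cmd` of structured programs on stacks is compiled to multi-stack
Turing machines, with a bound on the running time (`Cmd.Run.steps`, `Cmd.polyTime_of_run`).
Variables for vertices are kept in unary, an atomic formula is evaluated by a scan of the adjacency
matrix, and a quantifier becomes a loop over the vertices (`Form.exists_run_eval`). The two theorems
used are `polyTime_sentence` for decisions and `polyTime_colouring` for colourings.
-/

namespace RainbowSplit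

open Function

/-! ### Structured stack programs and their compilation to Turing machines -/

/-- The common alphabet of the working stacks: `some true` is used as a unary mark and `none` as a
separator. -/
abbrev Sym : Type := Option Bool

/-- The registers of a stack program: a Boolean flag, and the result of the last `pop`, which is
`none` when the stack was empty. -/
abbrev Reg : Type := Bool × Option Sym

/-- Structured programs on stacks indexed by `K`, with tests on the registers only. -/
inductive Cmd (K : Type) : Type
  | push (k : K) (f : Reg → Sym)
  | pop (k : K)
  | load (f : Reg → Reg)
  | seq (c d : Cmd K)
  | ite (p : Reg → Bool) (c d : Cmd K)
  | loop (p : Reg → Bool) (c : Cmd K)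

namespace Cmd

variable {K : Type}

/-- `Run c s s' t`: started in state `s`, the program `c` terminates in state `s'` after at most
`t` steps. -/
inductive Run [DecidableEq K] :
    Cmd K → Reg × (K → List Sym) → Reg × (K → List Sym) → ℕ → Prop
  | push (k f r S) : Run (.push k f) (r, S) (r, update S k (f r :: S k)) 1
  | pop (k) (r : Reg) (S) : Run (.pop k) (r, S) ((r.1, (S k).head?), update S k (S k).tail) 1
  | load (f r S) : Run (.load f) (r, S) (f r, S) 1
  | seq {c d s s' s'' t t'} : Run c s s' t → Run d s' s'' t' → Run (.seq c d) s s'' (t + t')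
  | ite_true {p c d s s' t} : p s.1 = true → Run c s s' t → Run (.ite p c d) s s' (t + 1)
  | ite_false {p c d s s' t} : p s.1 = false → Run d s s' t → Run (.ite p c d) s s' (t + 1)
  | loop_true {p c s s' s'' t t'} : p s.1 = true → Run c s s' t → Run (.loop p c) s' s'' t' →
      Run (.loop p c) s s'' (t + t' + 1)
  | loop_false {p c s} : p s.1 = false → Run (.loop p c) s s 1
  | weaken {c s s' t t'} : Run c s s' t → t ≤ t' → Run c s s' t'

/-- The program points of `c`: one for each atomic command, test and loop head. -/
def Lab : Cmd K → Type
  | push _ _ => Unit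
  | pop _ => Unit
  | load _ => Unit
  | seq c d => Lab c ⊕ Lab d
  | ite _ c d => Option (Lab c ⊕ Lab d)
  | loop _ c => Option (Lab c)

/-- The program has finitely many program points. -/
noncomputable instance fintypeLab : (c : Cmd K) → Fintype (Lab c)
  | push _ _ => inferInstanceAs (Fintype Unit)
  | pop _ => inferInstanceAs (Fintype Unit)
  | load _ => inferInstanceAs (Fintype Unit)
  | seq c d => @instFintypeSum _ _ (fintypeLab c) (fintypeLab d)
  | ite _ c d => @instFintypeOption _ (@instFintypeSum _ _ (fintypeLab c) (fintypeLab d))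
  | loop _ c => @instFintypeOption _ (fintypeLab c)

/-- The program point at which the execution of `c` starts. -/
def entry : (c : Cmd K) → Lab c
  | push _ _ => ()
  | pop _ => ()
  | load _ => ()
  | seq c _ => Sum.inl (entry c)
  | ite _ _ _ => none
  | loop _ _ => none

/-- Stack alphabets of the compiled machine: the working stacks carry `Sym`, and one extra stack
`none`, which receives the output, carries `Δ`. -/
abbrev Alph (K Δ : Type) : Option K → Type
  | none => Δ
  | some _ => Sym

/-- The machine statement at each program point of `c`, where `emb` embeds the program points of
`c` into the labels of the whole machine and `exit` is the label to continue with after `c`. -/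
def code {Δ Λ : Type} : (c : Cmd K) → (emb : Lab c → Λ) → (exit : Λ) → Lab c →
    Turing.TM2.Stmt (Alph K Δ) Λ Reg
  | push k f, _, exit, _ => .push (some k) f (.goto fun _ => exit)
  | pop k, _, exit, _ => .pop (some k) (fun r x => (r.1, x)) (.goto fun _ => exit)
  | load f, _, exit, _ => .load f (.goto fun _ => exit)
  | seq c d, emb, _, .inl l => code c (fun l => emb (.inl l)) (emb (.inr (entry d))) l
  | seq _ d, emb, exit, .inr l => code d (fun l => emb (.inr l)) exit l
  | ite p c d, emb, _, none => .branch p (.goto fun _ => emb (some (.inl (entry c))))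
      (.goto fun _ => emb (some (.inr (entry d))))
  | ite _ c _, emb, exit, some (.inl l) => code c (fun l => emb (some (.inl l))) exit l
  | ite _ _ d, emb, exit, some (.inr l) => code d (fun l => emb (some (.inr l))) exit l
  | loop p c, emb, exit, none => .branch p (.goto fun _ => emb (some (entry c)))
      (.goto fun _ => exit)
  | loop _ c, emb, _, some l => code c (fun l => emb (some l)) (emb none) l

/-- The stacks of the compiled machine with working stacks `S` and output stack `o`. -/
def machStacks {Δ : Type} (S : K → List Sym) (o : List Δ) : (k : Option K) → List (Alph K Δ k)
  | none => o
  | some k => S k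

section
variable [DecidableEq K] {Δ Λ : Type}

lemma update_machStacks_some (S : K → List Sym) (o : List Δ) (k : K) (l : List Sym) :
    update (machStacks S o) (some k) l = machStacks (update S k l) o := by
  funext j
  cases j with
  | none => rfl
  | some j =>
    by_cases h : j = k
    · subst h; simp [machStacks]
    · simp [machStacks, h]

lemma update_machStacks_none (S : K → List Sym) (o o' : List Δ) :
    update (machStacks S o) none o' = machStacks S o' := by
  funext j
  cases j <;> simp [machStacks]

/-- `c'` is reached from `c` in exactly `m` steps of the machine `M`. -/
def Steps (M : Λ → Turing.TM2.Stmt (Alph K Δ) Λ Reg) (m : ℕ)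
    (c c' : Turing.TM2.Cfg (Alph K Δ) Λ Reg) : Prop :=
  (flip bind (Turing.TM2.step M))^[m] (some c) = some c'

lemma Steps.trans {M : Λ → Turing.TM2.Stmt (Alph K Δ) Λ Reg} {m m' c c' c''}
    (h : Steps M m c c') (h' : Steps M m' c' c'') : Steps M (m' + m) c c'' := by
  unfold Steps at *
  rw [iterate_add_apply, h, h']

lemma Steps.one {M : Λ → Turing.TM2.Stmt (Alph K Δ) Λ Reg} {l r S c'}
    (h : Turing.TM2.stepAux (M l) r S = c') : Steps M 1 ⟨some l, r, S⟩ c' := by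
  subst h; rfl

/-- Correctness of the compilation, with its running time. -/
theorem Run.steps {c : Cmd K} {s s' : Reg × (K → List Sym)} {t : ℕ} (h : Run c s s' t)
    (M : Λ → Turing.TM2.Stmt (Alph K Δ) Λ Reg) (emb : Lab c → Λ) (exit : Λ)
    (hM : ∀ l, M (emb l) = code c emb exit l) (o : List Δ) :
    ∃ m ≤ t, Steps M m ⟨some (emb (entry c)), s.1, machStacks s.2 o⟩
      ⟨some exit, s'.1, machStacks s'.2 o⟩ := by
  induction h generalizing exit with
  | push k f r S =>
    refine ⟨1, le_rfl, Steps.one ?_⟩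
    rw [hM]
    simp only [code, Turing.TM2.stepAux]
    rw [← update_machStacks_some]; rfl
  | pop k r S =>
    refine ⟨1, le_rfl, Steps.one ?_⟩
    rw [hM]
    simp only [code, Turing.TM2.stepAux]
    rw [← update_machStacks_some]; rfl
  | load f r S =>
    refine ⟨1, le_rfl, Steps.one ?_⟩
    rw [hM]; rfl
  | seq _ _ ih ih' =>
    obtain ⟨m, hm, h⟩ := ih (fun l => emb (.inl l)) _ (fun l => hM (.inl l))
    obtain ⟨m', hm', h'⟩ := ih' (fun l => emb (.inr l)) _ (fun l => hM (.inr l))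
    exact ⟨_, by omega, h.trans h'⟩
  | @ite_true p c d s s' t hp _ ih =>
    obtain ⟨m, hm, h⟩ := ih (fun l => emb (some (.inl l))) _ (fun l => hM (some (.inl l)))
    refine ⟨m + 1, by omega, Steps.trans (Steps.one ?_) h⟩
    have := hM none
    simp only [entry] at this ⊢
    rw [this]
    simp [code, hp]
  | @ite_false p c d s s' t hp _ ih =>
    obtain ⟨m, hm, h⟩ := ih (fun l => emb (some (.inr l))) _ (fun l => hM (some (.inr l)))
    refine ⟨m + 1, by omega, Steps.trans (Steps.one ?_) h⟩
    have := hM none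
    simp only [entry] at this ⊢
    rw [this]
    simp [code, hp]
  | @loop_true p c s s' s'' t t' hp _ _ ih ih' =>
    obtain ⟨m, hm, h⟩ := ih (fun l => emb (some l)) (emb none) (fun l => hM (some l))
    obtain ⟨m', hm', h'⟩ := ih' emb exit hM
    refine ⟨m' + (m + 1), by omega, Steps.trans (Steps.trans (Steps.one ?_) h) h'⟩
    have := hM none
    simp only [entry] at this ⊢
    rw [this]
    simp [code, hp]
  | @loop_false p c s hp =>
    refine ⟨1, le_rfl, Steps.one ?_⟩
    have := hM none
    simp only [entry] at this ⊢
    rw [this]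
    simp [code, hp]
  | weaken _ hle ih =>
    obtain ⟨m, hm, h⟩ := ih emb exit hM
    exact ⟨m, hm.trans hle, h⟩

/-- No stack grows by more than the running time. -/
lemma Run.length_le {c : Cmd K} {s s' : Reg × (K → List Sym)} {t : ℕ} (h : Run c s s' t) (k : K) :
    (s'.2 k).length ≤ (s.2 k).length + t := by
  induction h with
  | push k' f r S =>
    by_cases hk : k = k'
    · subst hk; simp
    · simp [hk]
  | pop k' r S =>
    by_cases hk : k = k'
    · subst hk; simp; omega
    · simp [hk]
  | load f r S => simp
  | _ => omega

/-- The compiled machine: it runs `c`, and then moves the contents of the stack `out` to the output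
stack, translating the symbols by `g`. -/
noncomputable def machine (c : Cmd K) (out : K) (g : Sym → Δ) :
    Option (Lab c) → Turing.TM2.Stmt (Alph K Δ) (Option (Lab c)) Reg
  | some l => code c some none l
  | none => .pop (some out) (fun _ x => (false, x)) <|
      .branch (fun r => r.2.isSome)
        (.push none (fun r => g (r.2.getD none)) (.goto fun _ => none))
        (.load (fun _ => (false, none)) .halt)

lemma stepAux_machine_none (c : Cmd K) (out : K) (g : Sym → Δ) (S : K → List Sym) (r : Reg)
    (o : List Δ) :
    Turing.TM2.stepAux (machine c out g none) r (machStacks S o) =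
      cond (S out).head?.isSome
        ⟨some none, (false, (S out).head?),
          machStacks (update S out (S out).tail) (g ((S out).head?.getD none) :: o)⟩
        ⟨none, (false, none), machStacks (update S out (S out).tail) o⟩ := by
  rw [← update_machStacks_none (update S out (S out).tail) o, ← update_machStacks_some]
  rfl

lemma steps_machine_output (c : Cmd K) (out : K) (g : Sym → Δ) (l : List Sym) (r : Reg)
    (o : List Δ) :
    Steps (machine c out g) (l.length + 1)
      ⟨some none, r, machStacks (update (fun _ => []) out l) o⟩
      ⟨none, (false, none), machStacks (fun _ => []) ((l.map g).reverse ++ o)⟩ := by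
  induction l generalizing r o with
  | nil =>
    refine Steps.one ?_
    rw [stepAux_machine_none]
    simp
  | cons x l ih =>
    have := ih (false, some x) (g x :: o)
    rw [List.length_cons]
    simp only [List.map_cons, List.reverse_cons, List.append_assoc, List.singleton_append]
    refine Steps.trans (Steps.one ?_) this
    rw [stepAux_machine_none]
    simp

end

/-- A program that turns the input into the reversed output in polynomial time witnesses
polynomial time computability. -/
theorem polyTime_of_run {K : Type} [DecidableEq K] [Fintype K] {Δ : Type}
    (c : Cmd K) (inp out : K) (g : Sym → Δ)
    {α β : Type} (ea : α → List Sym) (eb : β → List Δ) (f : α → β) (p : Polynomial ℕ)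
    (h : ∀ a, ∃ r l, (l.map g).reverse = eb (f a) ∧
      Run c ((false, none), update (fun _ => []) inp (ea a)) (r, update (fun _ => []) out l)
        (p.eval (ea a).length)) :
    Nonempty (Turing.TM2ComputableInPolyTime ea eb f) := by
  let tm : Turing.FinTM2 :=
    { K := Option K
      k₀ := some inp
      k₁ := none
      Γ := Alph K Δ
      Λ := Option (Lab c)
      main := some (entry c)
      σ := Reg
      initialState := (false, none)
      Γk₀Fin := inferInstanceAs (Fintype Sym)
      m := machine c out g }
  refine ⟨{ tm := tm
            inputAlphabet := Equiv.refl Sym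
            outputAlphabet := Equiv.refl Δ
            -- `p` steps for `c`, and one for each of the at most `X + p` symbols of the output
            time := p + p + Polynomial.X + 1
            outputsFun := fun a => Classical.choice ?_ }⟩
  obtain ⟨r, l, hl, hr⟩ := h a
  obtain ⟨m, hm, hs⟩ := hr.steps (machine c out g) some none (fun _ => rfl) []
  have hs' := hs.trans (steps_machine_output c out g l r [])
  have hlen := hr.length_le out
  have hlen2 : (update (fun _ : K => ([] : List Sym)) inp (ea a) out).length ≤ (ea a).length := by
    by_cases h : out = inp
    · subst h; simp
    · simp [h]
  refine ⟨⟨⟨l.length + 1 + m, ?_⟩, ?_⟩⟩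
  · have e1 : Turing.initList tm (List.map (Equiv.refl Sym).invFun (ea a)) =
        ⟨some (some (entry c)), (false, none),
          machStacks (update (fun _ => []) inp (ea a)) []⟩ := by
      unfold Turing.initList
      congr 1
      funext k
      rcases k with _ | k
      · rfl
      · by_cases hk : k = inp
        · subst hk
          simp [tm, machStacks]
        · simp [tm, machStacks, hk]
    have e2 : Turing.haltList tm (List.map (Equiv.refl Δ).invFun (eb (f a))) =
        ⟨none, (false, none), machStacks (fun _ => []) ((l.map g).reverse ++ [])⟩ := by
      unfold Turing.haltList
      congr 1
      funext k
      rcases k with _ | k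
      · simp [tm, machStacks, hl]
      · simp [tm, machStacks]
    refine Eq.trans ?_ (Eq.trans hs' ?_)
    · exact congrArg (fun x => (flip bind (Turing.TM2.step (machine c out g)))^[_] (some x)) e1
    · exact congrArg some e2.symm
  · simp only [Polynomial.eval_add, Polynomial.eval_X, Polynomial.eval_one]
    simp only [update_self] at hlen
    omega

end Cmd

/-! ### Loops of stack programs -/

namespace Cmd

variable {K : Type} [DecidableEq K]

lemma Run.congr {c : Cmd K} {s s' s'' : Reg × (K → List Sym)} {t t' : ℕ} (h : Run c s s' t)
    (hs : s' = s'') (ht : t ≤ t') : Run c s s'' t' := hs ▸ h.weaken ht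

/-- Change of the stacks at both ends along equations. -/
lemma Run.cast {c : Cmd K} {r r' : Reg} {S S₁ S' S₁' : K → List Sym} {t t' : ℕ}
    (h : Run c (r, S₁) (r', S₁') t) (hS : S₁ = S) (hS' : S₁' = S') (ht : t ≤ t') :
    Run c (r, S) (r', S') t' := hS ▸ hS' ▸ h.weaken ht

/-- Pops symbols off the stack `k` and runs `body` after each, as long as they satisfy `p`; the
first symbol that does not satisfy `p` is popped as well. -/
def forEach (p : Sym → Bool) (k : K) (body : Cmd K) : Cmd K :=
  .seq (.pop k) (.loop (fun r => r.2.any p) (.seq body (.pop k)))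

/-- Pushes the symbol obtained by the last `pop` on the stack `k`. -/
def pushReg (k : K) : Cmd K := .push k fun r => r.2.getD none

/-- Does nothing. -/
def skip : Cmd K := .load id

/-- Moves the symbols satisfying `p` from the top of `src` to `dst`, and pops one more. -/
def move (p : Sym → Bool) (src dst : K) : Cmd K := forEach p src (pushReg dst)

/-- Symbolic execution of `forEach`. Here `G l` describes all stacks but `k` when the symbols `l`
are still to be treated, and `J` is an invariant of the flag. -/
lemma run_forEach {p : Sym → Bool} {k : K} {body : Cmd K} (J : Bool → Prop)
    (G : List Sym → K → List Sym) (l rest : List Sym) (T : ℕ)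
    (hp : ∀ x ∈ l, p x = true) (hrest : ∀ x ∈ rest.head?, p x = false)
    (step : ∀ x l', x :: l' <:+ l → ∀ b, J b → ∃ r', J r'.1 ∧
      Run body ((b, some x), update (G (x :: l')) k (l' ++ rest))
        (r', update (G l') k (l' ++ rest)) T)
    (r : Reg) (hr : J r.1) :
    ∃ b', J b' ∧ Run (forEach p k body) (r, update (G l) k (l ++ rest))
      ((b', rest.head?), update (G []) k rest.tail) ((l.length + 1) * (T + 2)) := by
  suffices H : ∀ b, J b → ∃ b', J b' ∧
      Run (.loop (fun r => r.2.any p) (.seq body (.pop k)))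
        ((b, (l ++ rest).head?), update (G l) k (l ++ rest).tail)
        ((b', rest.head?), update (G []) k rest.tail) (l.length * (T + 2) + 1) by
    obtain ⟨b', hb', h⟩ := H r.1 hr
    refine ⟨b', hb', ?_⟩
    refine (Run.seq (Run.pop _ _ _) ?_).weaken (t := 1 + (l.length * (T + 2) + 1)) ?_
    · simpa using h
    · ring_nf; omega
  induction l with
  | nil =>
    intro b hb
    refine ⟨b, hb, ?_⟩
    simp only [List.nil_append]
    refine (Run.loop_false ?_).weaken (by simp)
    rcases hh : rest.head? with _ | x
    · simp
    · simpa using hrest x (by simp [hh])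
  | cons x l ih =>
    intro b hb
    obtain ⟨r', hr', h1⟩ := step x l (List.suffix_refl _) b hb
    obtain ⟨b', hb', h2⟩ := ih (fun y hy => hp y (by simp [hy]))
      (fun y l' hl => step y l' (hl.trans (List.suffix_cons _ _))) r'.1 hr'
    refine ⟨b', hb', ?_⟩
    have h3 : Run (.seq body (.pop k)) ((b, some x), update (G (x :: l)) k (l ++ rest))
        ((r'.1, (l ++ rest).head?), update (G l) k (l ++ rest).tail) (T + 1) := by
      refine Run.seq h1 ((Run.pop _ _ _).congr ?_ le_rfl)
      simp
    refine (Run.loop_true (by simpa using hp x (by simp)) h3 h2).weaken ?_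
    rw [List.length_cons]; ring_nf; omega

/-- The unary mark. -/
def isMark (x : Sym) : Bool := x == some true

/-- `forEach` on a stack with a block of `u` marks on top; `F j` describes the other stacks after
`j` rounds. -/
lemma run_forMarks {k : K} {body : Cmd K} (J : Bool → Prop)
    (F : ℕ → K → List Sym) (u : ℕ) (rest : List Sym) (T : ℕ)
    (hrest : ∀ x ∈ rest.head?, isMark x = false)
    (step : ∀ j, j < u → ∀ b, J b → ∃ r', J r'.1 ∧
      Run body ((b, some (some true)),
          update (F j) k (List.replicate (u - 1 - j) (some true) ++ rest))
        (r', update (F (j + 1)) k (List.replicate (u - 1 - j) (some true) ++ rest)) T)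
    (r : Reg) (hr : J r.1) :
    ∃ b', J b' ∧ Run (forEach isMark k body)
      (r, update (F 0) k (List.replicate u (some true) ++ rest))
      ((b', rest.head?), update (F u) k rest.tail) ((u + 1) * (T + 2)) := by
  have := run_forEach (p := isMark) (k := k) (body := body) J (fun l => F (u - l.length))
    (List.replicate u (some true)) rest T
    (by intro x hx; rw [List.eq_of_mem_replicate hx]; rfl) hrest ?_ r hr
  · simpa using this
  · intro x l' hl b hb
    have hlen := hl.length_le
    have hmem : ∀ y ∈ x :: l', y = some true := fun y hy => List.eq_of_mem_replicate (hl.subset hy)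
    have hx := hmem x (by simp)
    have hl' : l' = List.replicate l'.length (some true) :=
      List.eq_replicate_of_mem fun y hy => hmem y (by simp [hy])
    simp only [List.length_cons, List.length_replicate] at hlen
    obtain ⟨r', hr', h⟩ := step (u - (l'.length + 1)) (by omega) b hb
    refine ⟨r', hr', ?_⟩
    have e1 : u - 1 - (u - (l'.length + 1)) = l'.length := by omega
    have e2 : u - (l'.length + 1) + 1 = u - l'.length := by omega
    rw [e1, e2, ← hl'] at h
    rw [hx]
    exact h

/-- The invariant is that the symbols popped so far are on `dst`, in reverse order. -/
lemma run_move {p : Sym → Bool} {src dst : K} (hne : src ≠ dst) (S : K → List Sym)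
    (l rest : List Sym) (hS : S src = l ++ rest)
    (hp : ∀ x ∈ l, p x = true) (hrest : ∀ x ∈ rest.head?, p x = false) (r : Reg) :
    Run (move p src dst) (r, S)
      ((r.1, rest.head?), update (update S src rest.tail) dst (l.reverse ++ S dst))
      ((l.length + 1) * 3) := by
  obtain ⟨b', hb', h⟩ := run_forEach (p := p) (k := src) (body := pushReg dst) (fun b => b = r.1)
    (fun l' => update S dst ((l.take (l.length - l'.length)).reverse ++ S dst)) l rest 1 hp hrest
    (by
      intro x l' hl b hb
      refine ⟨(b, some x), hb, (Run.push _ _ _ _).congr ?_ le_rfl⟩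
      obtain ⟨l0, rfl⟩ := hl
      simp only [Prod.mk.injEq, true_and]
      funext z
      by_cases hz : z = dst
      · subst hz
        simp only [update_self, update_of_ne hne.symm]
        have e1 : (l0 ++ x :: l').length - (x :: l').length = l0.length := by simp
        have e2 : (l0 ++ x :: l').length - l'.length = l0.length + 1 := by simp; omega
        rw [e1, e2, List.take_left, List.take_length_add_append]
        simp
      · by_cases hz' : z = src
        · subst hz'; simp [update_of_ne hz]
        · simp [hz, hz']) r rfl
  subst hb'
  have e : update (update S dst ((l.take (l.length - l.length)).reverse ++ S dst)) src (l ++ rest)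
      = S := by
    simp [← hS]
  rw [e] at h
  refine h.congr ?_ (by simp)
  simp only [List.length_nil, Nat.sub_zero, List.take_length]
  rw [update_comm hne]

end Cmd

/-! ### The stacks of the programs for graphs -/

/-- The working stacks: `inp` and `left` hold the part of the input to the right and to the left of
a reading position, `var i` holds the value of the `i`-th variable in unary, `cnt` the state of the
enclosing loops over the vertices, `acc` the results of the enclosing searches, and `out` the
reversed output. -/
inductive Stk (N : ℕ) : Type
  | inp | left | tmp | tmp2 | cnt | acc | out
  | var (i : Fin N)
  deriving DecidableEq, Fintype

/-- The contents of the working stacks, the variables being given by their values. -/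
@[ext] structure Mem (N : ℕ) : Type where
  inp : List Sym
  left : List Sym
  tmp : List Sym
  tmp2 : List Sym
  cnt : List Sym
  acc : List Sym
  out : List Sym
  var : Fin N → ℕ

namespace Mem

open Cmd

variable {N : ℕ}

/-- The stacks with the given contents. -/
def stk (m : Mem N) : Stk N → List Sym
  | .inp => m.inp
  | .left => m.left
  | .tmp => m.tmp
  | .tmp2 => m.tmp2
  | .cnt => m.cnt
  | .acc => m.acc
  | .out => m.out
  | .var i => List.replicate (m.var i) (some true)

variable (m : Mem N) (l : List Sym)

lemma update_inp : update m.stk .inp l = { m with inp := l }.stk := by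
  funext z; cases z <;> rfl
lemma update_left : update m.stk .left l = { m with left := l }.stk := by
  funext z; cases z <;> rfl
lemma update_tmp : update m.stk .tmp l = { m with tmp := l }.stk := by
  funext z; cases z <;> rfl
lemma update_tmp2 : update m.stk .tmp2 l = { m with tmp2 := l }.stk := by
  funext z; cases z <;> rfl
lemma update_cnt : update m.stk .cnt l = { m with cnt := l }.stk := by
  funext z; cases z <;> rfl
lemma update_acc : update m.stk .acc l = { m with acc := l }.stk := by
  funext z; cases z <;> rfl
lemma update_out : update m.stk .out l = { m with out := l }.stk := by
  funext z; cases z <;> rfl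
lemma update_var (i : Fin N) (c : ℕ) :
    update m.stk (.var i) (List.replicate c (some true)) =
      { m with var := update m.var i c }.stk := by
  funext z
  cases z with
  | var j =>
    by_cases h : j = i
    · subst h; simp [stk]
    · have : Stk.var j ≠ Stk.var i := by simpa using h
      simp [stk, h]
  | _ => rfl

lemma update_var_nil (i : Fin N) :
    update m.stk (.var i) [] = { m with var := update m.var i 0 }.stk :=
  update_var m i 0

lemma update_var_cons (i : Fin N) (c : ℕ) :
    update m.stk (.var i) (some true :: List.replicate c (some true)) =
      { m with var := update m.var i (c + 1) }.stk :=
  update_var m i (c + 1)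

variable {m} {m' : Mem N} {r : Reg}

lemma run_push {k : Stk N} {f : Reg → Sym}
    (h : update m.stk k (f r :: m.stk k) = m'.stk) :
    Run (.push k f) (r, m.stk) (r, m'.stk) 1 := h ▸ Run.push k f r m.stk

lemma run_pop {k : Stk N} {x : Option Sym} (hx : (m.stk k).head? = x)
    (h : update m.stk k (m.stk k).tail = m'.stk) :
    Run (.pop k) (r, m.stk) ((r.1, x), m'.stk) 1 := h ▸ hx ▸ Run.pop k r m.stk

lemma run_move {p : Sym → Bool} {src dst : Stk N} (hne : src ≠ dst) (l rest : List Sym)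
    (hS : m.stk src = l ++ rest) (hp : ∀ x ∈ l, p x = true)
    (hrest : ∀ x ∈ rest.head?, p x = false)
    (h : update (update m.stk src rest.tail) dst (l.reverse ++ m.stk dst) = m'.stk) :
    Run (move p src dst) (r, m.stk) ((r.1, rest.head?), m'.stk) ((l.length + 1) * 3) :=
  h ▸ Cmd.run_move hne m.stk l rest hS hp hrest r

lemma run_moveMarks {src dst : Stk N} (hne : src ≠ dst) (u : ℕ) (rest : List Sym)
    (hS : m.stk src = List.replicate u (some true) ++ rest)
    (hrest : ∀ x ∈ rest.head?, isMark x = false)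
    (h : update (update m.stk src rest.tail) dst (List.replicate u (some true) ++ m.stk dst)
      = m'.stk) :
    Run (move isMark src dst) (r, m.stk) ((r.1, rest.head?), m'.stk) ((u + 1) * 3) := by
  have := run_move (r := r) (m' := m') hne _ rest hS
    (fun x hx => by rw [List.eq_of_mem_replicate hx]; rfl) hrest (by simpa using h)
  simpa using this

end Mem

section Programs

open Cmd

variable {N : ℕ}

/-! ### The input tape -/

lemma drop_flatMap_of_length {α β : Type*} (f : α → List β) (c : ℕ) (hf : ∀ a, (f a).length = c)
    (l : List α) (j : ℕ) : (l.flatMap f).drop (j * c) = (l.drop j).flatMap f := by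
  induction j generalizing l with
  | zero => simp
  | succ j ih =>
    cases l with
    | nil => simp
    | cons a l =>
      rw [List.flatMap_cons, List.drop_succ_cons, ← ih, Nat.succ_mul, add_comm, ← hf a,
        List.drop_append]
      simp

section
variable {n : ℕ} (G : SimpleGraph (Fin n))

open Classical in
/-- A row of the adjacency matrix. -/
noncomputable def encRow (u : Fin n) : List Sym :=
  (List.finRange n).map fun v => some (decide (G.Adj u v))

lemma length_encRow (u : Fin n) : (encRow G u).length = n := by simp [encRow]

lemma isSome_of_mem_encRow (u : Fin n) : ∀ x ∈ encRow G u, x.isSome = true := by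
  intro x hx
  simp only [encRow, List.mem_map] at hx
  obtain ⟨v, -, rfl⟩ := hx
  rfl

lemma length_encodeGraph : (encodeGraph G).length = n * (n + 1) := by
  simp [encodeGraph, List.length_flatMap]

lemma drop_encodeGraph (u : Fin n) : (encodeGraph G).drop (u * (n + 1)) =
    encRow G u ++ none :: (encodeGraph G).drop ((u + 1) * (n + 1)) := by
  have h : ∀ u : Fin n, (encRow G u ++ [none]).length = n + 1 := by
    intro u; simp [length_encRow]
  have e : encodeGraph G = (List.finRange n).flatMap (fun u => encRow G u ++ [none]) := rfl
  rw [e, drop_flatMap_of_length _ _ h, drop_flatMap_of_length _ _ h]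
  have : (List.finRange n).drop u = u :: (List.finRange n).drop (u + 1) := by
    rw [List.drop_eq_getElem_cons (by simp)]
    simp
  rw [this, List.flatMap_cons]
  simp

open Classical in
lemma drop_encodeGraph_add (u v : Fin n) : (encodeGraph G).drop (u * (n + 1) + v) =
    some (decide (G.Adj u v)) :: (encodeGraph G).drop (u * (n + 1) + v + 1) := by
  have h : (encodeGraph G)[(u * (n + 1) + v : ℕ)]? = some (some (decide (G.Adj u v))) := by
    have := congrArg (fun l : List Sym => l[(v : ℕ)]?) (drop_encodeGraph G u)
    simp only [List.getElem?_drop] at this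
    rw [this, List.getElem?_append_left (by rw [length_encRow]; exact v.2)]
    simp [encRow]
  obtain ⟨hlt, he⟩ := List.getElem?_eq_some_iff.1 h
  rw [List.drop_eq_getElem_cons hlt, he]

lemma take_succ_of_drop_eq {α : Type*} {A : List α} {q : ℕ} {l : List α} {A' : List α}
    (h : A.drop q = l ++ A') : A.take (q + l.length) = A.take q ++ l := by
  rw [List.take_add, h, List.take_left]

end

/-- The contents of the stacks between the parts of a program: the input is in place, and the
auxiliary stacks are empty. -/
def home (A cnt acc out : List Sym) (e : Fin N → ℕ) : Mem N :=
  ⟨A, [], [], [], cnt, acc, out, e⟩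

/-- Moves the reading position to the beginning of the next row. -/
def skipRow : Cmd (Stk N) := .seq (move Option.isSome .inp .left) (.push .left fun _ => none)

/-- Pushes a mark. -/
def mark (k : Stk N) : Cmd (Stk N) := .push k fun _ => some true

/-- Sets the flag to the truth value of "the `i`-th and the `j`-th variable are adjacent". The
reading position is moved over as many rows as the `i`-th variable says, and then over as many
entries as the `j`-th one says; the variables are kept on `tmp` meanwhile. In the end the input is
rewound. -/
def adjCmd (i j : Fin N) : Cmd (Stk N) :=
  .seq (forEach isMark (.var i) (.seq (mark .tmp) skipRow)) <|
  .seq (move isMark .tmp (.var i)) <|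
  .seq (forEach isMark (.var j) (.seq (mark .tmp) (.seq (.pop .inp) (pushReg .left)))) <|
  .seq (move isMark .tmp (.var j)) <|
  .seq (.pop .inp) <|
  .seq (.load fun r => (r.2 == some (some true), r.2)) <|
  .seq (pushReg .inp) (move (fun _ => true) .left .inp)

/-- The contents of the stacks while position `q` of the input is read, with `t` marks stored on the
stack `tmp`. -/
def scan (A cnt acc out : List Sym) (e : Fin N → ℕ) (q t : ℕ) : Mem N :=
  ⟨A.drop q, (A.take q).reverse, List.replicate t (some true), [], cnt, acc, out, e⟩

section
variable {n : ℕ} (G : SimpleGraph (Fin n)) (cnt acc out : List Sym) (f : Fin N → ℕ)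

lemma run_skipRow (u : Fin n) (t : ℕ) (r : Reg) : ∃ r',
    Run skipRow (r, (scan (encodeGraph G) cnt acc out f (u * (n + 1)) t).stk)
      (r', (scan (encodeGraph G) cnt acc out f ((u + 1) * (n + 1)) t).stk) ((n + 1) * 3 + 1) := by
  have hd := drop_encodeGraph G u
  have ht : (encodeGraph G).take ((u + 1) * (n + 1)) =
      (encodeGraph G).take (u * (n + 1)) ++ (encRow G u ++ [none]) := by
    rw [← take_succ_of_drop_eq (A' := (encodeGraph G).drop ((u + 1) * (n + 1)))]
    · congr 1; simp [length_encRow]; ring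
    · rw [hd]; simp
  have h := Mem.run_move (p := Option.isSome) (src := Stk.inp) (dst := Stk.left) (by simp)
    (m := scan (encodeGraph G) cnt acc out f (u * (n + 1)) t) (r := r)
    (m' := { scan (encodeGraph G) cnt acc out f (u * (n + 1)) t with
      inp := (encodeGraph G).drop ((u + 1) * (n + 1))
      left := (encRow G u).reverse ++ ((encodeGraph G).take (u * (n + 1))).reverse })
    (encRow G u) (none :: (encodeGraph G).drop ((u + 1) * (n + 1)))
    (by rw [← hd]; rfl) (isSome_of_mem_encRow G u) (by simp)
    (by rw [Mem.update_inp, Mem.update_left]; rfl)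
  rw [length_encRow] at h
  refine ⟨_, h.seq (Mem.run_push ?_)⟩
  rw [Mem.update_left]
  simp [Mem.stk, scan, ht]

lemma run_readBit (q t : ℕ) (x : Sym) (A : List Sym) (hx : A.drop q = x :: A.drop (q + 1))
    (r : Reg) :
    Run (.seq (.pop .inp) (pushReg .left)) (r, (scan A cnt acc out f q t).stk)
      ((r.1, some x), (scan A cnt acc out f (q + 1) t).stk) 2 := by
  have ht : A.take (q + 1) = A.take q ++ [x] := take_succ_of_drop_eq (l := [x]) hx
  refine (Mem.run_pop (m' := { scan A cnt acc out f q t with inp := A.drop (q + 1) })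
    (x := some x) ?_ ?_).seq (Mem.run_push ?_)
  · simp [Mem.stk, scan, hx]
  · rw [Mem.update_inp]; simp [Mem.stk, scan, hx]
  · rw [Mem.update_left]
    simp [Mem.stk, scan, ht]

end

open Classical in
lemma run_adjCmd {n : ℕ} (G : SimpleGraph (Fin n)) (i j : Fin N) (e : Fin N → Fin n)
    (cnt acc out : List Sym) (r : Reg) :
    ∃ r', r'.1 = decide (G.Adj (e i) (e j)) ∧
      Run (adjCmd i j) (r, (home (encodeGraph G) cnt acc out fun i => e i).stk)
        (r', (home (encodeGraph G) cnt acc out fun i => e i).stk) (40 * (n + 1) ^ 2) := by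
  set A := encodeGraph G with hA
  set f : Fin N → ℕ := fun i => e i with hf
  have hi : (e i : ℕ) < n := (e i).2
  have hj : (e j : ℕ) < n := (e j).2
  have hfi : update (update f i 0) i (e i : ℕ) = f := by
    rw [update_idem]; exact update_eq_self i f
  have hfj : update (update f j 0) j (e j : ℕ) = f := by
    rw [update_idem]; exact update_eq_self j f
  obtain ⟨b1, -, h1⟩ := run_forMarks (k := Stk.var i)
    (body := .seq (mark .tmp) skipRow) (fun _ => True)
    (fun q => (scan A cnt acc out f (q * (n + 1)) q).stk) (e i) [] ((n + 1) * 3 + 2) (by simp)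
    (by
      intro q hq b _
      rw [List.append_nil, Mem.update_var, Mem.update_var]
      obtain ⟨r', h⟩ := run_skipRow G cnt acc out (update f i (e i - 1 - q)) ⟨q, hq.trans hi⟩
        (q + 1) (b, some (some true))
      refine ⟨r', trivial, (Run.seq (Mem.run_push ?_) h).weaken (by omega)⟩
      rw [Mem.update_tmp]; rfl) r trivial
  have h2 : Run (move isMark .tmp (.var i))
      ((b1, none), (scan A cnt acc out (update f i 0) (e i * (n + 1)) (e i)).stk)
      ((b1, none), (scan A cnt acc out f (e i * (n + 1)) 0).stk) (((e i : ℕ) + 1) * 3) :=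
    Mem.run_moveMarks (by simp) (e i) [] (by simp [scan, Mem.stk]) (by simp)
      (by simp [Mem.update_tmp, Mem.stk, scan, Mem.update_var, hfi])
  obtain ⟨b3, -, h3⟩ := run_forMarks (k := Stk.var j)
    (body := .seq (mark .tmp) (.seq (.pop .inp) (pushReg .left))) (fun _ => True)
    (fun q => (scan A cnt acc out f (e i * (n + 1) + q) q).stk) (e j) [] 3 (by simp)
    (by
      intro q hq b _
      rw [List.append_nil, Mem.update_var, Mem.update_var]
      have h := run_readBit cnt acc out (update f j (e j - 1 - q)) (e i * (n + 1) + q) (q + 1) _ A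
        (drop_encodeGraph_add G (e i) ⟨q, hq.trans hj⟩) (b, some (some true))
      refine ⟨_, trivial, (Run.seq (Mem.run_push ?_) h).weaken (by omega)⟩
      rw [Mem.update_tmp]; rfl) (b1, none) trivial
  have h4 : Run (move isMark .tmp (.var j))
      ((b3, none), (scan A cnt acc out (update f j 0) (e i * (n + 1) + e j) (e j)).stk)
      ((b3, none), (scan A cnt acc out f (e i * (n + 1) + e j) 0).stk) (((e j : ℕ) + 1) * 3) :=
    Mem.run_moveMarks (by simp) (e j) [] (by simp [scan, Mem.stk]) (by simp)
      (by simp [Mem.update_tmp, Mem.stk, scan, Mem.update_var, hfj])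
  set q := (e i : ℕ) * (n + 1) + e j with hq
  have hd := drop_encodeGraph_add G (e i) (e j)
  rw [← hq, ← hA] at hd
  have h5 : Run (.pop .inp) ((b3, none), (scan A cnt acc out f q 0).stk)
      ((b3, some (some (decide (G.Adj (e i) (e j))))),
        { scan A cnt acc out f q 0 with inp := A.drop (q + 1) }.stk) 1 :=
    Mem.run_pop (by simp [Mem.stk, scan, hd]) (by simp [Mem.update_inp, Mem.stk, scan, hd])
  have h6 := Run.load (fun r => (r.2 == some (some true), r.2))
    (b3, some (some (decide (G.Adj (e i) (e j)))))
    { scan A cnt acc out f q 0 with inp := A.drop (q + 1) }.stk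
  have h7 : Run (pushReg .inp)
      ((decide (G.Adj (e i) (e j)), some (some (decide (G.Adj (e i) (e j))))),
        { scan A cnt acc out f q 0 with inp := A.drop (q + 1) }.stk)
      (_, (scan A cnt acc out f q 0).stk) 1 :=
    Mem.run_push (by simp [Mem.update_inp, Mem.stk, scan, hd])
  have h8 : Run (move (fun _ => true) .left .inp)
      ((decide (G.Adj (e i) (e j)), some (some (decide (G.Adj (e i) (e j))))),
        (scan A cnt acc out f q 0).stk) (_, (home A cnt acc out f).stk) _ :=
    Mem.run_move (by simp) (A.take q).reverse [] (by simp [Mem.stk, scan]) (by simp) (by simp)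
      (by simp [Mem.update_inp, Mem.update_left, Mem.stk, scan, home])
  have hlen : (A.take q).reverse.length ≤ n * (n + 1) := by
    rw [List.length_reverse, ← length_encodeGraph G]
    exact List.length_take_le' _ _
  have e0 : update (scan A cnt acc out f (0 * (n + 1)) 0).stk (.var i)
      (List.replicate (e i) (some true) ++ []) = (home A cnt acc out f).stk := by
    rw [List.append_nil, Mem.update_var]
    have : update f i (e i : ℕ) = f := update_eq_self i f
    simp [scan, home, this]
  have e2 : update (scan A cnt acc out f (e i * (n + 1) + 0) 0).stk (.var j)
      (List.replicate (e j) (some true) ++ []) = (scan A cnt acc out f (e i * (n + 1)) 0).stk := by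
    rw [List.append_nil, Mem.update_var]
    have : update f j (e j : ℕ) = f := update_eq_self j f
    simp [scan, this]
  have e1 : update (scan A cnt acc out f (e i * (n + 1)) (e i)).stk (.var i) [] =
      (scan A cnt acc out (update f i 0) (e i * (n + 1)) (e i)).stk := by
    rw [Mem.update_var_nil]; rfl
  have e3 : update (scan A cnt acc out f q (e j)).stk (.var j) [] =
      (scan A cnt acc out (update f j 0) q (e j)).stk := by
    rw [Mem.update_var_nil]; rfl
  rw [e0] at h1
  rw [e2] at h3
  simp only [List.tail_nil, List.head?_nil] at h1 h3
  rw [e1] at h1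
  rw [e3] at h3
  have hb : (some (some (decide (G.Adj (e i) (e j)))) == some (some true)) =
      decide (G.Adj (e i) (e j)) := by
    by_cases h : G.Adj (e i) (e j) <;> simp [h]
  simp only [hb] at h6
  refine ⟨(decide (G.Adj (e i) (e j)), none), rfl,
    (h1.seq (h2.seq (h3.seq (h4.seq (h5.seq (h6.seq (h7.seq h8))))))).weaken ?_⟩
  have : (e i + 1 : ℕ) * ((n + 1) * 3 + 2 + 2) ≤ (n + 1) * ((n + 1) * 3 + 2 + 2) :=
    Nat.mul_le_mul_right _ (by omega)
  have h' : ((e j : ℕ) + 1) * 8 ≤ (n + 1) * 8 := Nat.mul_le_mul_right _ (by omega)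
  nlinarith

/-- Sets the flag to the truth value of "the `i`-th variable is smaller than the `j`-th". Marks are
taken from both variables until the `i`-th one is used up, and it is tested whether the `j`-th one
has another mark; `tmp` and `tmp2` keep the marks taken. -/
def ltCmd (i j : Fin N) : Cmd (Stk N) :=
  if i = j then .load fun r => (false, r.2) else
  .seq (forEach isMark (.var i) (.seq (mark .tmp) (.seq (.pop (.var j))
    (.ite (fun r => r.2.isSome) (mark .tmp2) skip)))) <|
  .seq (.seq (.pop (.var j)) (.seq (.load fun r => (r.2.isSome, r.2))
    (.ite (fun r => r.2.isSome) (mark (.var j)) skip))) <|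
  .seq (move isMark .tmp2 (.var j)) (move isMark .tmp (.var i))

lemma run_ltCmd (i j : Fin N) (f : Fin N → ℕ) (A cnt acc out : List Sym) (r : Reg) (b : ℕ)
    (hb : f i ≤ b) (hb' : f j ≤ b) :
    ∃ r', r'.1 = decide (f i < f j) ∧
      Run (ltCmd i j) (r, (home A cnt acc out f).stk) (r', (home A cnt acc out f).stk)
        (20 * (b + 1)) := by
  by_cases hij : i = j
  · subst hij
    refine ⟨(false, r.2), ?_, ?_⟩
    · simp
    · simp only [ltCmd, if_true]
      exact (Run.load (fun r => (false, r.2)) _ _).weaken (by omega)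
  have hji : j ≠ i := fun h => hij h.symm
  -- the stacks after `q` marks have been popped from both variables, the `i`-th one being `c`
  let M (q c : ℕ) : Mem N := ⟨A, [], List.replicate q (some true),
    List.replicate (min q (f j)) (some true), cnt, acc, out, update (update f j (f j - q)) i c⟩
  obtain ⟨b1, -, h1⟩ := run_forMarks (k := Stk.var i)
    (body := .seq (mark .tmp) (.seq (.pop (.var j))
      (.ite (fun r => r.2.isSome) (mark .tmp2) skip))) (fun _ => True)
    (fun q => (M q 0).stk) (f i) [] 4 (by simp)
    (by
      intro q hq b _
      rw [List.append_nil, Mem.update_var, Mem.update_var]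
      simp only [M, update_idem]
      have h1 : Run (mark .tmp) ((b, some (some true)), (M q (f i - 1 - q)).stk)
          (_, { M q (f i - 1 - q) with tmp := List.replicate (q + 1) (some true) }.stk) 1 :=
        Mem.run_push (by simp [Mem.update_tmp, Mem.stk, M, List.replicate_succ])
      rcases lt_or_ge q (f j) with hlt | hle
      · have h2 : Run (.pop (.var j)) ((b, some (some true)),
            { M q (f i - 1 - q) with tmp := List.replicate (q + 1) (some true) }.stk)
            ((b, some (some true)), { M (q + 1) (f i - 1 - q) with
              tmp2 := List.replicate (min q (f j)) (some true) }.stk) 1 := by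
          refine Mem.run_pop ?_ ?_
          · simp [Mem.stk, M, hji, List.head?_replicate]; omega
          · simp only [Mem.stk, List.tail_replicate, Mem.update_var]
            congr 1
            ext z
            all_goals try rfl
            simp only [M, update_of_ne hji, update_self]
            by_cases hz : z = i
            · subst hz; simp [hij]
            · by_cases hz' : z = j
              · subst hz'; simp [hji]; omega
              · simp [hz, hz']
        have h3 : Run (mark .tmp2) ((b, some (some true)), { M (q + 1) (f i - 1 - q) with
              tmp2 := List.replicate (min q (f j)) (some true) }.stk)
              ((b, some (some true)), (M (q + 1) (f i - 1 - q)).stk) 1 := by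
          refine Mem.run_push ?_
          rw [Mem.update_tmp2]
          congr 1
          have : min (q + 1) (f j) = min q (f j) + 1 := by omega
          simp [M, Mem.stk, this, List.replicate_succ]
        exact ⟨(b, some (some true)), trivial,
          (h1.seq (h2.seq (h3.ite_true rfl))).weaken (by omega)⟩
      · have h2 : Run (.pop (.var j)) ((b, some (some true)),
            { M q (f i - 1 - q) with tmp := List.replicate (q + 1) (some true) }.stk)
            ((b, none), (M (q + 1) (f i - 1 - q)).stk) 1 := by
          refine Mem.run_pop ?_ ?_
          · simp [Mem.stk, M, hji, List.head?_replicate]; omega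
          · simp only [Mem.stk, List.tail_replicate, Mem.update_var]
            congr 1
            ext z
            all_goals try rfl
            · have : min (q + 1) (f j) = min q (f j) := by omega
              simp [M, this]
            simp only [M, update_of_ne hji, update_self]
            by_cases hz : z = i
            · subst hz; simp [hij]
            · by_cases hz' : z = j
              · subst hz'; simp [hji]; omega
              · simp [hz, hz']
        have h3 := Run.load id (b, none) (M (q + 1) (f i - 1 - q)).stk
        exact ⟨(b, none), trivial,
          (h1.seq (h2.seq (h3.ite_false rfl))).weaken (by omega)⟩) r trivial
  have e0 : update (M 0 0).stk (.var i) (List.replicate (f i) (some true) ++ []) =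
      (home A cnt acc out f).stk := by
    rw [List.append_nil, Mem.update_var]
    simp [M, home]
  have e1 : update (M (f i) 0).stk (.var i) [] = (M (f i) 0).stk := by
    rw [Mem.update_var_nil]
    simp [M]
  rw [e0, List.tail_nil, e1, List.head?_nil] at h1
  -- the rest of the `j`-th variable tells the result, and the variables are restored
  have h2 : ∃ x : Option Sym, x.isSome = decide (f i < f j) ∧
      Run (.seq (.pop (.var j)) (.seq (.load fun r => (r.2.isSome, r.2))
        (.ite (fun r => r.2.isSome) (mark (.var j)) skip))) ((b1, none), (M (f i) 0).stk)
        ((x.isSome, x), (M (f i) 0).stk) 4 := by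
    rcases lt_or_ge (f i) (f j) with hlt | hle
    · obtain ⟨c, hc⟩ : ∃ c, f j - f i = c + 1 := ⟨f j - f i - 1, by omega⟩
      refine ⟨some (some true), by simp [hlt], ?_⟩
      have h2 : Run (.pop (.var j)) ((b1, none), (M (f i) 0).stk) ((b1, some (some true)),
          { M (f i) 0 with var := update (M (f i) 0).var j c }.stk) 1 := by
        refine Mem.run_pop ?_ ?_
        · simp [Mem.stk, M, hji, hc, List.replicate_succ]
        · rw [← Mem.update_var]; simp [Mem.stk, M, hji, hc]
      have h3 := Run.load (fun r => (r.2.isSome, r.2)) (b1, some (some true))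
        { M (f i) 0 with var := update (M (f i) 0).var j c }.stk
      have h4 : Run (mark (.var j)) ((true, some (some true)),
          { M (f i) 0 with var := update (M (f i) 0).var j c }.stk)
          ((true, some (some true)), (M (f i) 0).stk) 1 := by
        refine Mem.run_push ?_
        simp only [Mem.stk, update_self, Mem.update_var_cons, update_idem]
        congr 1
        ext z
        all_goals try rfl
        simp only
        rw [← hc]
        by_cases hz : z = j
        · subst hz; simp [M, hji]
        · simp [hz]
      exact h2.seq (h3.seq (h4.ite_true rfl))
    · refine ⟨none, by simpa using hle, ?_⟩
      have h2 : Run (.pop (.var j)) ((b1, none), (M (f i) 0).stk) ((b1, none),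
          (M (f i) 0).stk) 1 := by
        have : f j - f i = 0 := by omega
        refine Mem.run_pop ?_ ?_
        · simp [Mem.stk, M, hji, this]
        · simp [Mem.stk, M, hji, this, Mem.update_var_nil]
          congr 1
          ext z
          all_goals try rfl
          by_cases hz : z = j
          · subst hz; simp [hji]
          · simp [hz]
      have h3 := Run.load (fun r => (r.2.isSome, r.2)) (b1, none) (M (f i) 0).stk
      exact h2.seq (h3.seq ((Run.load id _ _).ite_false rfl))
  obtain ⟨x, hx, h2⟩ := h2
  have h3 : Run (move isMark .tmp2 (.var j)) ((x.isSome, x), (M (f i) 0).stk) ((x.isSome, none),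
      { home A cnt acc out (update f i 0) with tmp := List.replicate (f i) (some true) }.stk)
      ((min (f i) (f j) + 1) * 3) := by
    refine Mem.run_moveMarks (by simp) _ [] (by simp [Mem.stk, M]) (by simp) ?_
    simp only [Mem.update_tmp2, Mem.stk, List.replicate_append_replicate, Mem.update_var]
    congr 1
    ext z
    all_goals try rfl
    by_cases hz : z = j
    · subst hz; simp [M, hji, home]; omega
    · by_cases hz' : z = i
      · subst hz'; simp [M, hij, home]
      · simp [M, hz, hz', home]
  have h4 : Run (move isMark .tmp (.var i)) ((x.isSome, none),
      { home A cnt acc out (update f i 0) with tmp := List.replicate (f i) (some true) }.stk)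
      ((x.isSome, none), (home A cnt acc out f).stk) ((f i + 1) * 3) := by
    refine Mem.run_moveMarks (by simp) _ [] (by simp [Mem.stk]) (by simp) ?_
    simp [Mem.update_tmp, Mem.stk, home, Mem.update_var]
  refine ⟨(x.isSome, none), hx, ?_⟩
  rw [ltCmd, if_neg hij]
  refine (h1.seq (h2.seq (h3.seq h4))).weaken ?_
  omega

/-! ### Loops over the vertices -/

/-- Executes `body` for all values of the `i`-th variable in increasing order, and restores the
value of the variable. The number of vertices is not stored anywhere: it is read off the first row
of the input, whose length is copied in unary to `cnt`. There the counter stands on top of the old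
value of the variable and of the data of the enclosing loops, separated from each by `none`. -/
def forVar (i : Fin N) (body : Cmd (Stk N)) : Cmd (Stk N) :=
  .seq (.push .cnt fun _ => none) <|
  .seq (move isMark (.var i) .cnt) <|
  .seq (.push .cnt fun _ => none) <|
  .seq (move Option.isSome .inp .left) <|
  .seq (.push .inp fun _ => none) <|
  .seq (forEach Option.isSome .left (.seq (pushReg .inp) (mark .cnt))) <|
  .seq (forEach isMark .cnt (.seq body (mark (.var i)))) <|
  .seq (forEach isMark (.var i) skip) (move isMark .cnt (.var i))

/-- Symbolic execution of `forVar`, where `acc v` and `out v` are the contents of these stacks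
before the round for the vertex `v`. -/
lemma run_forVar {n : ℕ} (G : SimpleGraph (Fin n)) (hn : 0 < n) (i : Fin N) (body : Cmd (Stk N))
    (e : Fin N → ℕ) (he : e i ≤ n) (acc out : ℕ → List Sym) (T : ℕ)
    (hbody : ∀ v < n, ∀ cnt r, ∃ r', Run body
      (r, (home (encodeGraph G) cnt (acc v) (out v) (update e i v)).stk)
      (r', (home (encodeGraph G) cnt (acc (v + 1)) (out (v + 1)) (update e i v)).stk) T)
    (cnt : List Sym) (r : Reg) :
    ∃ r', Run (forVar i body) (r, (home (encodeGraph G) cnt (acc 0) (out 0) e).stk)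
      (r', (home (encodeGraph G) cnt (acc n) (out n) e).stk) ((n + 1) * (T + 30)) := by
  set A := encodeGraph G with hA
  set row := encRow G ⟨0, hn⟩ with hrow
  have hd : A = row ++ none :: A.drop (n + 1) := by
    have := drop_encodeGraph G ⟨0, hn⟩
    simpa using this
  set A' := A.drop (n + 1) with hA'
  have hlen : row.length = n := length_encRow G _
  have hsome : ∀ x ∈ row, x.isSome = true := isSome_of_mem_encRow G _
  -- what the stack `cnt` keeps below the counter of this loop
  set c₁ : List Sym := List.replicate (e i) (some true) ++ none :: cnt with hc₁
  set e₀ := update e i 0 with he₀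
  have h1 : Run (.push .cnt fun _ => none) (r, (home A cnt (acc 0) (out 0) e).stk)
      (r, (home A (none :: cnt) (acc 0) (out 0) e).stk) 1 :=
    Mem.run_push (by simp [Mem.update_cnt, Mem.stk, home])
  have h2 : Run (move isMark (.var i) .cnt) (r, (home A (none :: cnt) (acc 0) (out 0) e).stk)
      ((r.1, none), (home A c₁ (acc 0) (out 0) e₀).stk) ((e i + 1) * 3) :=
    Mem.run_moveMarks (by simp) _ [] (by simp [Mem.stk, home]) (by simp)
      (by simp [Mem.update_var_nil, Mem.update_cnt, Mem.stk, home, hc₁, he₀])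
  have h3 : Run (.push .cnt fun _ => none) ((r.1, none), (home A c₁ (acc 0) (out 0) e₀).stk)
      ((r.1, none), (home A (none :: c₁) (acc 0) (out 0) e₀).stk) 1 :=
    Mem.run_push (by simp [Mem.update_cnt, Mem.stk, home])
  have h4 : Run (move Option.isSome .inp .left)
      ((r.1, none), (home A (none :: c₁) (acc 0) (out 0) e₀).stk)
      ((r.1, some none), { home A' (none :: c₁) (acc 0) (out 0) e₀ with left := row.reverse }.stk)
      ((row.length + 1) * 3) :=
    Mem.run_move (by simp) row (none :: A') (by rw [← hd]; rfl) hsome (by simp)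
      (by simp [Mem.update_inp, Mem.update_left, Mem.stk, home])
  have h5 : Run (.push .inp fun _ => none)
      ((r.1, some none), { home A' (none :: c₁) (acc 0) (out 0) e₀ with left := row.reverse }.stk)
      ((r.1, some none), { home (none :: A') (none :: c₁) (acc 0) (out 0) e₀ with
        left := row.reverse }.stk) 1 :=
    Mem.run_push (by simp [Mem.update_inp, Mem.stk, home])
  -- moving the row back, with a mark on `cnt` for each of its entries
  obtain ⟨b6, -, h6⟩ := run_forEach (p := Option.isSome) (k := Stk.left)
    (body := .seq (pushReg .inp) (mark .cnt)) (fun _ => True)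
    (fun l => { home (row.drop l.length ++ none :: A')
      (List.replicate (n - l.length) (some true) ++ none :: c₁) (acc 0) (out 0) e₀ with
        left := [] }.stk) row.reverse [] 2 (fun x hx => hsome x (List.mem_reverse.1 hx)) (by simp)
    (by
      intro x l ⟨l0, hl⟩ b _
      have hr : row = l.reverse ++ x :: l0.reverse := by
        have := congrArg List.reverse hl
        simpa using this.symm
      have hn' : n = l.length + 1 + l0.length := by
        rw [← hlen, hr]; simp; omega
      have q1 : n - l.length = n - (l.length + 1) + 1 := by omega
      have q2 : row.drop (l.length + 1) = l0.reverse := by rw [hr]; simp [List.drop_append]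
      have q3 : row.drop l.length = x :: l0.reverse := by rw [hr]; simp
      rw [List.append_nil, Mem.update_left, Mem.update_left]
      simp only [List.length_cons]
      rw [q1, q2, q3, List.replicate_succ]
      exact ⟨(b, some x), trivial, Run.seq
        (Mem.run_push (m' := { home (x :: l0.reverse ++ none :: A')
          (List.replicate (n - (l.length + 1)) (some true) ++ none :: c₁) (acc 0) (out 0) e₀ with
            left := l }) (by simp [Mem.update_inp, Mem.stk, home]))
        (Mem.run_push (by simp [Mem.update_cnt, Mem.stk, home]))⟩) (r.1, some none) trivial
  have e6 : update { home (row.drop row.reverse.length ++ none :: A')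
      (List.replicate (n - row.reverse.length) (some true) ++ none :: c₁) (acc 0) (out 0) e₀ with
        left := [] }.stk .left (row.reverse ++ []) =
      { home (none :: A') (none :: c₁) (acc 0) (out 0) e₀ with left := row.reverse }.stk := by
    simp [Mem.update_left, home, hlen, List.drop_eq_nil_of_le hlen.le]
  have e6' : update { home (row.drop ([] : List Sym).length ++ none :: A')
      (List.replicate (n - ([] : List Sym).length) (some true) ++ none :: c₁) (acc 0) (out 0) e₀
        with left := [] }.stk .left ([] : List Sym).tail =
      (home A (List.replicate n (some true) ++ none :: c₁) (acc 0) (out 0) e₀).stk := by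
    simp [Mem.update_left, home, ← hd]
  rw [e6, e6'] at h6
  obtain ⟨b7, -, h7⟩ := run_forMarks (k := Stk.cnt) (body := .seq body (mark (.var i)))
    (fun _ => True) (fun v => (home A [] (acc v) (out v) (update e i v)).stk) n (none :: c₁) (T + 1)
    (by simp [isMark])
    (by
      intro v hv b _
      rw [Mem.update_cnt, Mem.update_cnt]
      obtain ⟨r', h⟩ := hbody v hv (List.replicate (n - 1 - v) (some true) ++ none :: c₁)
        (b, some (some true))
      refine ⟨r', trivial, h.seq (Mem.run_push ?_)⟩
      simp [Mem.stk, home, Mem.update_var_cons]) (b6, none) trivial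
  rw [Mem.update_cnt, Mem.update_cnt] at h7
  obtain ⟨b8, -, h8⟩ := run_forMarks (k := Stk.var i) (body := skip) (fun _ => True)
    (fun _ => (home A c₁ (acc n) (out n) e₀).stk) n [] 1 (by simp)
    (fun v hv b _ => ⟨(b, some (some true)), trivial, Run.load id _ _⟩) (b7, some none) trivial
  rw [List.append_nil, Mem.update_var, List.tail_nil, Mem.update_var_nil] at h8
  have h9 : Run (move isMark .cnt (.var i)) ((b8, none), (home A c₁ (acc n) (out n) e₀).stk)
      ((b8, some none), (home A cnt (acc n) (out n) e).stk) ((e i + 1) * 3) :=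
    Mem.run_moveMarks (by simp) _ (none :: cnt) (by simp [Mem.stk, home, hc₁]) (by simp [isMark])
      (by simp [Mem.update_cnt, Mem.stk, home, he₀, Mem.update_var])
  have h7' : Run (forEach isMark .cnt (.seq body (mark (.var i)))) ((b6, none),
        (home A (List.replicate n (some true) ++ none :: c₁) (acc 0) (out 0) e₀).stk)
      ((b7, some none), (home A c₁ (acc n) (out n) (update e i n)).stk)
      ((n + 1) * (T + 1 + 2)) := h7
  have h8' : Run (forEach isMark (.var i) skip) ((b7, some none),
        (home A c₁ (acc n) (out n) (update e i n)).stk)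
      ((b8, none), (home A c₁ (acc n) (out n) e₀).stk) ((n + 1) * (1 + 2)) := by
    simpa [home, he₀] using h8
  refine ⟨(b8, some none), (h1.seq (h2.seq (h3.seq (h4.seq (h5.seq (h6.seq (h7'.seq
    (h8'.seq h9)))))))).weaken ?_⟩
  rw [hlen, List.length_reverse, hlen]
  have : (e i + 1) * 3 ≤ (n + 1) * 3 := by omega
  nlinarith

/-! ### First-order formulas with a least-element operator -/

/-- First-order formulas about ordered graphs, with variables `0, …, N - 1`. The only quantifier is
`first i φ ψ`, which says that there is a value of the `i`-th variable satisfying `φ`, and that the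
least such value satisfies `ψ`. -/
inductive Form (N : ℕ) : Type
  | adj (i j : Fin N)
  | lt (i j : Fin N)
  | tt
  | neg (φ : Form N)
  | and (φ ψ : Form N)
  | first (i : Fin N) (φ ψ : Form N)

namespace Form

variable {n : ℕ}

/-- The truth of a formula in the graph `G`, with its vertices in their natural order. -/
def Sat (G : SimpleGraph (Fin n)) : Form N → (Fin N → Fin n) → Prop
  | adj i j, e => G.Adj (e i) (e j)
  | lt i j, e => e i < e j
  | tt, _ => True
  | neg φ, e => ¬ Sat G φ e
  | and φ ψ, e => Sat G φ e ∧ Sat G ψ e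
  | first i φ ψ, e => ∃ v, Sat G φ (update e i v) ∧ (∀ w < v, ¬ Sat G φ (update e i w)) ∧
      Sat G ψ (update e i v)

/-- The program that sets the flag to the truth value of a formula. The state of the search for the
least witness of `φ` in `first i φ ψ` is kept on top of the stack `acc`: it is `none` as long as
none has been found, and then `some b`, where `b` is the truth value of `ψ`. -/
def eval : Form N → Cmd (Stk N)
  | adj i j => adjCmd i j
  | lt i j => ltCmd i j
  | tt => .load fun r => (true, r.2)
  | neg φ => .seq (eval φ) (.load fun r => (!r.1, r.2))
  | and φ ψ => .seq (eval φ) (.ite (fun r => r.1) (eval ψ) skip)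
  | first i φ ψ =>
      .seq (.push .acc fun _ => none) <|
      .seq (forVar i (.seq (.pop .acc) (.ite (fun r => r.2 == some none)
        (.seq (eval φ) (.ite (fun r => r.1)
          (.seq (eval ψ) (.push .acc fun r => some r.1)) (.push .acc fun _ => none)))
        (pushReg .acc)))) <|
      .seq (.pop .acc) (.load fun r => (r.2 == some (some true), r.2))

open Classical in
/-- The state of the search for the least number satisfying `P` after the numbers below `v` have
been tried; `Q` is the property that is tested for the least number. -/
noncomputable def searchState (P Q : ℕ → Prop) : ℕ → Sym
  | 0 => none
  | v + 1 => (searchState P Q v).or (if P v then some (decide (Q v)) else none)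

lemma searchState_eq_none {P Q : ℕ → Prop} {v : ℕ} :
    searchState P Q v = none ↔ ∀ w < v, ¬ P w := by
  induction v with
  | zero => simp [searchState]
  | succ v ih =>
    rw [searchState, Option.or_eq_none_iff, ih]
    constructor
    · rintro ⟨h, h'⟩ w hw
      rcases Nat.lt_succ_iff_lt_or_eq.1 hw with hw | rfl
      · exact h w hw
      · intro hP; simp [hP] at h'
    · intro h
      exact ⟨fun w hw => h w (by omega), by simp [h v (by omega)]⟩

lemma searchState_eq_true {P Q : ℕ → Prop} {v : ℕ} :
    searchState P Q v = some true ↔ ∃ w < v, P w ∧ (∀ x < w, ¬ P x) ∧ Q w := by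
  induction v with
  | zero => simp [searchState]
  | succ v ih =>
    rw [searchState, Option.or_eq_some_iff, ih, searchState_eq_none]
    constructor
    · rintro (⟨w, hw, h⟩ | ⟨h, h'⟩)
      · exact ⟨w, by omega, h⟩
      · by_cases hP : P v
        · exact ⟨v, by omega, hP, h, by simpa [hP] using h'⟩
        · simp [hP] at h'
    · rintro ⟨w, hw, h⟩
      rcases Nat.lt_succ_iff_lt_or_eq.1 hw with hw | rfl
      · exact Or.inl ⟨w, hw, h⟩
      · exact Or.inr ⟨h.2.1, by simp [h.1, h.2.2]⟩

open Classical in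
/-- Formulas are evaluated correctly and in polynomial time. -/
theorem exists_run_eval (φ : Form N) : ∃ p : Polynomial ℕ, ∀ {n : ℕ} (_ : 0 < n)
    (G : SimpleGraph (Fin n)) (e : Fin N → Fin n) (cnt acc out : List Sym) (r : Reg),
    ∃ r', (r'.1 = true ↔ φ.Sat G e) ∧
      Run (eval φ) (r, (home (encodeGraph G) cnt acc out fun i => e i).stk)
        (r', (home (encodeGraph G) cnt acc out fun i => e i).stk) (p.eval n) := by
  induction φ with
  | adj i j =>
    refine ⟨40 * (Polynomial.X + 1) ^ 2, fun hn G e cnt acc out r => ?_⟩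
    obtain ⟨r', h, h'⟩ := run_adjCmd G i j e cnt acc out r
    exact ⟨r', by simp [h, Sat], h'.weaken (by simp)⟩
  | lt i j =>
    refine ⟨20 * (Polynomial.X + 1), fun hn G e cnt acc out r => ?_⟩
    obtain ⟨r', h, h'⟩ := run_ltCmd i j (fun i => (e i : ℕ)) (encodeGraph G) cnt acc out r _
      (e i).2.le (e j).2.le
    exact ⟨r', by simp [h, Sat], h'.weaken (by simp)⟩
  | tt =>
    refine ⟨1, fun hn G e cnt acc out r => ⟨(true, r.2), by simp [Sat], ?_⟩⟩
    exact (Run.load (fun r => (true, r.2)) _ _).weaken (by simp)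
  | neg φ ih =>
    obtain ⟨p, hp⟩ := ih
    refine ⟨p + 1, fun hn G e cnt acc out r => ?_⟩
    obtain ⟨r', h, h'⟩ := hp hn G e cnt acc out r
    refine ⟨(!r'.1, r'.2), by simp [Sat, ← h], ?_⟩
    exact (h'.seq (Run.load (fun r => (!r.1, r.2)) _ _)).weaken (by simp)
  | and φ ψ ih ih' =>
    obtain ⟨p, hp⟩ := ih
    obtain ⟨q, hq⟩ := ih'
    refine ⟨p + q + 2, fun hn G e cnt acc out r => ?_⟩
    obtain ⟨r', h, h'⟩ := hp hn G e cnt acc out r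
    by_cases hs : φ.Sat G e
    · obtain ⟨r'', k, k'⟩ := hq hn G e cnt acc out r'
      refine ⟨r'', by simp [k, Sat, hs], ?_⟩
      exact (h'.seq (k'.ite_true (h.2 hs))).weaken (by simp; omega)
    · refine ⟨r', by simp [h, Sat, hs], ?_⟩
      exact (h'.seq ((Run.load id _ _).ite_false (by simpa [← h] using hs))).weaken
        (by simp only [Polynomial.eval_add, Polynomial.eval_ofNat]; omega)
  | first i φ ψ ih ih' =>
    obtain ⟨p, hp⟩ := ih
    obtain ⟨q, hq⟩ := ih'
    refine ⟨(Polynomial.X + 1) * (p + q + 40) + 5, fun {n} hn G e cnt acc out r => ?_⟩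
    have hupd : ∀ v (hv : v < n), (fun j => (update e i ⟨v, hv⟩ j : ℕ)) =
        update (fun j => (e j : ℕ)) i v := by
      intro v hv
      funext j
      by_cases hj : j = i
      · subst hj; simp
      · simp [hj]
    let P : ℕ → Prop := fun v => ∃ hv : v < n, φ.Sat G (update e i ⟨v, hv⟩)
    let Q : ℕ → Prop := fun v => ∃ hv : v < n, ψ.Sat G (update e i ⟨v, hv⟩)
    have hres : (searchState P Q n == some true) = true ↔ (first i φ ψ).Sat G e := by
      rw [beq_iff_eq, searchState_eq_true]
      constructor
      · rintro ⟨w, hw, ⟨hw', hP⟩, hmin, ⟨hw'', hQ⟩⟩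
        exact ⟨⟨w, hw⟩, hP, fun x hx hPx => hmin x hx ⟨x.2, hPx⟩, hQ⟩
      · rintro ⟨w, hP, hmin, hQ⟩
        exact ⟨w, w.2, ⟨w.2, hP⟩, fun x hx ⟨hx', hPx⟩ => hmin ⟨x, hx'⟩ hx hPx, ⟨w.2, hQ⟩⟩
    obtain ⟨r1, h1⟩ := run_forVar G hn i (e := fun j => (e j : ℕ)) (he := (e i).2.le)
      (acc := fun v => searchState P Q v :: acc) (out := fun _ => out)
      (T := p.eval n + q.eval n + 5)
      (body := (.seq (.pop .acc) (.ite (fun r => r.2 == some none)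
        (.seq (eval φ) (.ite (fun r => r.1)
          (.seq (eval ψ) (.push .acc fun r => some r.1)) (.push .acc fun _ => none)))
        (pushReg .acc))))
      (hbody := by
        intro v hv cnt r
        have h0 : Run (.pop .acc) (r, (home (encodeGraph G) cnt (searchState P Q v :: acc) out
              (update (fun j => (e j : ℕ)) i v)).stk)
            ((r.1, some (searchState P Q v)), (home (encodeGraph G) cnt acc out
              (update (fun j => (e j : ℕ)) i v)).stk) 1 :=
          Mem.run_pop (by simp [Mem.stk, home]) (by simp [Mem.stk, home, Mem.update_acc])
        rcases hs : searchState P Q v with _ | b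
        · rw [hs] at h0
          obtain ⟨r1, k1, k1'⟩ := hp hn G (update e i ⟨v, hv⟩) cnt acc out (r.1, some none)
          rw [hupd v hv] at k1'
          by_cases hP : φ.Sat G (update e i ⟨v, hv⟩)
          · obtain ⟨r2, k2, k2'⟩ := hq hn G (update e i ⟨v, hv⟩) cnt acc out r1
            rw [hupd v hv] at k2'
            have hs' : searchState P Q (v + 1) = some r2.1 := by
              have hP' : P v := ⟨hv, hP⟩
              have hQ' : Q v ↔ ψ.Sat G (update e i ⟨v, hv⟩) := ⟨fun h => h.2, fun h => ⟨hv, h⟩⟩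
              simp only [searchState, hs, hP', if_true, Option.none_or, Option.some.injEq]
              exact Bool.eq_iff_iff.2
                ((@decide_eq_true_iff (Q v) (Classical.propDecidable _)).trans (hQ'.trans k2.symm))
            refine ⟨r2, (h0.seq (Run.ite_true rfl (k1'.seq (Run.ite_true (k1.2 hP)
              (k2'.seq (Mem.run_push ?_)))))).weaken ?_⟩
            · simp [Mem.update_acc, hs', home, Mem.stk]
            · omega
          · have hs' : searchState P Q (v + 1) = none := by
              have hP' : ¬ P v := fun h => hP h.2
              simp [searchState, hs, hP']
            refine ⟨r1, (h0.seq (Run.ite_true rfl (k1'.seq (Run.ite_false (by simpa [← k1] using hP)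
              (Mem.run_push ?_))))).weaken ?_⟩
            · simp [Mem.update_acc, hs', home, Mem.stk]
            · omega
        · rw [hs] at h0
          have hs' : searchState P Q (v + 1) = some b := by simp [searchState, hs]
          refine ⟨_, (h0.seq (Run.ite_false (by simp) (Mem.run_push ?_))).weaken ?_⟩
          · simp [Mem.update_acc, hs', home, Mem.stk]
          · omega) (cnt := cnt) (r := r)
    have h0 : Run (.push .acc fun _ => none)
        (r, (home (encodeGraph G) cnt acc out fun j => (e j : ℕ)).stk)
        (r, (home (encodeGraph G) cnt (searchState P Q 0 :: acc) out fun j => (e j : ℕ)).stk) 1 :=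
      Mem.run_push (by simp [Mem.update_acc, home, Mem.stk, searchState])
    have h2 : Run (.pop .acc)
        (r1, (home (encodeGraph G) cnt (searchState P Q n :: acc) out fun j => (e j : ℕ)).stk)
        ((r1.1, some (searchState P Q n)),
          (home (encodeGraph G) cnt acc out fun j => (e j : ℕ)).stk) 1 :=
      Mem.run_pop (by simp [Mem.stk, home]) (by simp [Mem.stk, home, Mem.update_acc])
    have h3 := Run.load (fun r => (r.2 == some (some true), r.2)) (r1.1, some (searchState P Q n))
      (home (encodeGraph G) cnt acc out fun j => (e j : ℕ)).stk
    refine ⟨_, ?_, (h0.seq (h1.seq (h2.seq h3))).weaken ?_⟩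
    · exact hres
    · simp only [Polynomial.eval_add, Polynomial.eval_mul, Polynomial.eval_X, Polynomial.eval_one,
        Polynomial.eval_ofNat]
      nlinarith

end Form

/-! ### Problems that are defined by formulas -/

variable {n : ℕ}

/-- A loop whose body writes `piece v` writes the concatenation of all these, in reverse order as is
everything on the stack `out`. -/
lemma run_forVar_append (G : SimpleGraph (Fin n)) (hn : 0 < n) (i : Fin N)
    (body : Cmd (Stk N)) (e : Fin N → Fin n) (acc out cnt : List Sym) (T : ℕ)
    (piece : Fin n → List Sym)
    (hbody : ∀ v cnt out r, ∃ r', Run body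
      (r, (home (encodeGraph G) cnt acc out fun j => update e i v j).stk)
      (r', (home (encodeGraph G) cnt acc ((piece v).reverse ++ out) fun j => update e i v j).stk) T)
    (r : Reg) :
    ∃ r', Run (forVar i body) (r, (home (encodeGraph G) cnt acc out fun j => e j).stk)
      (r', (home (encodeGraph G) cnt acc (((List.finRange n).flatMap piece).reverse ++ out)
        fun j => e j).stk) ((n + 1) * (T + 30)) := by
  have hupd : ∀ v (hv : v < n), (fun j => (update e i ⟨v, hv⟩ j : ℕ)) =
      update (fun j => (e j : ℕ)) i v := by
    intro v hv
    funext j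
    by_cases hj : j = i
    · subst hj; simp
    · simp [hj]
  have := run_forVar G hn i body (fun j => (e j : ℕ)) (e i).2.le (fun _ => acc)
    (fun v => (((List.finRange n).take v).flatMap piece).reverse ++ out) T
    (by
      intro v hv cnt r
      obtain ⟨r', h⟩ := hbody ⟨v, hv⟩ cnt
        ((((List.finRange n).take v).flatMap piece).reverse ++ out) r
      rw [hupd v hv] at h
      refine ⟨r', ?_⟩
      have : (List.finRange n).take (v + 1) = (List.finRange n).take v ++ [⟨v, hv⟩] := by
        rw [List.take_succ_eq_append_getElem (by simpa using hv)]
        simp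
      rw [this]
      simpa using h) cnt r
  simpa [List.take_of_length_le] using this

lemma run_skip (r : Reg) (S : Stk N → List Sym) : Run skip (r, S) (r, S) 1 := Run.load id r S

/-- Empties the input stack. -/
def clear : Cmd (Stk N) := forEach (fun _ => true) .inp skip

lemma run_clear (A out : List Sym) (e : Fin N → ℕ) (r : Reg) :
    ∃ r', Run clear (r, (home A [] [] out e).stk) (r', (home [] [] [] out e).stk)
      ((A.length + 1) * 3) := by
  obtain ⟨b, -, h⟩ := run_forEach (p := fun _ => true) (k := Stk.inp) (body := skip) (fun _ => True)
    (fun _ => (home [] [] [] out e).stk) A [] 1 (by simp) (by simp)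
    (fun x l _ b _ => ⟨_, trivial, Run.load id (b, some x) _⟩) r trivial
  refine ⟨_, h.cast ?_ ?_ le_rfl⟩ <;> simp [Mem.update_inp, home]

lemma update_inp_eq_home (A : List Sym) :
    update (fun _ : Stk N => ([] : List Sym)) .inp A = (home A [] [] [] fun _ => 0).stk := by
  funext z; cases z <;> rfl

lemma update_out_eq_home (out : List Sym) :
    update (fun _ : Stk N => ([] : List Sym)) .out out = (home [] [] [] out fun _ => 0).stk := by
  funext z; cases z <;> rfl

lemma eval_mono (p : Polynomial ℕ) {a b : ℕ} (h : a ≤ b) : p.eval a ≤ p.eval b := by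
  rw [Polynomial.eval_eq_sum, Polynomial.eval_eq_sum]
  exact Finset.sum_le_sum fun i _ => Nat.mul_le_mul_left _ (Nat.pow_le_pow_left h i)

lemma ConnectedSplitGraph.pos (G : ConnectedSplitGraph) : 0 < G.n := by
  have := G.connected.nonempty
  exact Fin.pos_iff_nonempty.2 this

lemma ConnectedSplitGraph.length_encode (G : ConnectedSplitGraph) :
    G.encode.length = G.n * (G.n + 1) := length_encodeGraph _

lemma ConnectedSplitGraph.le_length_encode (G : ConnectedSplitGraph) : G.n ≤ G.encode.length := by
  rw [G.length_encode]; nlinarith [G.pos]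

/-- Properties of graphs defined by a sentence are decidable in polynomial time. -/
theorem polyTime_sentence (φ : Form N) (f : ConnectedSplitGraph → Bool)
    (hf : ∀ G (e : Fin N → Fin G.n), f G = true ↔ φ.Sat G.graph e) :
    Nonempty (Turing.TM2ComputableInPolyTime ConnectedSplitGraph.encode
      Computability.encodeBool f) := by
  obtain ⟨p, hp⟩ := φ.exists_run_eval
  refine polyTime_of_run (.seq φ.eval (.seq (.push .out fun r => some r.1) clear)) Stk.inp Stk.out
    (fun x => x.getD false) _ _ _ (p + 1 + (Polynomial.X + 1) * 3) fun G => ?_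
  obtain ⟨r1, h1, h1'⟩ := hp G.pos G.graph (fun _ => ⟨0, G.pos⟩) [] [] [] (false, none)
  obtain ⟨r2, h2⟩ := run_clear (N := N) G.encode [some r1.1] (fun _ => 0) r1
  have h3 : Run (.push .out fun r => some r.1)
      (r1, (home (N := N) G.encode [] [] [] fun _ => 0).stk)
      (r1, (home G.encode [] [] [some r1.1] fun _ => 0).stk) 1 :=
    Mem.run_push (by simp [Mem.update_out, Mem.stk, home])
  refine ⟨r2, [some r1.1], ?_, ?_⟩
  · have : f G = r1.1 := by rw [Bool.eq_iff_iff, hf, h1]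
    simp [Computability.encodeBool, this]
  · rw [update_inp_eq_home, update_out_eq_home]
    refine (h1'.seq (h3.seq h2)).weaken ?_
    have := eval_mono p G.le_length_encode
    simp only [Polynomial.eval_add, Polynomial.eval_mul, Polynomial.eval_X, Polynomial.eval_one,
      Polynomial.eval_ofNat]
    omega

open Classical in
lemma flatMap_ite_eq_replicate {α β : Type*} (P : α → Prop) (b : β) (l : List α) :
    l.flatMap (fun t => if P t then [b] else []) =
      List.replicate (l.countP fun t => decide (P t)) b := by
  induction l with
  | nil => rfl
  | cons a l ih =>
    by_cases h : P a
    · simp [h, ih, List.replicate_succ]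
    · simp [h, ih]

/-- The program that writes the colouring in which the edge `uv` has as its colour the number of
vertices `t` satisfying `χ`, where `iu`, `iv` and `it` are the variables for `u`, `v` and `t`. -/
def colourCmd (iu iv it : Fin N) (χ : Form N) : Cmd (Stk N) :=
  forVar iu <| .seq
    (forVar iv <| .seq
      (.seq (Form.adj iu iv).eval (.ite (fun r => r.1)
        (.seq (mark .out) (forVar it (.seq χ.eval (.ite (fun r => r.1) (mark .out) skip)))) skip))
      (.push .out fun _ => some false))
    (.push .out fun _ => none)

open Classical in
/-- Colourings whose colours are numbers of vertices satisfying a formula are computable in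
polynomial time. -/
theorem polyTime_colouring (iu iv it : Fin N) (χ : Form N)
    (c : (G : ConnectedSplitGraph) → EdgeColouring G.graph)
    (hc : ∀ G (e : Fin N → Fin G.n) u v (h : G.graph.Adj u v), c G ⟨s(u, v), h⟩ =
      (Finset.univ.filter fun t => χ.Sat G.graph (update (update (update e iu u) iv v) it t)).card)
    (hne : iu ≠ iv) :
    Nonempty (Turing.TM2ComputableInPolyTime ConnectedSplitGraph.encode
      (id : List (Option Bool) → List (Option Bool)) fun G => encodeColouring (c G)) := by
  obtain ⟨p, hp⟩ := χ.exists_run_eval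
  obtain ⟨q, hq⟩ := (Form.adj iu iv).exists_run_eval
  refine polyTime_of_run (.seq (colourCmd iu iv it χ) clear) Stk.inp Stk.out id _ _ _
    ((Polynomial.X + 1) *
        (((Polynomial.X + 1) * (q + ((Polynomial.X + 1) * (p + 40) + 5) + 40)) + 40) +
      (Polynomial.X + 1) * 3) fun G => ?_
  set e : Fin N → Fin G.n := fun _ => ⟨0, G.pos⟩ with he
  -- the pieces of the output
  let entry (u v : Fin G.n) : List Sym :=
    (if h : G.graph.Adj u v then List.replicate (c G ⟨s(u, v), h⟩ + 1) (some true) else []) ++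
      [some false]
  let row (u : Fin G.n) : List Sym := (List.finRange G.n).flatMap (entry u) ++ [none]
  have hrow : encodeColouring (c G) = (List.finRange G.n).flatMap row := rfl
  have hin : ∀ u v cnt out r, ∃ r', Run
      (forVar it (.seq χ.eval (.ite (fun r => r.1) (mark .out) skip)))
      (r, (home (encodeGraph G.graph) cnt [] out fun j => update (update e iu u) iv v j).stk)
      (r', (home (encodeGraph G.graph) cnt [] (List.replicate
        (Finset.univ.filter fun t => χ.Sat G.graph (update (update (update e iu u) iv v) it t)).card
        (some true) ++ out) fun j => update (update e iu u) iv v j).stk)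
      ((G.n + 1) * (p.eval G.n + 2 + 30)) := by
    intro u v cnt out r
    obtain ⟨r', h⟩ := run_forVar_append G.graph G.pos it
      (.seq χ.eval (.ite (fun r => r.1) (mark .out) skip)) (update (update e iu u) iv v) [] out cnt
      (p.eval G.n + 2) (fun t => if χ.Sat G.graph (update (update (update e iu u) iv v) it t)
        then [some true] else [])
      (by
        intro t cnt out r
        obtain ⟨r1, h1, h1'⟩ := hp G.pos G.graph (update (update (update e iu u) iv v) it t) cnt []
          out r
        by_cases hs : χ.Sat G.graph (update (update (update e iu u) iv v) it t)
        · refine ⟨r1, h1'.seq (Run.ite_true (h1.2 hs) (Mem.run_push ?_))⟩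
          simp [hs, Mem.update_out, home, Mem.stk]
        · refine ⟨r1, h1'.seq (Run.ite_false (by simpa [← h1] using hs) ?_)⟩
          simpa [hs] using run_skip r1 _) r
    refine ⟨r', ?_⟩
    have hcount : ∀ (P : Fin G.n → Prop),
        (List.finRange G.n).flatMap (fun t => if P t then [some true] else []) =
          List.replicate (Finset.univ.filter P).card (some true : Sym) := by
      intro P
      rw [flatMap_ite_eq_replicate]
      congr 1
      rw [List.countP_eq_length_filter]
      rfl
    rw [hcount, List.reverse_replicate] at h
    exact h
  have hentry : ∀ u v cnt out r, ∃ r', Run (.seq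
      (.seq (Form.adj iu iv).eval (.ite (fun r => r.1)
        (.seq (mark .out) (forVar it (.seq χ.eval (.ite (fun r => r.1) (mark .out) skip)))) skip))
      (.push .out fun _ => some false))
      (r, (home (encodeGraph G.graph) cnt [] out fun j => update (update e iu u) iv v j).stk)
      (r', (home (encodeGraph G.graph) cnt [] ((entry u v).reverse ++ out)
        fun j => update (update e iu u) iv v j).stk)
      (q.eval G.n + (1 + (G.n + 1) * (p.eval G.n + 2 + 30) + 1) + 1) := by
    intro u v cnt out r
    obtain ⟨r1, h1, h1'⟩ := hq G.pos G.graph (update (update e iu u) iv v) cnt [] out r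
    have hadj : (Form.adj iu iv).Sat G.graph (update (update e iu u) iv v) ↔ G.graph.Adj u v := by
      simp [Form.Sat, hne]
    rw [hadj] at h1
    by_cases hs : G.graph.Adj u v
    · have h2 : Run (mark .out)
        (r1, (home (encodeGraph G.graph) cnt [] out fun j => update (update e iu u) iv v j).stk)
        (r1, (home (encodeGraph G.graph) cnt [] (some true :: out)
          fun j => update (update e iu u) iv v j).stk) 1 :=
        Mem.run_push (by simp [Mem.update_out, home, Mem.stk])
      obtain ⟨r3, h3⟩ := hin u v cnt (some true :: out) r1
      rw [← hc G e u v hs] at h3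
      refine ⟨r3, (h1'.seq (Run.ite_true (h1.2 hs) (h2.seq h3))).seq (Mem.run_push ?_)⟩
      have key : ∀ (k : ℕ) (l : List Sym), List.replicate k (some true) ++ some true :: l =
          List.replicate (k + 1) (some true) ++ l := by simp [List.replicate_succ']
      simp [Mem.update_out, home, Mem.stk, entry, hs, key]
    · refine ⟨r1, ((h1'.seq (Run.ite_false (by simpa [← h1] using hs)
        (Run.load id r1 _))).seq (Mem.run_push ?_)).weaken ?_⟩
      · simp [Mem.update_out, home, Mem.stk, entry, hs]
      · omega
  have hline : ∀ u cnt out r, ∃ r', Run (.seq (forVar iv (.seq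
      (.seq (Form.adj iu iv).eval (.ite (fun r => r.1)
        (.seq (mark .out) (forVar it (.seq χ.eval (.ite (fun r => r.1) (mark .out) skip)))) skip))
      (.push .out fun _ => some false))) (.push .out fun _ => none))
      (r, (home (encodeGraph G.graph) cnt [] out fun j => update e iu u j).stk)
      (r', (home (encodeGraph G.graph) cnt [] ((row u).reverse ++ out)
        fun j => update e iu u j).stk)
      ((G.n + 1) * (q.eval G.n + (1 + (G.n + 1) * (p.eval G.n + 2 + 30) + 1) + 1 + 30) + 1) := by
    intro u cnt out r
    obtain ⟨r1, h1⟩ := run_forVar_append G.graph G.pos iv _ (update e iu u) [] out cnt _ (entry u)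
      (hentry u) r
    refine ⟨r1, h1.seq (Mem.run_push ?_)⟩
    simp [Mem.update_out, home, Mem.stk, row]
  obtain ⟨r1, h1⟩ := run_forVar_append G.graph G.pos iu _ e [] [] [] _ row hline (false, none)
  rw [← hrow] at h1
  obtain ⟨r2, h2⟩ := run_clear (N := N) G.encode ((encodeColouring (c G)).reverse ++ [])
    (fun j => e j) r1
  refine ⟨r2, (encodeColouring (c G)).reverse ++ [], by simp, ?_⟩
  rw [update_inp_eq_home, update_out_eq_home]
  refine (h1.seq h2).weaken ?_
  have := eval_mono p G.le_length_encode
  have := eval_mono q G.le_length_encode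
  have := G.le_length_encode
  simp only [Polynomial.eval_add, Polynomial.eval_mul, Polynomial.eval_X, Polynomial.eval_one,
      Polynomial.eval_ofNat]
  refine Nat.add_le_add ?_ le_rfl
  have k1 : (G.n + 1) * (p.eval G.n + 2 + 30) ≤
      (G.encode.length + 1) * (p.eval G.encode.length + 40) := Nat.mul_le_mul (by omega) (by omega)
  have k2 : (G.n + 1) * (q.eval G.n + (1 + (G.n + 1) * (p.eval G.n + 2 + 30) + 1) + 1 + 30) ≤
      (G.encode.length + 1) * (q.eval G.encode.length +
        ((G.encode.length + 1) * (p.eval G.encode.length + 40) + 5) + 40) :=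
    Nat.mul_le_mul (by omega) (by omega)
  exact Nat.mul_le_mul (by omega) (by omega)

end Programs

/-! ### Rainbow connection by colour sets -/

section Via

variable {V : Type*} {G : SimpleGraph V} {col : V → V → ℕ}

/-- There is a walk from `u` to `v` whose edges have distinct colours, all in `S`. -/
inductive Via (G : SimpleGraph V) (col : V → V → ℕ) : Set ℕ → V → V → Prop
  | refl (S u) : Via G col S u u
  | cons {S u v w} : G.Adj u v → col u v ∈ S → Via G col (S \ {col u v}) v w → Via G col S u w

lemma Via.mono {S T : Set ℕ} {u v : V} (h : Via G col S u v) (hST : S ⊆ T) : Via G col T u v := by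
  induction h generalizing T with
  | refl S u => exact .refl _ _
  | cons ha hc _ ih => exact .cons ha (hST hc) (ih (Set.sdiff_subset_sdiff_left hST))

lemma Via.single {S : Set ℕ} {u v : V} (h : G.Adj u v) (hc : col u v ∈ S) : Via G col S u v :=
  .cons h hc (.refl _ _)

lemma Via.trans {S T : Set ℕ} {u v w : V} (h : Via G col S u v) (h' : Via G col T v w)
    (hd : Disjoint S T) : Via G col (S ∪ T) u w := by
  induction h with
  | refl S u => exact h'.mono Set.subset_union_right
  | @cons S u v x ha hc _ ih =>
    refine .cons ha (Or.inl hc) ((ih h' (hd.mono_left Set.sdiff_subset)).mono ?_)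
    rintro y (⟨hy, hne⟩ | hy)
    · exact ⟨Or.inl hy, hne⟩
    · refine ⟨Or.inr hy, ?_⟩
      rintro rfl
      exact Set.disjoint_left.1 hd hc hy

lemma Via.trans' {S T R : Set ℕ} {u v w : V} (h : Via G col S u v) (h' : Via G col T v w)
    (hd : Disjoint S T) (hS : S ⊆ R) (hT : T ⊆ R) : Via G col R u w :=
  (h.trans h' hd).mono (Set.union_subset hS hT)

lemma Via.symm (hsymm : ∀ u v, G.Adj u v → col u v = col v u) {S : Set ℕ} {u v : V}
    (h : Via G col S u v) : Via G col S v u := by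
  induction h with
  | refl S u => exact .refl _ _
  | @cons S u v w ha hc _ ih =>
    refine ih.trans' (T := {col u v}) (.single ha.symm (hsymm _ _ ha.symm)) ?_ Set.sdiff_subset ?_
    · exact Set.disjoint_sdiff_left
    · simpa using hc

lemma Via.exists_walk (c : EdgeColouring G) (hc : ∀ u v (h : G.Adj u v), c ⟨s(u, v), h⟩ = col u v)
    {S : Set ℕ} {u v : V} (h : Via G col S u v) :
    ∃ p : G.Walk u v, (∀ e : G.edgeSet, e.1 ∈ p.edges → c e ∈ S) ∧
      ∀ e f : G.edgeSet, e.1 ∈ p.edges → f.1 ∈ p.edges → c e = c f → e = f := by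
  induction h with
  | refl S u => exact ⟨.nil, by simp, by simp⟩
  | @cons S u v w ha hS _ ih =>
    obtain ⟨p, hp, hp'⟩ := ih
    have key : ∀ e : G.edgeSet, e.1 ∈ (SimpleGraph.Walk.cons ha p).edges →
        e = ⟨s(u, v), ha⟩ ∧ c e = col u v ∨ e.1 ∈ p.edges ∧ c e ∈ S ∧ c e ≠ col u v := by
      intro e he
      rw [SimpleGraph.Walk.edges_cons, List.mem_cons] at he
      rcases he with he | he
      · have : e = ⟨s(u, v), ha⟩ := Subtype.ext he
        exact Or.inl ⟨this, by rw [this, hc]⟩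
      · exact Or.inr ⟨he, (hp e he).1, (hp e he).2⟩
    refine ⟨.cons ha p, fun e he => ?_, fun e f he hf hef => ?_⟩
    · rcases key e he with ⟨-, h⟩ | ⟨-, h, -⟩
      · rw [h]; exact hS
      · exact h
    · rcases key e he with ⟨h1, h2⟩ | ⟨h1, -, h2⟩ <;> rcases key f hf with ⟨k1, k2⟩ | ⟨k1, -, k2⟩
      · rw [h1, k1]
      · exact absurd (hef.symm.trans h2) k2
      · exact absurd (hef.trans k2) h2
      · exact hp' e f h1 k1 hef

lemma Via.exists_isRainbowPath (c : EdgeColouring G)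
    (hc : ∀ u v (h : G.Adj u v), c ⟨s(u, v), h⟩ = col u v) {S : Set ℕ} {u v : V}
    (h : Via G col S u v) : ∃ p : G.Walk u v, IsRainbowPath c p := by
  classical
  obtain ⟨p, -, hp⟩ := h.exists_walk c hc
  exact ⟨p.bypass, p.bypass_isPath, fun e f he hf =>
    hp e f (p.edges_bypass_subset_edges he) (p.edges_bypass_subset_edges hf)⟩

end Via

/-! ### Pendant vertices and cores -/

section Core

variable {V : Type*} (G : SimpleGraph V)

/-- `v` is a pendant vertex: it has exactly one neighbour. -/
def Pend (v : V) : Prop := ∃ u, G.Adj v u ∧ ∀ w, G.Adj v w → w = u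

/-- `K` is a clique without pendant vertices whose complement is independent, and it is maximal as
far as the non-pendant vertices are concerned. -/
structure IsCore (K : Set V) : Prop where
  clique : ∀ u ∈ K, ∀ v ∈ K, u ≠ v → G.Adj u v
  indep : ∀ u ∉ K, ∀ v ∉ K, ¬ G.Adj u v
  not_pend : ∀ u ∈ K, ¬ Pend G u
  maximal : ∀ w ∉ K, ¬ Pend G w → ∃ u ∈ K, ¬ G.Adj w u

variable {G}

lemma Pend.eq {v u w : V} (h : Pend G v) (hu : G.Adj v u) (hw : G.Adj v w) : u = w := by
  obtain ⟨x, -, hx⟩ := h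
  rw [hx u hu, hx w hw]

namespace IsCore

variable {K : Set V} (hK : IsCore G K)
include hK

lemma notMem_of_pend {s : V} (hs : Pend G s) : s ∉ K := fun h => hK.not_pend s h hs

lemma mem_of_adj {w u : V} (hw : w ∉ K) (h : G.Adj w u) : u ∈ K := by
  by_contra hu
  exact hK.indep w hw u hu h

lemma mem_of_pend_adj {s h : V} (hs : Pend G s) (hh : G.Adj s h) : h ∈ K :=
  hK.mem_of_adj (hK.notMem_of_pend hs) hh

lemma exists_adj_ne (hconn : G.Connected) {w : V} (hw : w ∉ K) (hp : ¬ Pend G w) (y : V) :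
    ∃ x, G.Adj w x ∧ x ≠ y := by
  by_contra! h
  obtain ⟨u, hu, -⟩ := hK.maximal w hw hp
  have : ∃ x, G.Adj w x := by
    have hne : w ≠ u := fun h => hw (h ▸ hu)
    obtain ⟨p⟩ := hconn.preconnected w u
    cases p with
    | nil => exact absurd rfl hne
    | cons ha _ => exact ⟨_, ha⟩
  obtain ⟨x, hx⟩ := this
  exact hp ⟨y, h x hx ▸ hx, h⟩

end IsCore

end Core

/-- Rainbow connection follows from the existence of suitable walks between the three kinds of
vertices: core vertices, pendant vertices, and the others. The pendant edges are coloured by their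
pendant vertices. -/
lemma via_of_core {n : ℕ} {G : SimpleGraph (Fin n)} {K : Set (Fin n)} (hK : IsCore G K)
    {col : Fin n → Fin n → ℕ} (hsymm : ∀ u v, G.Adj u v → col u v = col v u)
    (hpend : ∀ s h, Pend G s → G.Adj s h → col s h = s)
    (hPK : ∀ s h, Pend G s → G.Adj s h → ∀ t ∈ K, Via G col {(s : ℕ)}ᶜ h t)
    (hPP : ∀ s h s' h', Pend G s → G.Adj s h → Pend G s' → G.Adj s' h' → s ≠ s' →
      Via G col {(s : ℕ), (s' : ℕ)}ᶜ h h')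
    (hWK : ∀ w ∉ K, ¬ Pend G w → ∀ t ∈ K, Via G col Set.univ w t)
    (hWP : ∀ w ∉ K, ¬ Pend G w → ∀ s h, Pend G s → G.Adj s h → Via G col {(s : ℕ)}ᶜ w h)
    (hWW : ∀ w ∉ K, ¬ Pend G w → ∀ w' ∉ K, ¬ Pend G w' → w ≠ w' → Via G col Set.univ w w')
    (u v : Fin n) : Via G col Set.univ u v := by
  have symm : ∀ {S : Set ℕ} {u v}, Via G col S u v → Via G col S v u := fun h => h.symm hsymm
  -- a walk ending at the host of a pendant vertex extends to the pendant vertex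
  have ext : ∀ s h x, Pend G s → G.Adj s h → Via G col {(s : ℕ)}ᶜ x h → Via G col Set.univ x s := by
    intro s h x hs hh hx
    refine hx.trans' (T := {(s : ℕ)}) (.single hh.symm ?_) disjoint_compl_left (Set.subset_univ _)
      (Set.subset_univ _)
    rw [hsymm _ _ hh.symm, hpend s h hs hh]; rfl
  by_cases huv : u = v
  · subst huv; exact .refl _ _
  by_cases hu : u ∈ K
  · by_cases hv : v ∈ K
    · exact .single (hK.clique u hu v hv huv) (Set.mem_univ _)
    · by_cases hp : Pend G v
      · obtain ⟨h, hh, -⟩ := id hp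
        exact ext v h u hp hh (symm (hPK v h hp hh u hu))
      · exact symm (hWK v hv hp u hu)
  · by_cases hp : Pend G u
    · obtain ⟨h, hh, -⟩ := id hp
      by_cases hv : v ∈ K
      · exact symm (ext u h v hp hh (symm (hPK u h hp hh v hv)))
      · by_cases hp' : Pend G v
        · obtain ⟨h', hh', -⟩ := id hp'
          refine ext v h' u hp' hh' ?_
          refine Via.trans' (S := {(u : ℕ)}) (.single hh (hpend u h hp hh))
            (hPP u h v h' hp hh hp' hh' huv) ?_ ?_ ?_
          · simp
          · simpa using fun h => huv (Fin.ext h.symm)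
          · simp
        · exact symm (ext u h v hp hh (hWP v hv hp' u h hp hh))
    · by_cases hv : v ∈ K
      · exact hWK u hu hp v hv
      · by_cases hp' : Pend G v
        · obtain ⟨h', hh', -⟩ := id hp'
          exact ext v h' u hp' hh' (hWP u hu hp v h' hp' hh')
        · exact hWW u hu hp v hv hp' huv

/-! ### Colourings in which every pendant edge is coloured by its pendant vertex -/

section Painting

variable {n : ℕ} {G : SimpleGraph (Fin n)} {K : Set (Fin n)} {kcol wcol : Fin n → Fin n → ℕ}

open Classical in
/-- The colour of the edge `uv`: a pendant edge gets its pendant vertex as its colour, the other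
edges within `K` are coloured by `kcol`, and those from a vertex outside `K` by `wcol`, which takes
the vertex outside `K` as its first argument. -/
noncomputable def paint (G : SimpleGraph (Fin n)) (K : Set (Fin n)) (kcol wcol : Fin n → Fin n → ℕ)
    (u v : Fin n) : ℕ :=
  if Pend G u then u else if Pend G v then v else
    if u ∈ K then if v ∈ K then kcol u v else wcol v u else wcol u v

/-- The edge colouring given by `paint`; an edge is read from its smaller to its larger end. -/
noncomputable def painting (G : SimpleGraph (Fin n)) (K : Set (Fin n))
    (kcol wcol : Fin n → Fin n → ℕ) : EdgeColouring G :=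
  fun e => paint G K kcol wcol e.1.inf e.1.sup

lemma paint_pend {s h : Fin n} (hs : Pend G s) : paint G K kcol wcol s h = s := by
  simp [paint, hs]

namespace IsCore

variable (hK : IsCore G K)
include hK

lemma not_pend_of_pend_adj {s h : Fin n} (hs : Pend G s) (hh : G.Adj s h) : ¬ Pend G h :=
  hK.not_pend h (hK.mem_of_pend_adj hs hh)

lemma paint_symm (hsymm : ∀ u v, kcol u v = kcol v u) {u v : Fin n} (h : G.Adj u v) :
    paint G K kcol wcol u v = paint G K kcol wcol v u := by
  unfold paint
  by_cases hu : Pend G u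
  · simp [hu, hK.not_pend_of_pend_adj hu h]
  by_cases hv : Pend G v
  · simp [hv, hu]
  by_cases hu' : u ∈ K <;> by_cases hv' : v ∈ K <;> simp [hu, hv, hu', hv', hsymm u v]
  exact absurd h (hK.indep u hu' v hv')

lemma painting_apply (hsymm : ∀ u v, kcol u v = kcol v u) (u v : Fin n) (h : G.Adj u v) :
    painting G K kcol wcol ⟨s(u, v), h⟩ = paint G K kcol wcol u v := by
  rcases le_total u v with huv | huv
  · simp [painting, huv]
  · rw [hK.paint_symm hsymm h]
    simp [painting, huv]

lemma paint_core {u v : Fin n} (hu : u ∈ K) (hv : v ∈ K) : paint G K kcol wcol u v = kcol u v := by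
  simp [paint, hK.not_pend, hu, hv]

lemma paint_out {w u : Fin n} (hw : w ∉ K) (hp : ¬ Pend G w) (h : G.Adj w u) :
    paint G K kcol wcol w u = wcol w u := by
  simp [paint, hK.not_pend, hK.mem_of_adj hw h, hw, hp]

lemma paint_out' (hsymm : ∀ u v, kcol u v = kcol v u) {w u : Fin n} (hw : w ∉ K) (hp : ¬ Pend G w)
    (h : G.Adj w u) : paint G K kcol wcol u w = wcol w u := by
  rw [hK.paint_symm hsymm h.symm, hK.paint_out hw hp h]

lemma adj {u v : Fin n} (hu : u ∈ K) (hv : v ∈ K) (h : u ≠ v) : G.Adj u v := hK.clique u hu v hv h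

/-- A painting is a rainbow colouring if the walks required by `via_of_core` exist. -/
lemma isRainbowColouring_painting {c : Fin n → Fin n → ℕ} (hc : c = paint G K kcol wcol)
    (hsymm : ∀ u v, kcol u v = kcol v u)
    (hPK : ∀ s h, Pend G s → G.Adj s h → ∀ t ∈ K, Via G c {(s : ℕ)}ᶜ h t)
    (hPP : ∀ s h s' h', Pend G s → G.Adj s h → Pend G s' → G.Adj s' h' → s ≠ s' →
      Via G c {(s : ℕ), (s' : ℕ)}ᶜ h h')
    (hWK : ∀ w ∉ K, ¬ Pend G w → ∀ t ∈ K, Via G c Set.univ w t)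
    (hWP : ∀ w ∉ K, ¬ Pend G w → ∀ s h, Pend G s → G.Adj s h →
      Via G c {(s : ℕ)}ᶜ w h)
    (hWW : ∀ w ∉ K, ¬ Pend G w → ∀ w' ∉ K, ¬ Pend G w' → w ≠ w' →
      Via G c Set.univ w w') :
    IsRainbowColouring (painting G K kcol wcol) := by
  subst hc
  exact fun u v => (via_of_core hK (fun _ _ h => hK.paint_symm hsymm h)
    (fun _ _ hs _ => paint_pend hs)
    hPK hPP hWK hWP hWW u v).exists_isRainbowPath _ (hK.painting_apply hsymm)

/-- The colours of a painting. -/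
lemma painting_mem {S : Set ℕ} (hsymm : ∀ u v, kcol u v = kcol v u)
    (hP : ∀ s, Pend G s → (s : ℕ) ∈ S)
    (hk : ∀ u ∈ K, ∀ v ∈ K, u ≠ v → kcol u v ∈ S)
    (hw : ∀ w ∉ K, ¬ Pend G w → ∀ u, G.Adj w u → wcol w u ∈ S) (e : G.edgeSet) :
    painting G K kcol wcol e ∈ S := by
  obtain ⟨e, he⟩ := e
  induction e with
  | _ u v =>
  have huv : G.Adj u v := he
  rw [hK.painting_apply hsymm u v huv]
  by_cases hu : Pend G u
  · rw [paint_pend hu]; exact hP u hu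
  by_cases hv : Pend G v
  · rw [hK.paint_symm hsymm huv, paint_pend hv]; exact hP v hv
  by_cases hu' : u ∈ K
  · by_cases hv' : v ∈ K
    · rw [hK.paint_core hu' hv']; exact hk u hu' v hv' huv.ne
    · rw [hK.paint_out' hsymm hv' hv huv.symm]; exact hw v hv' hv u huv.symm
  · rw [hK.paint_out hu' hu huv]; exact hw u hu' hu v huv

end IsCore

end Painting

section Via

variable {V : Type*} {G : SimpleGraph V} {col : V → V → ℕ} {S : Set ℕ} {u v w x : V}

lemma Via.two (h : G.Adj u v) (h' : G.Adj v w) (hc : col u v ∈ S) (hc' : col v w ∈ S)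
    (hne : col u v ≠ col v w) : Via G col S u w :=
  .cons h hc (.single h' ⟨hc', fun h => hne h.symm⟩)

/-- Walks with colours in `S` can be prolonged by an edge whose colour is not in `S`. -/
lemma Via.cons' {R : Set ℕ} (h : G.Adj u v) (h' : Via G col S v w) (hc : col u v ∈ R) (hS : S ⊆ R)
    (hne : col u v ∉ S) : Via G col R u w :=
  .cons h hc (h'.mono fun _ hx => ⟨hS hx, fun h => hne (h ▸ hx)⟩)

end Via

/-! ### A rainbow colouring with at most one colour that is not a pendant vertex -/

section Extra

variable {n : ℕ}

/-- The edges from `w` get the colour `σ` if they go to the least neighbour of `w`, and `τ`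
otherwise. -/
noncomputable def leastCol (G : SimpleGraph (Fin n)) (σ τ : ℕ) (w u : Fin n) : ℕ :=
  open Classical in if ∀ t < u, ¬ G.Adj w t then σ else τ

variable {G : SimpleGraph (Fin n)} {K : Set (Fin n)}

lemma exists_least {p : Fin n → Prop} (h : ∃ u, p u) : ∃ u, p u ∧ ∀ t < u, ¬ p t := by
  obtain ⟨u, hu, hmin⟩ := WellFounded.has_min (wellFounded_lt (α := Fin n)) {u | p u} h
  exact ⟨u, hu, fun t ht h => hmin t h ht⟩

/-- If all edges of the core have the same colour `ε`, then three colours suffice apart from the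
pendant edges: every vertex outside the core has edges of two other colours to it, one of which
differs from the colour of a given pendant edge. -/
lemma IsCore.isRainbowColouring_extra (hK : IsCore G K) (hconn : G.Connected) {σ τ ε : ℕ}
    (hστ : σ ≠ τ) (hσ : σ ≠ ε) (hτ : τ ≠ ε) (hε : ∀ s, Pend G s → (s : ℕ) ≠ ε) :
    IsRainbowColouring (painting G K (fun _ _ => ε) (leastCol G σ τ)) := by
  have hcol : ∀ u v : Fin n, (fun _ _ => ε : Fin n → Fin n → ℕ) u v = (fun _ _ => ε) v u :=
    fun _ _ => rfl
  set c := paint G K (fun _ _ => ε) (leastCol G σ τ) with hc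
  have hkk : ∀ {S : Set ℕ} {u v}, u ∈ K → v ∈ K → ε ∈ S → Via G c S u v := by
    intro S u v hu hv hS
    by_cases h : u = v
    · subst h; exact .refl _ _
    · refine .single (hK.adj hu hv h) ?_
      rw [hc, hK.paint_core hu hv]; exact hS
  have hmin : ∀ w ∉ K, ¬ Pend G w → ∃ y, G.Adj w y ∧ c w y = σ := by
    intro w hw hp
    obtain ⟨x, hx, -⟩ := hK.exists_adj_ne hconn hw hp w
    obtain ⟨y, hy, hy'⟩ := exists_least ⟨x, hx⟩
    exact ⟨y, hy, by rw [hc, hK.paint_out hw hp hy, leastCol, if_pos hy']⟩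
  have hother : ∀ w ∉ K, ¬ Pend G w → ∃ x, G.Adj w x ∧ c w x = τ := by
    intro w hw hp
    obtain ⟨x, hx, -⟩ := hK.exists_adj_ne hconn hw hp w
    obtain ⟨y, hy, hy'⟩ := exists_least ⟨x, hx⟩
    obtain ⟨z, hz, hzy⟩ := hK.exists_adj_ne hconn hw hp y
    refine ⟨z, hz, ?_⟩
    rw [hc, hK.paint_out hw hp hz, leastCol, if_neg]
    intro h
    exact (lt_or_gt_of_ne hzy).elim (fun h => hy' z h hz) (fun h' => h y h' hy)
  -- the walk to a vertex of the core whose first edge has colour `ρ`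
  have hto : ∀ {w y ρ}, w ∉ K → G.Adj w y → c w y = ρ → ρ ≠ ε → ∀ {S : Set ℕ}, ρ ∈ S → ε ∈ S →
      ∀ {t}, t ∈ K → Via G c S w t := by
    intro w y ρ hw hy hcy hρ S hS hS' t ht
    refine Via.cons' (S := {ε}) hy (hkk (hK.mem_of_adj hw hy) ht rfl) (hcy ▸ hS) (by simpa) ?_
    simpa [hcy]
  refine hK.isRainbowColouring_painting hc hcol ?_ ?_ ?_ ?_ ?_
  · intro s h hs hh t ht
    exact hkk (hK.mem_of_pend_adj hs hh) ht (hε s hs).symm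
  · intro s h s' h' hs hh hs' hh' _
    refine hkk (hK.mem_of_pend_adj hs hh) (hK.mem_of_pend_adj hs' hh') ?_
    simp [(hε s hs).symm, (hε s' hs').symm]
  · intro w hw hp t ht
    obtain ⟨y, hy, hcy⟩ := hmin w hw hp
    exact hto (S := Set.univ) hw hy hcy hσ trivial trivial ht
  · intro w hw hp s h hs hh
    have hh' := hK.mem_of_pend_adj hs hh
    by_cases h1 : σ = s
    · obtain ⟨x, hx, hcx⟩ := hother w hw hp
      exact hto (S := {(s : ℕ)}ᶜ) hw hx hcx hτ (fun h => hστ (h1.trans h.symm)) (hε s hs).symm hh'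
    · obtain ⟨y, hy, hcy⟩ := hmin w hw hp
      exact hto (S := {(s : ℕ)}ᶜ) hw hy hcy hσ h1 (hε s hs).symm hh'
  · intro w hw hp w' hw' hp' _
    obtain ⟨y, hy, hcy⟩ := hmin w hw hp
    obtain ⟨x, hx, hcx⟩ := hother w' hw' hp'
    refine (hto (S := {σ, ε}) hw hy hcy hσ (by simp) (by simp) (hK.mem_of_adj hw' hx)).trans'
      (T := {τ}) (.single hx.symm ?_) ?_ (Set.subset_univ _) (Set.subset_univ _)
    · rw [hc, hK.paint_symm hcol hx.symm, ← hc, hcx]; rfl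
    · simp [hστ.symm, hτ]

end Extra

/-! ### Rainbow colourings that use pendant vertices as colours only -/

section Schemes

variable {n : ℕ}

/-- The four vertices are different and pendant. -/
def FourPend (G : SimpleGraph (Fin n)) (s₁ s₂ s₃ s₄ : Fin n) : Prop :=
  (Pend G s₁ ∧ Pend G s₂ ∧ Pend G s₃ ∧ Pend G s₄) ∧
    s₁ ≠ s₂ ∧ s₁ ≠ s₃ ∧ s₁ ≠ s₄ ∧ s₂ ≠ s₃ ∧ s₂ ≠ s₄ ∧ s₃ ≠ s₄

/-- Pendant vertices whose labels serve as colours if some vertex has three pendant neighbours, or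
if three vertices have pendant neighbours; the core must have a vertex other than `a` and `b`. The
last argument has no meaning here, and is made equal to `s₁` so that it is no vertex of the core. -/
def WideTuple (G : SimpleGraph (Fin n)) (K : Set (Fin n)) (s₁ s₂ s₃ s₄ a b x₀ : Fin n) : Prop :=
  FourPend G s₁ s₂ s₃ s₄ ∧ a ∈ K ∧ b ∈ K ∧ a ≠ b ∧ (∃ d, d ∈ K ∧ d ≠ a ∧ d ≠ b) ∧ x₀ = s₁ ∧
    ((G.Adj s₁ a ∧ G.Adj s₂ a ∧ G.Adj s₃ a) ∨
      (G.Adj s₃ a ∧ G.Adj s₂ b ∧ ¬ G.Adj s₁ a ∧ ¬ G.Adj s₁ b))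

/-- Pendant vertices whose labels serve as colours if there are exactly four pendant vertices, two
at `a` and two at `b`, provided that `a` and `b` have two common neighbours. -/
def NarrowTuple (G : SimpleGraph (Fin n)) (K : Set (Fin n)) (s₁ s₂ s₃ s₄ a b x₀ : Fin n) : Prop :=
  FourPend G s₁ s₂ s₃ s₄ ∧ (∀ s, Pend G s → s = s₁ ∨ s = s₂ ∨ s = s₃ ∨ s = s₄) ∧
    (G.Adj s₁ a ∧ G.Adj s₃ a ∧ G.Adj s₂ b ∧ G.Adj s₄ b) ∧ (a ∈ K ∧ b ∈ K ∧ a ≠ b) ∧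
    (x₀ ∈ K ∧ x₀ ≠ a ∧ x₀ ≠ b) ∧ ∃ x, x ≠ x₀ ∧ G.Adj x a ∧ G.Adj x b

open Classical in
/-- The colours within the core: `s₁` for `ab`, `s₄` for `ax₀`, `s₂` for the other edges at `a`, and
`s₃` for the rest. -/
noncomputable def kcol (s₁ s₂ s₃ s₄ a b x₀ : Fin n) (u v : Fin n) : ℕ :=
  if (u = a ∧ v = b) ∨ (u = b ∧ v = a) then s₁ else
    if (u = a ∧ v = x₀) ∨ (u = x₀ ∧ v = a) then s₄ else if u = a ∨ v = a then s₂ else s₃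

/-- `u` is the preferred neighbour of `w`: it is `b` if `b` is adjacent to `w`, and the least
neighbour other than `a` if not. -/
def Pref (G : SimpleGraph (Fin n)) (a b w u : Fin n) : Prop :=
  G.Adj w u ∧ ((G.Adj w b ∧ u = b) ∨ (¬ G.Adj w b ∧ u ≠ a ∧ ∀ t, t < u → G.Adj w t → t = a))

open Classical in
/-- The colours between the core and the vertices outside it. -/
noncomputable def wcol (G : SimpleGraph (Fin n)) (K : Set (Fin n)) (s₁ s₂ s₃ s₄ a b x₀ : Fin n)
    (w u : Fin n) : ℕ :=
  if x₀ ∈ K ∧ G.Adj w a ∧ G.Adj w b then if u = a then s₂ else s₃ else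
    if Pref G a b w u then s₁ else if u = x₀ ∨ (u = a ∧ Pref G a b w x₀) then s₂ else s₄

variable {G : SimpleGraph (Fin n)} {K : Set (Fin n)} {s₁ s₂ s₃ s₄ a b x₀ : Fin n}

lemma kcol_symm (u v : Fin n) : kcol s₁ s₂ s₃ s₄ a b x₀ u v = kcol s₁ s₂ s₃ s₄ a b x₀ v u := by
  unfold kcol
  congr 1
  · grind
  · congr 1
    · grind
    · congr 1
      grind

lemma Pref.unique {w u v : Fin n} (hu : Pref G a b w u) (hv : Pref G a b w v) : u = v := by
  obtain ⟨hu, ⟨h1, h2⟩ | ⟨h1, h2, h3⟩⟩ := hu <;> obtain ⟨hv, ⟨k1, k2⟩ | ⟨k1, k2, k3⟩⟩ := hv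
  · rw [h2, k2]
  · exact absurd h1 k1
  · exact absurd k1 h1
  · by_contra h
    rcases lt_or_gt_of_ne h with h | h
    · exact h2 (k3 u h hu)
    · exact k2 (h3 v h hv)

lemma Pref.ne (hab : a ≠ b) {w u : Fin n} (hu : Pref G a b w u) : u ≠ a := by
  obtain ⟨hu, ⟨h1, h2⟩ | ⟨h1, h2, h3⟩⟩ := hu
  · exact h2 ▸ hab.symm
  · exact h2

lemma IsCore.exists_pref (hK : IsCore G K) (hconn : G.Connected) (a b : Fin n) {w : Fin n}
    (hw : w ∉ K) (hp : ¬ Pend G w) : ∃ u, Pref G a b w u := by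
  by_cases h : G.Adj w b
  · exact ⟨b, h, Or.inl ⟨h, rfl⟩⟩
  · obtain ⟨u, ⟨hu, hua⟩, hmin⟩ := exists_least (p := fun u => G.Adj w u ∧ u ≠ a)
      (hK.exists_adj_ne hconn hw hp a)
    exact ⟨u, hu, Or.inr ⟨h, hua, fun t ht hwt => by_contra fun hne => hmin t ht ⟨hwt, hne⟩⟩⟩

/-- Edges that leave the core have the colour `s₁` or `s₄`, and every vertex outside the core has
edges of both colours, that of colour `s₁` not going to `a`. Within the core, `s₂` and `s₃` suffice
for a start other than `a`, and `s₁`, `s₂`, `s₃` without the colour of a pendant edge suffice for a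
start at its host. -/
lemma WideTuple.isRainbowColouring (hK : IsCore G K) (hconn : G.Connected)
    (hT : WideTuple G K s₁ s₂ s₃ s₄ a b x₀) :
    IsRainbowColouring (painting G K (kcol s₁ s₂ s₃ s₄ a b x₀) (wcol G K s₁ s₂ s₃ s₄ a b x₀)) := by
  obtain ⟨⟨⟨p1, p2, p3, p4⟩, h12, h13, h14, h23, h24, h34⟩, ha, hb, hab, ⟨d, hd, hda, hdb⟩, rfl,
    hL⟩ := hT
  have hx : x₀ ∉ K := hK.notMem_of_pend p1
  obtain ⟨c, hc⟩ : ∃ c, c = paint G K (kcol x₀ s₂ s₃ s₄ a b x₀) (wcol G K x₀ s₂ s₃ s₄ a b x₀) :=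
    ⟨_, rfl⟩
  have hkc : ∀ {u v}, u ∈ K → v ∈ K → c u v =
      if (u = a ∧ v = b) ∨ (u = b ∧ v = a) then (x₀ : ℕ) else if u = a ∨ v = a then s₂ else s₃ := by
    intro u v hu hv
    have h1 : u ≠ x₀ := fun h => hx (h ▸ hu)
    have h2 : v ≠ x₀ := fun h => hx (h ▸ hv)
    rw [hc, hK.paint_core hu hv, kcol]
    simp [h1, h2]
  have hwc : ∀ {w u}, w ∉ K → ¬ Pend G w → G.Adj w u → (Pref G a b w u → c w u = x₀) ∧
      (¬ Pref G a b w u → c w u = s₄) := by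
    intro w u hw hp h
    have h1 : u ≠ x₀ := fun h' => hx (h' ▸ hK.mem_of_adj hw h)
    have h2 : ¬ Pref G a b w x₀ := fun h' => hx (hK.mem_of_adj hw h'.1)
    rw [hc, hK.paint_out hw hp h, wcol]
    simp +contextual [h1, h2, hx]
  have symm : ∀ {u v}, G.Adj u v → c u v = c v u := fun h => hc ▸ hK.paint_symm kcol_symm h
  -- the walks from a vertex outside the core start with a preferred or with another edge
  have hY : ∀ {w}, w ∉ K → ¬ Pend G w → ∃ y, G.Adj w y ∧ c w y = x₀ ∧ y ∈ K ∧ y ≠ a := by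
    intro w hw hp
    obtain ⟨y, hy⟩ := hK.exists_pref hconn a b hw hp
    exact ⟨y, hy.1, (hwc hw hp hy.1).1 hy, hK.mem_of_adj hw hy.1, hy.ne hab⟩
  have hX : ∀ {w}, w ∉ K → ¬ Pend G w → ∃ x, G.Adj w x ∧ c w x = s₄ ∧ x ∈ K := by
    intro w hw hp
    obtain ⟨y, hy⟩ := hK.exists_pref hconn a b hw hp
    obtain ⟨x, hx, hxy⟩ := hK.exists_adj_ne hconn hw hp y
    exact ⟨x, hx, (hwc hw hp hx).2 fun h => hxy (h.unique hy), hK.mem_of_adj hw hx⟩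
  have hcc : ∀ {u v}, u ∈ K → v ∈ K →
      (c u v = x₀ ∧ ((u = a ∧ v = b) ∨ (u = b ∧ v = a))) ∨
      (c u v = s₂ ∧ (u = a ∨ v = a) ∧ ¬ (u = a ∧ v = b) ∧ ¬ (u = b ∧ v = a)) ∨
      (c u v = s₃ ∧ u ≠ a ∧ v ≠ a) := by
    intro u v hu hv
    rw [hkc hu hv]
    split_ifs with h1 h2
    · exact Or.inl ⟨rfl, h1⟩
    · exact Or.inr (Or.inl ⟨rfl, h2, not_or.1 h1⟩)
    · exact Or.inr (Or.inr ⟨rfl, not_or.1 h2⟩)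
  have ndb : c d b = s₃ := by rw [hkc hd hb]; simp [hda, hdb, hab.symm]
  have nbd : c b d = s₃ := by rw [hkc hb hd]; simp [hda, hdb, hab.symm]
  have nad : c a d = s₂ := by rw [hkc ha hd]; simp [hdb, hab]
  have nda : c d a = s₂ := by rw [hkc hd ha]; simp [hdb, hda]
  have nab : c a b = x₀ := by rw [hkc ha hb]; simp
  have ad := hK.adj ha hd hda.symm
  have bd := hK.adj hb hd hdb.symm
  have v12 : (x₀ : ℕ) ≠ s₂ := fun h => h12 (Fin.ext h)
  have v13 : (x₀ : ℕ) ≠ s₃ := fun h => h13 (Fin.ext h)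
  have v14 : (x₀ : ℕ) ≠ s₄ := fun h => h14 (Fin.ext h)
  have v23 : (s₂ : ℕ) ≠ s₃ := fun h => h23 (Fin.ext h)
  have v24 : (s₂ : ℕ) ≠ s₄ := fun h => h24 (Fin.ext h)
  have v34 : (s₃ : ℕ) ≠ s₄ := fun h => h34 (Fin.ext h)
  -- from a vertex other than `a`, the core can be traversed with two colours
  have hR : ∀ {y t}, y ∈ K → t ∈ K → y ≠ a → Via G c {(s₂ : ℕ), (s₃ : ℕ)} y t := by
    intro y t hy ht hya
    by_cases hyt : y = t
    · subst hyt; exact .refl _ _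
    by_cases h : y = b ∧ t = a
    · obtain ⟨rfl, rfl⟩ := h
      exact .two bd ad.symm (by simp [nbd]) (by simp [nda]) (by rw [nbd, nda]; exact v23.symm)
    · refine .single (hK.adj hy ht hyt) ?_
      rw [hkc hy ht]
      by_cases hta : t = a <;> simp_all
  -- from the host of a pendant vertex, the core can be traversed without its colour
  have hQ : ∀ {s h t}, Pend G s → G.Adj s h → t ∈ K →
      Via G c ({(x₀ : ℕ), (s₂ : ℕ), (s₃ : ℕ)} \ {(s : ℕ)}) h t := by
    intro s h t hs hh ht
    have hhK := hK.mem_of_pend_adj hs hh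
    by_cases hht : h = t
    · subst hht; exact .refl _ _
    have hmem : c h t = x₀ ∨ c h t = s₂ ∨ c h t = s₃ := by
      rcases hcc hhK ht with h | h | h <;> simp [h.1]
    by_cases hne : c h t = s
    swap
    · exact .single (hK.adj hhK ht hht) ⟨by simpa using hmem, hne⟩
    rcases hcc hhK ht with ⟨h1, h2⟩ | ⟨h1, h2, h3⟩ | ⟨h1, h2, h3⟩
    · obtain rfl : s = x₀ := Fin.ext (hne.symm.trans h1)
      rcases hL with ⟨l1, l2, l3⟩ | ⟨l3, l2, l1a, l1b⟩
      · obtain rfl := hs.eq hh l1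
        obtain rfl : t = b := by
          rcases h2 with h2 | h2
          · exact h2.2
          · exact absurd h2.2.symm hht
        exact .two ad bd.symm (by simp [nad, v12.symm]) (by simp [ndb, v13.symm])
          (by rw [nad, ndb]; exact v23)
      · rcases h2 with ⟨rfl, -⟩ | ⟨rfl, -⟩
        · exact absurd hh l1a
        · exact absurd hh l1b
    · obtain rfl : s = s₂ := Fin.ext (hne.symm.trans h1)
      rcases hL with ⟨l1, l2, l3⟩ | ⟨l3, l2, l1a, l1b⟩
      · obtain rfl := hs.eq hh l2
        have htb : t ≠ b := fun h => h3.1 ⟨rfl, h⟩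
        have nbt : c b t = s₃ := by rw [hkc hb ht]; simp [htb, hab.symm, Ne.symm hht]
        exact .two (hK.adj ha hb hab) (hK.adj hb ht htb.symm) (by simp [nab, v12])
          (by simp [nbt, v23.symm]) (by rw [nab, nbt]; exact v13)
      · obtain rfl := hs.eq hh l2
        rcases h2 with h2 | h2
        · exact absurd h2.symm hab
        · exact absurd ⟨rfl, h2⟩ h3.2
    · obtain rfl : s = s₃ := Fin.ext (hne.symm.trans h1)
      refine absurd (hs.eq hh ?_) h2
      rcases hL with ⟨l1, l2, l3⟩ | ⟨l3, l2, l1a, l1b⟩ <;> exact l3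
  have compl : ∀ {s : Fin n}, ({(x₀ : ℕ), (s₂ : ℕ), (s₃ : ℕ)} \ {(s : ℕ)} : Set ℕ) ⊆ {(s : ℕ)}ᶜ :=
    fun {_} _ h => h.2
  refine hK.isRainbowColouring_painting hc kcol_symm ?_ ?_ ?_ ?_ ?_
  · exact fun s h hs hh t ht => (hQ hs hh ht).mono compl
  · intro s h s' h' hs hh hs' hh' hne
    have hhK := hK.mem_of_pend_adj hs hh
    have hhK' := hK.mem_of_pend_adj hs' hh'
    have main : ∀ {s h s' h'}, Pend G s → G.Adj s h → h' ∈ K →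
        (s' ≠ x₀ ∧ s' ≠ s₂ ∧ s' ≠ s₃) → Via G c {(s : ℕ), (s' : ℕ)}ᶜ h h' := by
      rintro s h s' h' hs hh hhK' ⟨k1, k2, k3⟩
      refine (hQ hs hh hhK').mono ?_
      rintro x ⟨hx, hxs⟩ (rfl | rfl)
      · exact hxs rfl
      · simp [Fin.ext_iff] at hx k1 k2 k3
        omega
    by_cases k' : s' = x₀ ∨ s' = s₂ ∨ s' = s₃
    swap
    · exact main hs hh hhK' (by simpa only [not_or] using k')
    by_cases k : s = x₀ ∨ s = s₂ ∨ s = s₃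
    swap
    · rw [Set.pair_comm]
      exact (main hs' hh' hhK (by simpa only [not_or] using k)).symm fun _ _ => symm
    rcases hL with ⟨l1, l2, l3⟩ | ⟨l3, l2, l1a, l1b⟩
    · have host : ∀ {s h}, Pend G s → G.Adj s h → (s = x₀ ∨ s = s₂ ∨ s = s₃) → h = a := by
        rintro s h hs hh (rfl | rfl | rfl)
        · exact hs.eq hh l1
        · exact hs.eq hh l2
        · exact hs.eq hh l3
      rw [host hs hh k, host hs' hh' k']
      exact .refl _ _
    · obtain ⟨r, hr, -⟩ := id p1
      have hrK := hK.mem_of_pend_adj p1 hr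
      have hra : r ≠ a := by rintro rfl; exact l1a hr
      have hrb : r ≠ b := by rintro rfl; exact l1b hr
      have e12 : Via G c {(x₀ : ℕ), (s₂ : ℕ)}ᶜ r b := by
        refine .single (hK.adj hrK hb hrb) ?_
        rw [hkc hrK hb]
        simp [hra, hrb, hab.symm, v13.symm, v23.symm]
      have e13 : Via G c {(x₀ : ℕ), (s₃ : ℕ)}ᶜ r a := by
        refine .single (hK.adj hrK ha hra) ?_
        rw [hkc hrK ha]
        simp [hra, hrb, v12.symm, v23]
      have e23 : Via G c {(s₂ : ℕ), (s₃ : ℕ)}ᶜ b a := by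
        refine .single (hK.adj hb ha hab.symm) ?_
        rw [hkc hb ha]
        simp [v12, v13]
      have sw : ∀ {s s' : ℕ} {h h'}, Via G c {s, s'}ᶜ h h' → Via G c {s', s}ᶜ h' h :=
        fun {s s' _ _} h => by rw [Set.pair_comm s' s]; exact h.symm fun _ _ => symm
      rcases k with rfl | rfl | rfl <;> rcases k' with rfl | rfl | rfl
      · exact absurd rfl hne
      · rw [hs.eq hh hr, hs'.eq hh' l2]; exact e12
      · rw [hs.eq hh hr, hs'.eq hh' l3]; exact e13
      · rw [hs.eq hh l2, hs'.eq hh' hr]; exact sw e12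
      · exact absurd rfl hne
      · rw [hs.eq hh l2, hs'.eq hh' l3]; exact e23
      · rw [hs.eq hh l3, hs'.eq hh' hr]; exact sw e13
      · rw [hs.eq hh l3, hs'.eq hh' l2]; exact sw e23
      · exact absurd rfl hne
  · intro w hw hp t ht
    obtain ⟨x, hx, hcx, hxK⟩ := hX hw hp
    by_cases hxt : x = t
    · subst hxt; exact .single hx trivial
    refine .two hx (hK.adj hxK ht hxt) trivial trivial ?_
    rw [hcx]
    rcases hcc hxK ht with h | h | h <;> simp [h.1, v14.symm, v24.symm, v34.symm]
  · intro w hw hp s h hs hh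
    have hhK := hK.mem_of_pend_adj hs hh
    by_cases h4 : s = s₄
    · subst h4
      obtain ⟨y, hy, hcy, hyK, hya⟩ := hY hw hp
      refine Via.cons' hy (hR hyK hhK hya) ?_ ?_ ?_
      · simpa [hcy] using v14
      · rintro x (rfl | rfl) <;> simp [v24, v34]
      · simp [hcy, v12, v13]
    · obtain ⟨x, hx, hcx, hxK⟩ := hX hw hp
      refine Via.cons' hx ((hQ hs hh hxK).symm fun _ _ => symm) ?_ compl ?_
      · simpa [hcx, Fin.ext_iff, eq_comm] using h4
      · simp [hcx, v14.symm, v24.symm, v34.symm]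
  · intro w hw hp w' hw' hp' _
    obtain ⟨x, hx, hcx, hxK⟩ := hX hw hp
    obtain ⟨y, hy, hcy, hyK, hya⟩ := hY hw' hp'
    refine Via.cons' (S := {(s₂ : ℕ), (s₃ : ℕ)} ∪ {(x₀ : ℕ)}) hx (((hR hyK hxK hya).symm
      fun _ _ => symm).trans (.single hy.symm ?_) ?_) trivial (Set.subset_univ _) ?_
    · rw [symm hy.symm, hcy]; rfl
    · simp [v12, v13]
    · simp [hcx, v14.symm, v24.symm, v34.symm]

/-- The pendant edges at `a` have the colours `s₁` and `s₃`, and those at `b` have `s₂` and `s₄`.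
Hence it matters that a vertex outside the core is joined to `a` by `s₂` and `s₄` alone, and to `b`
by `s₁` and `s₃` alone. The walks from `a` to `b` that the pendant vertices need have the colour
`s₁`, or `s₄` and `s₃` through `x₀`, or `s₂` and `s₃` through the other common neighbour. -/
lemma NarrowTuple.isRainbowColouring (hK : IsCore G K) (hconn : G.Connected)
    (hT : NarrowTuple G K s₁ s₂ s₃ s₄ a b x₀) :
    IsRainbowColouring (painting G K (kcol s₁ s₂ s₃ s₄ a b x₀) (wcol G K s₁ s₂ s₃ s₄ a b x₀)) := by
  classical
  obtain ⟨⟨⟨p1, p2, p3, p4⟩, h12, h13, h14, h23, h24, h34⟩, hall, ⟨l1, l3, l2, l4⟩, ⟨ha, hb, hab⟩,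
    ⟨hx, hxa, hxb⟩, x₁, hx1, x1a, x1b⟩ := hT
  obtain ⟨c, hc⟩ : ∃ c, c = paint G K (kcol s₁ s₂ s₃ s₄ a b x₀) (wcol G K s₁ s₂ s₃ s₄ a b x₀) :=
    ⟨_, rfl⟩
  have hkc : ∀ {u v}, u ∈ K → v ∈ K → c u v = kcol s₁ s₂ s₃ s₄ a b x₀ u v :=
    fun hu hv => hc ▸ hK.paint_core hu hv
  have symm : ∀ {u v}, G.Adj u v → c u v = c v u := fun h => hc ▸ hK.paint_symm kcol_symm h
  have vsymm : ∀ {S : Set ℕ} {u v}, Via G c S u v → Via G c S v u :=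
    fun h => h.symm fun _ _ => symm
  -- the colours within the core
  have cab : c a b = s₁ := by simp [hkc ha hb, kcol]
  have cba : c b a = s₁ := by simp [hkc hb ha, kcol]
  have cax : c a x₀ = s₄ := by simp [hkc ha hx, kcol, hxb, hxa, hab]
  have cxa : c x₀ a = s₄ := by simp [hkc hx ha, kcol, hxb, hxa, hab]
  have cad : ∀ {d}, d ∈ K → d ≠ b → d ≠ x₀ → d ≠ a → c a d = s₂ := by
    intro d hd h1 h2 h3; simp [hkc ha hd, kcol, h1, h2, hab, hxa.symm]
  have cda : ∀ {d}, d ∈ K → d ≠ b → d ≠ x₀ → d ≠ a → c d a = s₂ := by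
    intro d hd h1 h2 h3; simp [hkc hd ha, kcol, h1, h2, hab, hxa.symm]
  have cde : ∀ {d e}, d ∈ K → e ∈ K → d ≠ a → e ≠ a → c d e = s₃ := by
    intro d e hd he h1 h2; simp [hkc hd he, kcol, h1, h2]
  -- the colours of the edges that leave the core
  have wAB : ∀ {w}, w ∉ K → ¬ Pend G w → G.Adj w a → G.Adj w b → c w a = s₂ ∧ c w b = s₃ := by
    intro w hw hp h1 h2
    rw [hc, hK.paint_out hw hp h1, hK.paint_out hw hp h2]
    simp [wcol, hx, h1, h2, hab.symm]
  have wY : ∀ {w y}, w ∉ K → ¬ Pend G w → ¬ (G.Adj w a ∧ G.Adj w b) → Pref G a b w y →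
      c w y = s₁ := by
    intro w y hw hp h1 h2
    rw [hc, hK.paint_out hw hp h2.1]
    simp [wcol, h1, h2]
  have wX : ∀ {w x}, w ∉ K → ¬ Pend G w → ¬ (G.Adj w a ∧ G.Adj w b) → ¬ Pref G a b w x →
      G.Adj w x → c w x = if x = x₀ ∨ (x = a ∧ Pref G a b w x₀) then (s₂ : ℕ) else s₄ := by
    intro w x hw hp h1 h2 h3
    rw [hc, hK.paint_out hw hp h3]
    simp [wcol, h1, h2]
  have v12 : (s₁ : ℕ) ≠ s₂ := fun h => h12 (Fin.ext h)
  have v13 : (s₁ : ℕ) ≠ s₃ := fun h => h13 (Fin.ext h)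
  have v14 : (s₁ : ℕ) ≠ s₄ := fun h => h14 (Fin.ext h)
  have v23 : (s₂ : ℕ) ≠ s₃ := fun h => h23 (Fin.ext h)
  have v24 : (s₂ : ℕ) ≠ s₄ := fun h => h24 (Fin.ext h)
  have v34 : (s₃ : ℕ) ≠ s₄ := fun h => h34 (Fin.ext h)
  have nPa : ∀ {w}, ¬ Pref G a b w a := fun h => h.ne hab rfl
  have axb : Via G c {(s₃ : ℕ), (s₄ : ℕ)} a b :=
    .two (hK.adj ha hx hxa.symm) (hK.adj hx hb hxb) (by simp [cax])
      (by simp [cde hx hb hxa hab.symm]) (by rw [cax, cde hx hb hxa hab.symm]; exact v34.symm)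
  -- every vertex outside the core is joined to `a` by a walk with colours `s₂` and `s₄`
  have hA : ∀ {w}, w ∉ K → ¬ Pend G w → Via G c {(s₂ : ℕ), (s₄ : ℕ)} w a := by
    intro w hw hp
    by_cases hwa : G.Adj w a
    · refine .single hwa ?_
      by_cases hwb : G.Adj w b
      · simp [wAB hw hp hwa hwb]
      · rw [wX hw hp (fun h => hwb h.2) nPa hwa]
        split_ifs <;> simp
    · have hn : ¬ (G.Adj w a ∧ G.Adj w b) := fun h => hwa h.1
      obtain ⟨y, hy⟩ := hK.exists_pref hconn a b hw hp
      obtain ⟨x, hx', hxy⟩ := hK.exists_adj_ne hconn hw hp y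
      have hxK := hK.mem_of_adj hw hx'
      have hxa' : x ≠ a := by rintro rfl; exact hwa hx'
      have hxY : ¬ Pref G a b w x := fun h => hxy (h.unique hy)
      have hcx := wX hw hp hn hxY hx'
      by_cases h0 : x = x₀
      · subst h0
        rw [if_pos (Or.inl rfl)] at hcx
        exact .two hx' (hK.adj hxK ha hxa') (by simp [hcx]) (by simp [cxa])
          (by rw [hcx, cxa]; exact v24)
      · rw [if_neg (by simp [h0, hxa'])] at hcx
        have hxb' : x ≠ b := by
          rintro rfl
          exact hxY ⟨hx', Or.inl ⟨hx', rfl⟩⟩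
        have := cda hxK hxb' h0 hxa'
        exact .two hx' (hK.adj hxK ha hxa') (by simp [hcx]) (by simp [this])
          (by rw [hcx, this]; exact v24.symm)
  -- and to `b` by a walk with colours `s₁` and `s₃`
  have hB : ∀ {w}, w ∉ K → ¬ Pend G w → Via G c {(s₁ : ℕ), (s₃ : ℕ)} w b := by
    intro w hw hp
    by_cases hwb : G.Adj w b
    · refine .single hwb ?_
      by_cases hwa : G.Adj w a
      · simp [wAB hw hp hwa hwb]
      · simp [wY hw hp (fun h => hwa h.1) ⟨hwb, Or.inl ⟨hwb, rfl⟩⟩]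
    · have hn : ¬ (G.Adj w a ∧ G.Adj w b) := fun h => hwb h.2
      obtain ⟨y, hy⟩ := hK.exists_pref hconn a b hw hp
      have hyK := hK.mem_of_adj hw hy.1
      have hyb : y ≠ b := by rintro rfl; exact hwb hy.1
      have h1 := wY hw hp hn hy
      have h2 := cde hyK hb (hy.ne hab) hab.symm
      exact .two hy.1 (hK.adj hyK hb hyb) (by simp [h1]) (by simp [h2]) (by rw [h1, h2]; exact v13)
  have host : ∀ {s h}, Pend G s → G.Adj s h → (h = a ∧ (s = s₁ ∨ s = s₃)) ∨
      (h = b ∧ (s = s₂ ∨ s = s₄)) := by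
    intro s h hs hh
    rcases hall s hs with rfl | rfl | rfl | rfl
    · exact Or.inl ⟨hs.eq hh l1, Or.inl rfl⟩
    · exact Or.inr ⟨hs.eq hh l2, Or.inl rfl⟩
    · exact Or.inl ⟨hs.eq hh l3, Or.inr rfl⟩
    · exact Or.inr ⟨hs.eq hh l4, Or.inr rfl⟩
  have hcor : ∀ {u v}, u ∈ K → v ∈ K → {S : Set ℕ} → (u ≠ v → c u v ∈ S) → Via G c S u v := by
    intro u v hu hv S h
    by_cases huv : u = v
    · subst huv; exact .refl _ _
    · exact .single (hK.adj hu hv huv) (h huv)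
  refine hK.isRainbowColouring_painting hc kcol_symm ?_ ?_ ?_ ?_ ?_
  · intro s h hs hh t ht
    rcases host hs hh with ⟨rfl, h | h⟩ | ⟨rfl, h⟩
    · by_cases htb : t = b
      · subst htb
        refine axb.mono ?_
        rintro x (rfl | rfl) <;> simp [h, v13.symm, v14.symm]
      · refine hcor ha ht fun hne => ?_
        by_cases htx : t = x₀
        · simp [htx, cax, h, v14.symm]
        · simp [cad ht htb htx hne.symm, h, v12.symm]
    · refine hcor ha ht fun hne => ?_
      by_cases htb : t = b
      · simp [htb, cab, h, v13]
      by_cases htx : t = x₀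
      · simp [htx, cax, h, v34.symm]
      · simp [cad ht htb htx hne.symm, h, v23]
    · refine hcor hb ht fun hne => ?_
      by_cases hta : t = a
      · rcases h with h | h <;> simp [hta, cba, h, v12, v14]
      · rcases h with h | h <;> simp [cde hb ht hab.symm hta, h, v23.symm, v34]
  · intro s h s' h' hs hh hs' hh' hne
    have sw : ∀ {s s' : ℕ} {h h'}, Via G c {s, s'}ᶜ h h' → Via G c {s', s}ᶜ h' h :=
      fun {s s' _ _} h => by rw [Set.pair_comm s' s]; exact vsymm h
    -- the walk between the hosts depends on the two colours to be avoided
    have main : ∀ {s s'}, (s = s₁ ∨ s = s₃) → (s' = s₂ ∨ s' = s₄) →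
        Via G c {(s : ℕ), (s' : ℕ)}ᶜ a b := by
      rintro s s' (rfl | rfl) hs'
      · rcases hs' with rfl | rfl
        · refine axb.mono ?_
          rintro x (rfl | rfl) <;> simp [v13.symm, v14.symm, v23.symm, v24.symm]
        · have hcol : c a x₁ = s₂ ∧ c x₁ b = s₃ := by
            by_cases hx1K : x₁ ∈ K
            · exact ⟨cad hx1K x1b.ne hx1 x1a.ne, cde hx1K hb x1a.ne hab.symm⟩
            · have hp : ¬ Pend G x₁ := fun h => hab (h.eq x1a x1b)
              obtain ⟨k1, k2⟩ := wAB hx1K hp x1a x1b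
              exact ⟨by rw [symm x1a.symm, k1], k2⟩
          refine .two x1a.symm x1b ?_ ?_ (by rw [hcol.1, hcol.2]; exact v23)
          · simp [hcol.1, v12.symm, v24]
          · simp [hcol.2, v13.symm, v34]
      · refine .single (hK.adj ha hb hab) ?_
        rcases hs' with rfl | rfl <;> simp [cab, v12, v13, v14]
    rcases host hs hh with ⟨rfl, h1⟩ | ⟨rfl, h1⟩ <;> rcases host hs' hh' with ⟨rfl, h2⟩ | ⟨rfl, h2⟩
    · exact .refl _ _
    · exact main h1 h2
    · exact sw (main h2 h1)
    · exact .refl _ _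
  · intro w hw hp t ht
    by_cases hta : t = a
    · exact hta ▸ (hA hw hp).mono (Set.subset_univ _)
    by_cases htb : t = b
    · exact htb ▸ (hB hw hp).mono (Set.subset_univ _)
    by_cases hn : G.Adj w a ∧ G.Adj w b
    · obtain ⟨k1, k2⟩ := wAB hw hp hn.1 hn.2
      have := cde hb ht hab.symm hta
      refine .cons hn.1 trivial (.two (hK.adj ha hb hab) (hK.adj hb ht (Ne.symm htb)) ?_ ?_ ?_)
      · simp [k1, cab, v12]
      · simp [k1, this, v23.symm]
      · rw [cab, this]; exact v13
    · obtain ⟨y, hy⟩ := hK.exists_pref hconn a b hw hp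
      have hyK := hK.mem_of_adj hw hy.1
      have h1 := wY hw hp hn hy
      have h2 := cde hyK ht (hy.ne hab) hta
      refine Via.cons' (S := {(s₃ : ℕ)}) hy.1 (hcor hyK ht ?_) trivial (Set.subset_univ _) ?_
      · simp [h2]
      · simp [h1, v13]
  · intro w hw hp s h hs hh
    rcases host hs hh with ⟨rfl, h1⟩ | ⟨rfl, h1⟩
    · refine (hA hw hp).mono ?_
      rcases h1 with rfl | rfl <;> rintro x (rfl | rfl) <;>
        simp [v12.symm, v14.symm, v23, v34.symm]
    · refine (hB hw hp).mono ?_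
      rcases h1 with rfl | rfl <;> rintro x (rfl | rfl) <;>
        simp [v12, v14, v23.symm, v34]
  · -- if one of the vertices is adjacent to `a` and `b`, the edge `ab` is used
    have one : ∀ {w w'}, w ∉ K → ¬ Pend G w → w' ∉ K → ¬ Pend G w' → G.Adj w' a → G.Adj w' b →
        Via G c Set.univ w w' := by
      intro w w' hw hp hw' hp' h1 h2
      obtain ⟨k1, k2⟩ := wAB hw' hp' h1 h2
      refine (hA hw hp).trans' (T := {(s₁ : ℕ), (s₃ : ℕ)})
        (.two (hK.adj ha hb hab) h2.symm ?_ ?_ ?_) ?_ (Set.subset_univ _) (Set.subset_univ _)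
      · simp [cab]
      · simp [symm h2.symm, k2]
      · rw [cab, symm h2.symm, k2]; exact v13
      · simp [v12, v14, v23.symm, v34]
    -- if one of the vertices is not adjacent to `a`, the colour `s₃` joins their neighbours
    have two : ∀ {w w'}, w ∉ K → ¬ Pend G w → w' ∉ K → ¬ Pend G w' → ¬ G.Adj w a →
        ¬ (G.Adj w' a ∧ G.Adj w' b) → Via G c Set.univ w w' := by
      intro w w' hw hp hw' hp' hwa hn
      obtain ⟨y, hy⟩ := hK.exists_pref hconn a b hw hp
      obtain ⟨x, hx', hxy⟩ := hK.exists_adj_ne hconn hw hp y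
      obtain ⟨y', hy'⟩ := hK.exists_pref hconn a b hw' hp'
      have hxK := hK.mem_of_adj hw hx'
      have hyK' := hK.mem_of_adj hw' hy'.1
      have hxa' : x ≠ a := by rintro rfl; exact hwa hx'
      have hcx := wX hw hp (fun h => hwa h.1) (fun h => hxy (h.unique hy)) hx'
      have hcy := wY hw' hp' hn hy'
      have h3 := cde hxK hyK' hxa' (hy'.ne hab)
      refine Via.cons' (S := {(s₃ : ℕ)} ∪ {(s₁ : ℕ)}) hx' (Via.trans (hcor hxK hyK' fun _ => h3)
        (.single hy'.1.symm (by rw [symm hy'.1.symm, hcy]; rfl)) ?_) trivial (Set.subset_univ _) ?_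
      · simp [v13.symm]
      · rw [hcx]
        split_ifs <;> simp [v23, v12.symm, v34.symm, v14.symm]
    intro w hw hp w' hw' hp' hne
    by_cases hn : G.Adj w a ∧ G.Adj w b
    · exact vsymm (one hw' hp' hw hp hn.1 hn.2)
    by_cases hn' : G.Adj w' a ∧ G.Adj w' b
    · exact one hw hp hw' hp' hn'.1 hn'.2
    by_cases hwa : G.Adj w a
    swap
    · exact two hw hp hw' hp' hwa hn'
    by_cases hwa' : G.Adj w' a
    swap
    · exact vsymm (two hw' hp' hw hp hwa' hn)
    have h1 := wX hw hp hn nPa hwa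
    have h2 := wX hw' hp' hn' nPa hwa'
    simp only [hxa.symm, true_and, false_or] at h1 h2
    obtain ⟨y', hy'⟩ := hK.exists_pref hconn a b hw' hp'
    have hyK' := hK.mem_of_adj hw' hy'.1
    have hcy := wY hw' hp' hn' hy'
    have hsy := symm hy'.1.symm
    rw [hcy] at hsy
    have hyb : y' ≠ b := by rintro rfl; exact hn' ⟨hwa', hy'.1⟩
    by_cases hcc : c w a = c w' a
    · by_cases hP : Pref G a b w' x₀
      · obtain rfl := hy'.unique hP
        have : c w a = s₂ := by rw [hcc, h2, if_pos hP]
        refine .cons hwa trivial (.two (hK.adj ha hyK' hxa.symm) hy'.1.symm ?_ ?_ ?_)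
        · simp [cax, this, v24.symm]
        · simp [hsy, this, v12]
        · rw [cax, hsy]; exact v14.symm
      · have : c w a = s₄ := by rw [hcc, h2, if_neg hP]
        have hyx : y' ≠ x₀ := by rintro rfl; exact hP hy'
        have h3 := cad hyK' hyb hyx (hy'.ne hab)
        refine .cons hwa trivial (.two (hK.adj ha hyK' (hy'.ne hab).symm) hy'.1.symm ?_ ?_ ?_)
        · simp [h3, this, v24]
        · simp [hsy, this, v14]
        · rw [h3, hsy]; exact v12.symm
    · refine .two hwa hwa'.symm trivial trivial ?_
      rwa [symm hwa'.symm]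

/-- The colours used are pendant vertices, whatever `a`, `b` and `x₀` are. -/
lemma FourPend.painting_mem (hK : IsCore G K) (h : FourPend G s₁ s₂ s₃ s₄) (e : G.edgeSet) :
    painting G K (kcol s₁ s₂ s₃ s₄ a b x₀) (wcol G K s₁ s₂ s₃ s₄ a b x₀) e ∈
      ((↑) : Fin n → ℕ) '' {s | Pend G s} := by
  obtain ⟨⟨p1, p2, p3, p4⟩, -⟩ := h
  have m1 := Set.mem_image_of_mem ((↑) : Fin n → ℕ) (show s₁ ∈ {s | Pend G s} from p1)
  have m2 := Set.mem_image_of_mem ((↑) : Fin n → ℕ) (show s₂ ∈ {s | Pend G s} from p2)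
  have m3 := Set.mem_image_of_mem ((↑) : Fin n → ℕ) (show s₃ ∈ {s | Pend G s} from p3)
  have m4 := Set.mem_image_of_mem ((↑) : Fin n → ℕ) (show s₄ ∈ {s | Pend G s} from p4)
  refine hK.painting_mem kcol_symm (fun s hs => Set.mem_image_of_mem _ hs) ?_ ?_ e
  · intro u _ v _ _
    unfold kcol
    split_ifs <;> assumption
  · intro w _ _ u _
    unfold wcol
    split_ifs <;> assumption

end Schemes

/-! ### The core of a split graph -/

section CoreOf

variable {n : ℕ} {G : SimpleGraph (Fin n)}

/-- `x` is `v` or a neighbour of `v`. -/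
def InNbhd (G : SimpleGraph (Fin n)) (v x : Fin n) : Prop := x = v ∨ G.Adj v x

/-- The closed neighbourhood of `v` is a clique, and its complement is independent. -/
def IsSplitCentre (G : SimpleGraph (Fin n)) (v : Fin n) : Prop :=
  (∀ x y, InNbhd G v x → InNbhd G v y → x ≠ y → G.Adj x y) ∧
    ∀ x y, ¬ InNbhd G v x → ¬ InNbhd G v y → ¬ G.Adj x y

/-- A vertex is in the core if it is not pendant and belongs to the closed neighbourhood of the
least split centre or, if there is no split centre, has two neighbours that are not adjacent. This
selects the clique of a partition without a search through the sets of vertices. -/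
def InCore (G : SimpleGraph (Fin n)) (u : Fin n) : Prop :=
  ¬ Pend G u ∧
    ((∃ v, IsSplitCentre G v ∧ (∀ w, w < v → ¬ IsSplitCentre G w) ∧ InNbhd G v u) ∨
      ((¬ ∃ v, IsSplitCentre G v) ∧ ∃ x y, G.Adj u x ∧ G.Adj u y ∧ x ≠ y ∧ ¬ G.Adj x y))

lemma exists_adj (hconn : G.Connected) (hn : 3 ≤ n) (u : Fin n) : ∃ v, G.Adj u v := by
  have : Nontrivial (Fin n) := Fin.nontrivial_iff_two_le.2 (by omega)
  obtain ⟨v, hv⟩ := exists_ne u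
  obtain ⟨p⟩ := hconn.preconnected u v
  cases p with
  | nil => exact absurd rfl hv
  | cons h _ => exact ⟨_, h⟩

lemma Pend.not_pend_of_adj (hconn : G.Connected) (hn : 3 ≤ n) {u v : Fin n} (hu : Pend G u)
    (h : G.Adj u v) : ¬ Pend G v := by
  intro hv
  obtain ⟨x, hx⟩ : ∃ x, x ∉ ({u, v} : Finset (Fin n)) := by
    by_contra! hx
    have := Finset.card_le_card (fun y _ => hx y : (Finset.univ : Finset (Fin n)) ⊆ {u, v})
    have h2 := Finset.card_le_two (a := u) (b := v)
    simp at this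
    omega
  obtain ⟨p⟩ := hconn.preconnected u x
  obtain ⟨d, -, hd1, hd2⟩ := p.exists_boundary_dart {u, v} (by simp) (by simpa using hx)
  rcases hd1 with hd1 | hd1
  · exact hd2 (Or.inr (hu.eq (hd1 ▸ d.adj) h))
  · exact hd2 (Or.inl (hv.eq (hd1 ▸ d.adj) h.symm))

/-- If there is no split centre, then the clique of a partition, taken maximal, has to contain all
vertices with two nonadjacent neighbours and no others. -/
lemma exists_isClique_mem_iff (hs : IsSplitGraph G) (hc : ¬ ∃ v, IsSplitCentre G v) :
    ∃ S : Set (Fin n), G.IsClique S ∧ G.IsIndepSet Sᶜ ∧ (∀ w ∉ S, ∃ u ∈ S, ¬ G.Adj w u) ∧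
      ∀ u, u ∈ S ↔ ∃ x y, G.Adj u x ∧ G.Adj u y ∧ x ≠ y ∧ ¬ G.Adj x y := by
  obtain ⟨S, ⟨hS1, hS2⟩, hmax⟩ := (Set.toFinite {S : Set (Fin n) | G.IsClique S ∧
    G.IsIndepSet Sᶜ}).exists_maximal hs
  have hout : ∀ w ∉ S, ∃ u ∈ S, ¬ G.Adj w u := by
    intro w hw
    by_contra! h
    refine hw (hmax (y := insert w S) ⟨?_, ?_⟩ (Set.subset_insert _ _) (Set.mem_insert _ _))
    · exact hS1.insert fun u hu _ => h u hu
    · exact hS2.mono (Set.compl_subset_compl.2 (Set.subset_insert _ _))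
  refine ⟨S, hS1, hS2, hout, fun u => ⟨fun hu => ?_, ?_⟩⟩
  · have : ∃ w ∉ S, G.Adj u w := by
      by_contra! h
      have hN : ∀ x, InNbhd G u x ↔ x ∈ S := by
        intro x
        constructor
        · rintro (rfl | hx)
          · exact hu
          · by_contra hxS
            exact h x hxS hx
        · intro hx
          by_cases hxu : x = u
          · exact Or.inl hxu
          · exact Or.inr (hS1 hu hx (Ne.symm hxu))
      refine hc ⟨u, fun x y hx hy hxy => ?_, fun x y hx hy hxy => ?_⟩
      · exact hS1 ((hN x).1 hx) ((hN y).1 hy) hxy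
      · exact hS2 (fun h => hx ((hN x).2 h)) (fun h => hy ((hN y).2 h)) hxy.ne hxy
    obtain ⟨w, hw, huw⟩ := this
    obtain ⟨u', hu', hn⟩ := hout w hw
    refine ⟨w, u', huw, hS1 hu hu' ?_, ?_, hn⟩
    · rintro rfl; exact hn huw.symm
    · rintro rfl; exact hw hu'
  · rintro ⟨x, y, hx, hy, hxy, hn⟩
    by_contra hu
    have mem : ∀ z, G.Adj u z → z ∈ S := fun z hz => by
      by_contra hzS
      exact hS2 hu hzS hz.ne hz
    exact hn (hS1 (mem x hx) (mem y hy) hxy)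

lemma isCore_inCore (hs : IsSplitGraph G) (hconn : G.Connected) (hn : 3 ≤ n) :
    IsCore G {u | InCore G u} := by
  by_cases hc : ∃ v, IsSplitCentre G v
  · obtain ⟨v, hv, hmin⟩ := exists_least hc
    have hK : ∀ u, InCore G u ↔ ¬ Pend G u ∧ InNbhd G v u := by
      intro u
      refine and_congr_right fun hu => ⟨?_, fun h => Or.inl ⟨v, hv, hmin, h⟩⟩
      rintro (⟨v', hv', hmin', hu'⟩ | ⟨h, -⟩)
      · have : v = v' := by
          by_contra hne
          rcases lt_or_gt_of_ne hne with h | h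
          · exact hmin' v h hv
          · exact hmin v' h hv'
        rwa [this]
      · exact absurd hc h
    have mem : ∀ u, u ∈ {u | InCore G u} ↔ ¬ Pend G u ∧ InNbhd G v u := hK
    have key : ∀ x y, Pend G x → G.Adj x y → InNbhd G v y := by
      intro x y hx hxy
      by_contra hy
      refine hv.2 x y ?_ hy hxy
      rintro (rfl | h)
      · exact hy (Or.inr hxy)
      · exact hy (Or.inl (hx.eq hxy h.symm))
    refine ⟨?_, ?_, fun u hu => ((mem u).1 hu).1, ?_⟩
    · exact fun x hx y hy hxy => hv.1 x y ((mem x).1 hx).2 ((mem y).1 hy).2 hxy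
    · intro x hx y hy hxy
      rw [mem, not_and_or, not_not] at hx hy
      by_cases hxp : Pend G x
      · rcases hy with hy | hy
        · exact hxp.not_pend_of_adj hconn hn hxy hy
        · exact hy (key x y hxp hxy)
      · by_cases hyp : Pend G y
        · exact (hx.resolve_left hxp) (key y x hyp hxy.symm)
        · exact hv.2 x y (hx.resolve_left hxp) (hy.resolve_left hyp) hxy
    · intro w hw hp
      rw [mem, not_and] at hw
      have hwv := hw hp
      by_cases hvp : Pend G v
      · obtain ⟨x, hx⟩ := exists_adj hconn hn w
        obtain ⟨h, hvh, huniq⟩ := id hvp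
        refine absurd ⟨x, hx, fun y hy => ?_⟩ hp
        have nb : ∀ z, G.Adj w z → z = h := by
          intro z hz
          have : InNbhd G v z := by
            by_contra hzn
            exact hv.2 w z hwv hzn hz
          rcases this with rfl | hz'
          · exact absurd (Or.inr hz.symm) hwv
          · exact huniq z hz'
        rw [nb x hx, nb y hy]
      · exact ⟨v, (mem v).2 ⟨hvp, Or.inl rfl⟩, fun h => hwv (Or.inr h.symm)⟩
  · obtain ⟨S, hS1, hS2, hS3, hS4⟩ := exists_isClique_mem_iff hs hc
    have hSp : ∀ u ∈ S, ¬ Pend G u := by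
      intro u hu hp
      obtain ⟨x, y, hx, hy, hxy, -⟩ := (hS4 u).1 hu
      exact hxy (hp.eq hx hy)
    have : {u | InCore G u} = S := by
      ext u
      constructor
      · rintro ⟨-, ⟨v, hv, -⟩ | ⟨-, h⟩⟩
        · exact absurd ⟨v, hv⟩ hc
        · exact (hS4 u).2 h
      · exact fun hu => ⟨hSp u hu, Or.inr ⟨hc, (hS4 u).1 hu⟩⟩
    rw [this]
    exact ⟨fun u hu v hv => hS1 hu hv, fun u hu v hv h => hS2 hu hv h.ne h, hSp,
      fun w hw _ => hS3 w hw⟩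

end CoreOf

/-! ### Which configurations of pendant vertices leave no room for a tuple -/

section Configurations

variable {n : ℕ} {G : SimpleGraph (Fin n)} {K : Set (Fin n)}

/-- All vertices other than `a` are pendant, for some `a`. -/
def IsStar (G : SimpleGraph (Fin n)) : Prop := ∃ a, ∀ v, v ≠ a → Pend G v

/-- The pendant vertices can be used as the colours of a rainbow colouring. -/
def HasTuple (G : SimpleGraph (Fin n)) (K : Set (Fin n)) : Prop :=
  ∃ s₁ s₂ s₃ s₄ a b x₀, WideTuple G K s₁ s₂ s₃ s₄ a b x₀ ∨ NarrowTuple G K s₁ s₂ s₃ s₄ a b x₀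

/-- All vertices other than the adjacent vertices `a` and `b` are pendant, and both have pendant
neighbours. -/
def IsDoubleStar (G : SimpleGraph (Fin n)) : Prop :=
  ∃ a b, G.Adj a b ∧ ¬ Pend G a ∧ ¬ Pend G b ∧ (∀ v, v ≠ a → v ≠ b → Pend G v) ∧
    (∃ s, Pend G s ∧ G.Adj s a) ∧ ∃ s, Pend G s ∧ G.Adj s b

/-- There are exactly four pendant vertices, two at `a` and two at the adjacent vertex `b`, and `a`
and `b` have at most one common neighbour. -/
def IsTight (G : SimpleGraph (Fin n)) : Prop :=
  ∃ s₁ s₂ s₃ s₄ a b, FourPend G s₁ s₂ s₃ s₄ ∧ (∀ s, Pend G s → s = s₁ ∨ s = s₂ ∨ s = s₃ ∨ s = s₄) ∧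
    (G.Adj s₁ a ∧ G.Adj s₃ a ∧ G.Adj s₂ b ∧ G.Adj s₄ b) ∧ G.Adj a b ∧
    ∀ x y, G.Adj x a → G.Adj x b → G.Adj y a → G.Adj y b → x = y

lemma IsCore.isStar_or_isDoubleStar (hK : IsCore G K) (hconn : G.Connected)
    (h3 : ¬ ∃ x y z, x ∈ K ∧ y ∈ K ∧ z ∈ K ∧ x ≠ y ∧ x ≠ z ∧ y ≠ z) {s : Fin n} (hs : Pend G s) :
    IsStar G ∨ IsDoubleStar G := by
  have hout : ∀ v ∉ K, Pend G v := by
    intro w hw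
    by_contra hp
    obtain ⟨u, hu, hwu⟩ := hK.maximal w hw hp
    obtain ⟨x, hx, -⟩ := hK.exists_adj_ne hconn hw hp w
    obtain ⟨y, hy, hxy⟩ := hK.exists_adj_ne hconn hw hp x
    refine h3 ⟨u, x, y, hu, hK.mem_of_adj hw hx, hK.mem_of_adj hw hy, ?_, ?_, hxy.symm⟩
    · rintro rfl; exact hwu hx
    · rintro rfl; exact hwu hy
  obtain ⟨a, ha, -⟩ := id hs
  have haK := hK.mem_of_pend_adj hs ha
  by_cases h2 : ∃ b ∈ K, b ≠ a
  · obtain ⟨b, hbK, hba⟩ := h2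
    have hab := hK.adj haK hbK hba.symm
    have hrest : ∀ v, v ≠ a → v ≠ b → Pend G v := fun v hva hvb => hout v fun hv =>
      h3 ⟨a, b, v, haK, hbK, hv, hba.symm, hva.symm, hvb.symm⟩
    refine Or.inr ⟨a, b, hab, hK.not_pend a haK, hK.not_pend b hbK, hrest, ⟨s, hs, ha⟩, ?_⟩
    by_contra! h
    refine hK.not_pend b hbK ⟨a, hab.symm, fun w hw => ?_⟩
    by_contra hwa
    exact h w (hrest w hwa hw.ne') hw.symm
  · refine Or.inl ⟨a, fun v hv => hout v fun hvK => h2 ⟨v, hvK, hv⟩⟩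

/-- If four pendant vertices are given, then the pendant vertices can be used as colours, or
the graph is of one of three special kinds. -/
lemma IsCore.hasTuple_or (hK : IsCore G K) (hconn : G.Connected) {q₁ q₂ q₃ q₄ : Fin n}
    (hq : FourPend G q₁ q₂ q₃ q₄) : HasTuple G K ∨ IsStar G ∨ IsDoubleStar G ∨ IsTight G := by
  by_cases h3 : ∃ x y z, x ∈ K ∧ y ∈ K ∧ z ∈ K ∧ x ≠ y ∧ x ≠ z ∧ y ≠ z
  swap
  · rcases hK.isStar_or_isDoubleStar hconn h3 hq.1.1 with h | h
    · exact Or.inr (Or.inl h)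
    · exact Or.inr (Or.inr (Or.inl h))
  have third : ∀ a b, ∃ d, d ∈ K ∧ d ≠ a ∧ d ≠ b := by
    obtain ⟨x, y, z, hx, hy, hz, hxy, hxz, hyz⟩ := h3
    intro a b
    grind
  by_cases hT : HasTuple G K
  · exact Or.inl hT
  obtain ⟨⟨p1, p2, p3, p4⟩, h12, h13, h14, h23, h24, h34⟩ := hq
  have fourth : ∀ x y z : Fin n, ∃ s, Pend G s ∧ s ≠ x ∧ s ≠ y ∧ s ≠ z := by
    intro x y z
    grind
  -- no vertex has three pendant neighbours
  have hno3 : ∀ {x y z a}, Pend G x → Pend G y → Pend G z → x ≠ y → x ≠ z → y ≠ z →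
      G.Adj x a → G.Adj y a → G.Adj z a → False := by
    intro x y z a hx hy hz hxy hxz hyz xa ya za
    obtain ⟨s, hs, hsx, hsy, hsz⟩ := fourth x y z
    obtain ⟨b, hb, hba, -⟩ := third a a
    exact hT ⟨x, y, z, s, a, b, x, Or.inl ⟨⟨⟨hx, hy, hz, hs⟩, hxy, hxz, hsx.symm, hyz, hsy.symm,
      hsz.symm⟩, hK.mem_of_pend_adj hx xa, hb, hba.symm, third a b, rfl, Or.inl ⟨xa, ya, za⟩⟩⟩
  -- no three vertices have pendant neighbours
  have hno2 : ∀ {x y z a b d}, Pend G x → Pend G y → Pend G z → a ≠ b → a ≠ d → b ≠ d →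
      G.Adj x a → G.Adj y b → G.Adj z d → False := by
    intro x y z a b d hx hy hz hab had hbd xa yb zd
    have hne : ∀ {u v r t}, Pend G u → r ≠ t → G.Adj u r → G.Adj v t → u ≠ v := by
      rintro u v r t hu hrt hr ht rfl
      exact hrt (hu.eq hr ht)
    obtain ⟨s, hs, hsx, hsy, hsz⟩ := fourth x y z
    exact hT ⟨z, y, x, s, a, b, z, Or.inl ⟨⟨⟨hz, hy, hx, hs⟩, hne hz hbd.symm zd yb,
      hne hz had.symm zd xa, hsz.symm, hne hy hab.symm yb xa, hsy.symm, hsx.symm⟩,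
      hK.mem_of_pend_adj hx xa, hK.mem_of_pend_adj hy yb, hab, third a b, rfl,
      Or.inr ⟨xa, yb, fun h => had (hz.eq h zd), fun h => hbd (hz.eq h zd)⟩⟩⟩
  have two : ∃ s₁ s₂ s₃ s₄ a b, FourPend G s₁ s₂ s₃ s₄ ∧
      (G.Adj s₁ a ∧ G.Adj s₃ a ∧ G.Adj s₂ b ∧ G.Adj s₄ b) ∧ a ≠ b := by
    obtain ⟨r1, hr1, -⟩ := id p1
    obtain ⟨r2, hr2, -⟩ := id p2
    obtain ⟨r3, hr3, -⟩ := id p3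
    obtain ⟨r4, hr4, -⟩ := id p4
    have c1 : r1 = r2 ∨ r1 = r3 ∨ r2 = r3 := by
      by_contra! h
      exact hno2 p1 p2 p3 h.1 h.2.1 h.2.2 hr1 hr2 hr3
    have c2 : r1 = r2 ∨ r1 = r4 ∨ r2 = r4 := by
      by_contra! h
      exact hno2 p1 p2 p4 h.1 h.2.1 h.2.2 hr1 hr2 hr4
    have c3 : r1 = r3 ∨ r1 = r4 ∨ r3 = r4 := by
      by_contra! h
      exact hno2 p1 p3 p4 h.1 h.2.1 h.2.2 hr1 hr3 hr4
    have d1 : ¬ (r1 = r2 ∧ r1 = r3) := fun ⟨e, e'⟩ =>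
      hno3 p1 p2 p3 h12 h13 h23 hr1 (e ▸ hr2) (e' ▸ hr3)
    have d2 : ¬ (r1 = r2 ∧ r1 = r4) := fun ⟨e, e'⟩ =>
      hno3 p1 p2 p4 h12 h14 h24 hr1 (e ▸ hr2) (e' ▸ hr4)
    have d3 : ¬ (r1 = r3 ∧ r1 = r4) := fun ⟨e, e'⟩ =>
      hno3 p1 p3 p4 h13 h14 h34 hr1 (e ▸ hr3) (e' ▸ hr4)
    have d4 : ¬ (r2 = r3 ∧ r2 = r4) := fun ⟨e, e'⟩ =>
      hno3 p2 p3 p4 h23 h24 h34 hr2 (e ▸ hr3) (e' ▸ hr4)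
    by_cases e12 : r1 = r2
    · have e34 : r3 = r4 := by grind
      exact ⟨q₁, q₃, q₂, q₄, r1, r3, ⟨⟨p1, p3, p2, p4⟩, h13, h12, h14, h23.symm, h34, h24⟩,
        ⟨hr1, e12 ▸ hr2, hr3, e34 ▸ hr4⟩, by grind⟩
    by_cases e13 : r1 = r3
    · have e24 : r2 = r4 := by grind
      exact ⟨q₁, q₂, q₃, q₄, r1, r2, ⟨⟨p1, p2, p3, p4⟩, h12, h13, h14, h23, h24, h34⟩,
        ⟨hr1, e13 ▸ hr3, hr2, e24 ▸ hr4⟩, e12⟩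
    · have e14 : r1 = r4 := by grind
      have e23 : r2 = r3 := by grind
      exact ⟨q₁, q₂, q₄, q₃, r1, r2, ⟨⟨p1, p2, p4, p3⟩, h12, h14, h13, h24, h23, h34.symm⟩,
        ⟨hr1, e14 ▸ hr4, hr2, e23 ▸ hr3⟩, e12⟩
  obtain ⟨s₁, s₂, s₃, s₄, a, b, hF, ⟨l1, l3, l2, l4⟩, hab⟩ := two
  obtain ⟨⟨p1, p2, p3, p4⟩, h12, h13, h14, h23, h24, h34⟩ := id hF
  have haK := hK.mem_of_pend_adj p1 l1
  have hbK := hK.mem_of_pend_adj p2 l2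
  have hall : ∀ s, Pend G s → s = s₁ ∨ s = s₂ ∨ s = s₃ ∨ s = s₄ := by
    intro s hs
    by_contra! h
    obtain ⟨r, hr, -⟩ := id hs
    by_cases hra : r = a
    · exact hno3 p1 p3 hs h13 h.1.symm h.2.2.1.symm l1 l3 (hra ▸ hr)
    by_cases hrb : r = b
    · exact hno3 p2 p4 hs h24 h.2.1.symm h.2.2.2.symm l2 l4 (hrb ▸ hr)
    · exact hno2 p1 p2 hs hab (Ne.symm hra) (Ne.symm hrb) l1 l2 hr
  obtain ⟨x₀, hx, hxa, hxb⟩ := third a b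
  refine Or.inr (Or.inr (Or.inr ⟨s₁, s₂, s₃, s₄, a, b, hF, hall, ⟨l1, l3, l2, l4⟩,
    hK.adj haK hbK hab, ?_⟩))
  have hx0 : ∀ x, G.Adj x a → G.Adj x b → x = x₀ := by
    intro x h1 h2
    by_contra hne
    exact hT ⟨s₁, s₂, s₃, s₄, a, b, x₀, Or.inr ⟨hF, hall, ⟨l1, l3, l2, l4⟩, ⟨haK, hbK, hab⟩,
      ⟨hx, hxa, hxb⟩, x, hne, h1, h2⟩⟩
  intro x y h1 h2 h3 h4
  rw [hx0 x h1 h2, hx0 y h3 h4]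

end Configurations

/-! ### Lower bounds -/

section LowerBounds

variable {n : ℕ} {G : SimpleGraph (Fin n)}

open Classical in
/-- The set of pendant vertices. -/
noncomputable def pendants (G : SimpleGraph (Fin n)) : Finset (Fin n) :=
  Finset.univ.filter (Pend G)

lemma mem_pendants {s : Fin n} : s ∈ pendants G ↔ Pend G s := by simp [pendants]

lemma edge_mem_of_pend {s h t : Fin n} (hs : Pend G s) (hh : G.Adj s h) (hst : s ≠ t)
    (p : G.Walk s t) : s(s, h) ∈ p.edges := by
  cases p with
  | nil => exact absurd rfl hst
  | cons ha q => simp [hs.eq hh ha]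

lemma edge_mem_of_pend' {s h t : Fin n} (hs : Pend G s) (hh : G.Adj s h) (hst : s ≠ t)
    (p : G.Walk t s) : s(s, h) ∈ p.edges := by
  simpa using edge_mem_of_pend hs hh hst p.reverse

/-- The colour of the edge at a pendant vertex; at any other vertex it is the colour of some edge,
or `0` if there is none. -/
noncomputable def pendColour (c : EdgeColouring G) (s : Fin n) : ℕ :=
  open Classical in if h : ∃ t, G.Adj s t then c ⟨s(s, h.choose), h.choose_spec⟩ else 0

lemma pendColour_eq (c : EdgeColouring G) {s h : Fin n} (hs : Pend G s) (hh : G.Adj s h) :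
    pendColour c s = c ⟨s(s, h), hh⟩ := by
  have hex : ∃ t, G.Adj s t := ⟨h, hh⟩
  rw [pendColour, dif_pos hex]
  have := hs.eq hex.choose_spec hh
  congr 3

/-- The edges of pendant vertices have different colours, as a rainbow path between two of them
uses both edges. -/
lemma IsRainbowColouring.pendColour_injOn {c : EdgeColouring G} (hc : IsRainbowColouring c)
    (hconn : G.Connected) (hn : 3 ≤ n) : Set.InjOn (pendColour c) (pendants G) := by
  intro s hs t ht hst
  by_contra hne
  rw [Finset.mem_coe, mem_pendants] at hs ht
  obtain ⟨h, hh, -⟩ := id hs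
  obtain ⟨k, hk, -⟩ := id ht
  obtain ⟨p, -, hp⟩ := hc s t
  rw [pendColour_eq c hs hh, pendColour_eq c ht hk] at hst
  have := Sym2.eq_iff.1 <| congrArg Subtype.val <| hp ⟨s(s, h), hh⟩ ⟨s(t, k), hk⟩
    (edge_mem_of_pend hs hh hne p) (edge_mem_of_pend' ht hk (Ne.symm hne) p) hst
  rcases this with ⟨h1, -⟩ | ⟨-, h1⟩
  · exact hne h1
  · subst h1
    exact hs.not_pend_of_adj hconn hn hh ht

lemma pendColour_mem (hconn : G.Connected) (hn : 3 ≤ n) (c : EdgeColouring G) (s : Fin n) :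
    pendColour c s ∈ Set.range c := by
  obtain ⟨t, ht⟩ := exists_adj hconn hn s
  rw [pendColour, dif_pos ⟨t, ht⟩]
  exact Set.mem_range_self _

lemma IsRainbowColouring.card_pendants_le {c : EdgeColouring G} (hc : IsRainbowColouring c)
    (hconn : G.Connected) (hn : 3 ≤ n) : (pendants G).card ≤ numColours c := by
  rw [← Set.ncard_coe_finset, ← (hc.pendColour_injOn hconn hn).ncard_image, numColours]
  refine Set.ncard_le_ncard ?_ (Set.finite_range c)
  rintro _ ⟨s, -, rfl⟩
  exact pendColour_mem hconn hn c s

/-- If there are no more colours than pendant vertices, then every colour occurs at a pendant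
vertex. -/
lemma IsRainbowColouring.exists_pendColour_eq {c : EdgeColouring G} (hc : IsRainbowColouring c)
    (hconn : G.Connected) (hn : 3 ≤ n) (hle : numColours c ≤ (pendants G).card) (e : G.edgeSet) :
    ∃ s, Pend G s ∧ pendColour c s = c e := by
  have : pendColour c '' pendants G = Set.range c := by
    refine Set.eq_of_subset_of_ncard_le ?_ ?_ (Set.finite_range c)
    · rintro _ ⟨s, -, rfl⟩
      exact pendColour_mem hconn hn c s
    · rwa [(hc.pendColour_injOn hconn hn).ncard_image, Set.ncard_coe_finset]
  obtain ⟨s, hs, h⟩ := this.symm ▸ Set.mem_range_self e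
  exact ⟨s, mem_pendants.1 hs, h⟩

/-- A rainbow path has no more edges than there are colours. -/
lemma IsRainbowPath.length_le {c : EdgeColouring G} {u v : Fin n} {p : G.Walk u v}
    (hp : IsRainbowPath c p) : p.length ≤ numColours c := by
  classical
  have h1 : p.edges.toFinset.card = p.length := by
    rw [List.toFinset_card_of_nodup hp.1.isTrail.edges_nodup, SimpleGraph.Walk.length_edges]
  rw [← h1, numColours, Set.ncard_eq_toFinset_card _ (Set.finite_range c)]
  refine Finset.card_le_card_of_injOn
    (fun e => if h : e ∈ G.edgeSet then c ⟨e, h⟩ else 0) ?_ ?_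
  · intro e he
    have := p.edges_subset_edgeSet (List.mem_toFinset.1 he)
    simp [this]
  · intro e he f hf hef
    have he' := List.mem_toFinset.1 he
    have hf' := List.mem_toFinset.1 hf
    simp only [p.edges_subset_edgeSet he', p.edges_subset_edgeSet hf', dif_pos] at hef
    exact congrArg Subtype.val (hp.2 ⟨e, _⟩ ⟨f, _⟩ he' hf' hef)

/-- The central edge of a double star separates the pendant vertices at `a` from those at `b`, so
its colour cannot be that of a pendant edge. -/
lemma IsDoubleStar.lt_numColours (h : IsDoubleStar G) (hconn : G.Connected) (hn : 3 ≤ n)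
    {c : EdgeColouring G} (hc : IsRainbowColouring c) : (pendants G).card < numColours c := by
  by_contra! hle
  obtain ⟨a, b, hab, ha, hb, hrest, hsa, hsb⟩ := h
  have main : ∀ {a b}, (hab : G.Adj a b) → ¬ Pend G a → ¬ Pend G b →
      (∀ v, v ≠ a → v ≠ b → Pend G v) → (∃ s, Pend G s ∧ G.Adj s b) →
      ∀ s, Pend G s → G.Adj s a → pendColour c s ≠ c ⟨s(a, b), hab⟩ := by
    rintro a b hab ha hb hrest ⟨t, ht, htb⟩ s hs hsa hcol
    have hst : s ≠ t := by
      rintro rfl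
      exact hab.ne (hs.eq hsa htb)
    obtain ⟨p, -, hp⟩ := hc s t
    obtain ⟨d, hd, hd1, hd2⟩ := p.exists_boundary_dart ({a} ∪ {x | Pend G x ∧ G.Adj x a})
      (Or.inr ⟨hs, hsa⟩) (by
        rintro (h | ⟨-, h⟩)
        · exact ha (h ▸ ht)
        · exact hab.ne (ht.eq h htb))
    have hdab : d.edge = s(a, b) := by
      obtain ⟨⟨x, y⟩, hxy⟩ := d
      rcases hd1 with hd1 | ⟨hx, hxa⟩
      · obtain rfl : x = a := hd1
        have : y = b := by
          by_contra hyb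
          have hyp : Pend G y := hrest y hxy.ne' hyb
          exact hd2 (Or.inr ⟨hyp, hxy.symm⟩)
        subst this
        rfl
      · exact absurd (Or.inl (hx.eq hxy hxa)) hd2
    rw [pendColour_eq c hs hsa] at hcol
    have hmem : s(a, b) ∈ p.edges := hdab ▸ List.mem_map_of_mem hd
    have := Sym2.eq_iff.1 <| congrArg Subtype.val <| hp ⟨s(s, a), hsa⟩ ⟨s(a, b), hab⟩
      (edge_mem_of_pend hs hsa hst p) hmem hcol
    rcases this with ⟨h1, -⟩ | ⟨h1, -⟩
    · exact ha (h1 ▸ hs)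
    · exact hb (h1 ▸ hs)
  obtain ⟨s, hs, hcol⟩ := hc.exists_pendColour_eq hconn hn hle ⟨s(a, b), hab⟩
  obtain ⟨r, hr, -⟩ := id hs
  have hrp := hs.not_pend_of_adj hconn hn hr
  by_cases hra : r = a
  · exact main hab ha hb hrest hsb s hs (hra ▸ hr) hcol
  by_cases hrb : r = b
  · refine main hab.symm hb ha (fun v h1 h2 => hrest v h2 h1) hsa s hs (hrb ▸ hr) ?_
    rw [hcol]
    congr 2
    exact Sym2.eq_swap
  · exact hrp (hrest r hra hrb)

/-- If the edge `ab` has the colour of a pendant edge at `a`, then the walk from there to a pendant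
vertex at `b` passes through a common neighbour of `a` and `b`, and spends all four colours. -/
lemma exists_common_neighbour {c : EdgeColouring G} (hc : IsRainbowColouring c)
    (hn4 : numColours c ≤ 4) {a b s t : Fin n} (hab : G.Adj a b) (ha : ¬ Pend G a) (hb : ¬ Pend G b)
    (hs : Pend G s) (ht : Pend G t) (hsa : G.Adj s a) (htb : G.Adj t b)
    (hcol : pendColour c s = c ⟨s(a, b), hab⟩) :
    ∃ x, ∃ (hxa : G.Adj x a) (hxb : G.Adj x b), c ⟨s(x, a), hxa⟩ ≠ c ⟨s(x, b), hxb⟩ ∧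
      c ⟨s(x, a), hxa⟩ ≠ pendColour c s ∧ c ⟨s(x, a), hxa⟩ ≠ pendColour c t ∧
      c ⟨s(x, b), hxb⟩ ≠ pendColour c s ∧ c ⟨s(x, b), hxb⟩ ≠ pendColour c t := by
  have hst : s ≠ t := by
    rintro rfl
    exact hab.ne (hs.eq hsa htb)
  obtain ⟨p, hpath⟩ := hc s t
  have hlen := hpath.length_le.trans hn4
  have hnodup := hpath.1.isTrail.edges_nodup
  obtain ⟨-, hp⟩ := hpath
  -- the edge `ab` cannot occur on the path
  have hnab : s(a, b) ∉ p.edges := by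
    intro hmem
    rw [pendColour_eq c hs hsa] at hcol
    have := Sym2.eq_iff.1 <| congrArg Subtype.val <| hp ⟨s(s, a), hsa⟩ ⟨s(a, b), hab⟩
      (edge_mem_of_pend hs hsa hst p) hmem hcol
    rcases this with ⟨h1, -⟩ | ⟨h1, -⟩
    · exact ha (h1 ▸ hs)
    · exact hb (h1 ▸ hs)
  rw [pendColour_eq c hs hsa, pendColour_eq c ht htb]
  cases p with
  | nil => exact absurd rfl hst
  | cons h1 q =>
  obtain rfl := hs.eq hsa h1
  cases q with
  | nil => exact absurd ht ha
  | @cons _ x _ h2 q =>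
  cases q with
  | nil => exact absurd (ht.eq h2.symm htb) hab.ne
  | @cons _ y _ h3 q =>
  cases q with
  | nil =>
    obtain rfl := ht.eq h3.symm htb
    simp at hnab
  | @cons _ z _ h4 q =>
  cases q with
  | cons h5 q => simp at hlen; omega
  | nil =>
    obtain rfl := ht.eq h4.symm htb
    simp only [SimpleGraph.Walk.edges_cons, SimpleGraph.Walk.edges_nil, List.nodup_cons,
      List.mem_cons, not_or] at hnodup
    obtain ⟨⟨n12, n13, n14, -⟩, ⟨n23, n24, -⟩, ⟨n34, -⟩, -⟩ := hnodup
    have inj : ∀ e f : G.edgeSet, e.1 ∈ (SimpleGraph.Walk.cons h1 (.cons h2 (.cons h3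
        (.cons h4 .nil)))).edges → f.1 ∈ (SimpleGraph.Walk.cons h1 (.cons h2 (.cons h3
        (.cons h4 .nil)))).edges → e.1 ≠ f.1 → c e ≠ c f := by
      intro e f he hf hne h
      exact hne (congrArg Subtype.val (hp e f he hf h))
    refine ⟨x, h2.symm, h3, ?_, ?_, ?_, ?_, ?_⟩
    · refine inj _ _ (by simp) (by simp) ?_
      change s(_, _) ≠ s(_, _)
      rwa [Sym2.eq_swap (a := x) (b := a)]
    · refine inj _ _ (by simp) (by simp) ?_
      change s(_, _) ≠ s(_, _)
      rw [Sym2.eq_swap (a := x)]; exact Ne.symm n12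
    · refine inj _ _ (by simp) (by simp) ?_
      change s(_, _) ≠ s(_, _)
      rw [Sym2.eq_swap (a := x), Sym2.eq_swap (a := t)]; exact n24
    · exact inj _ _ (by simp) (by simp) (Ne.symm n13)
    · refine inj _ _ (by simp) (by simp) ?_
      change s(_, _) ≠ s(_, _)
      rw [Sym2.eq_swap (a := t)]; exact n34

/-- The colour of `ab` would be that of a pendant edge, say at `a`. The walks from there to the two
pendant vertices at `b` pass through the same common neighbour of `a` and `b`, whose two edges avoid
all pendant colours but one. -/
lemma IsTight.lt_numColours (h : IsTight G) (hconn : G.Connected) (hn : 3 ≤ n)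
    {c : EdgeColouring G} (hc : IsRainbowColouring c) : (pendants G).card < numColours c := by
  by_contra! hle
  obtain ⟨s₁, s₂, s₃, s₄, a, b, ⟨⟨p1, p2, p3, p4⟩, h12, h13, h14, h23, h24, h34⟩, hall,
    ⟨l1, l3, l2, l4⟩, hab, huniq⟩ := h
  have hn4 : numColours c ≤ 4 := by
    refine hle.trans ((Finset.card_le_card (t := {s₁, s₂, s₃, s₄}) fun s hs => ?_).trans
      Finset.card_le_four)
    simpa using hall s (mem_pendants.1 hs)
  have inj : ∀ {s t}, Pend G s → Pend G t → s ≠ t → pendColour c s ≠ pendColour c t :=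
    fun hs ht hne h => hne (hc.pendColour_injOn hconn hn (mem_pendants.2 hs) (mem_pendants.2 ht) h)
  have main : ∀ {a b s s' t t'}, (hab : G.Adj a b) →
      (∀ x y, G.Adj x a → G.Adj x b → G.Adj y a → G.Adj y b → x = y) →
      Pend G s → Pend G t → Pend G t' → t ≠ t' →
      (∀ r, Pend G r → r = s ∨ r = s' ∨ r = t ∨ r = t') →
      G.Adj s a → G.Adj t b → G.Adj t' b → pendColour c s ≠ c ⟨s(a, b), hab⟩ := by
    intro a b s s' t t' hab huniq hs ht ht' htt hall hsa htb htb' hcol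
    have ha := hs.not_pend_of_adj hconn hn hsa
    have hb := ht.not_pend_of_adj hconn hn htb
    obtain ⟨x, hxa, hxb, k1, k2, k3, k4, k5⟩ :=
      exists_common_neighbour hc hn4 hab ha hb hs ht hsa htb hcol
    obtain ⟨y, hya, hyb, m1, m2, m3, m4, m5⟩ :=
      exists_common_neighbour hc hn4 hab ha hb hs ht' hsa htb' hcol
    obtain rfl := huniq x y hxa hxb hya hyb
    -- both edges of the common neighbour would have the one colour that is left
    have left : ∀ e, c e ≠ pendColour c s → c e ≠ pendColour c t → c e ≠ pendColour c t' →
        c e = pendColour c s' := by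
      intro e e1 e2 e3
      obtain ⟨r, hr, hre⟩ := hc.exists_pendColour_eq hconn hn hle e
      rcases hall r hr with rfl | rfl | rfl | rfl
      · exact absurd hre.symm e1
      · exact hre.symm
      · exact absurd hre.symm e2
      · exact absurd hre.symm e3
    exact k1 ((left _ k2 k3 m3).trans (left _ k4 k5 m5).symm)
  obtain ⟨s, hs, hcol⟩ := hc.exists_pendColour_eq hconn hn hle ⟨s(a, b), hab⟩
  have hcol' : pendColour c s = c ⟨s(b, a), hab.symm⟩ := by
    rw [hcol]
    congr 2
    exact Sym2.eq_swap
  have huniq' : ∀ x y, G.Adj x b → G.Adj x a → G.Adj y b → G.Adj y a → x = y :=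
    fun x y h1 h2 h3 h4 => huniq x y h2 h1 h4 h3
  rcases hall s hs with rfl | rfl | rfl | rfl
  · exact main (s' := s₃) hab huniq hs p2 p4 h24 (by grind) l1 l2 l4 hcol
  · exact main (s' := s₄) hab.symm huniq' hs p1 p3 h13 (by grind) l2 l1 l3 hcol'
  · exact main (s' := s₁) hab huniq hs p2 p4 h24 (by grind) l3 l2 l4 hcol
  · exact main (s' := s₂) hab.symm huniq' hs p1 p3 h13 (by grind) l4 l1 l3 hcol'

end LowerBounds

namespace Form

section Derived

variable {N n : ℕ} {G : SimpleGraph (Fin n)} {φ ψ : Form N} {e : Fin N → Fin n} {i j : Fin N}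

/-- Disjunction. -/
def or (φ ψ : Form N) : Form N := neg (and (neg φ) (neg ψ))

/-- Implication. -/
def imp (φ ψ : Form N) : Form N := neg (and φ (neg ψ))

/-- Equality. -/
def eq (i j : Fin N) : Form N := and (neg (lt i j)) (neg (lt j i))

/-- Existential quantification. -/
def ex (i : Fin N) (φ : Form N) : Form N := first i φ tt

/-- Universal quantification. -/
def all (i : Fin N) (φ : Form N) : Form N := neg (ex i (neg φ))

/-- The formula `φ` in one case, and `ψ` in the other. -/
def cond (θ φ ψ : Form N) : Form N := or (and θ φ) (and (neg θ) ψ)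

@[simp] lemma sat_adj : Sat G (adj i j) e ↔ G.Adj (e i) (e j) := .rfl
@[simp] lemma sat_lt : Sat G (lt i j) e ↔ e i < e j := .rfl
@[simp] lemma sat_tt : Sat G (tt : Form N) e ↔ True := .rfl
@[simp] lemma sat_neg : Sat G (neg φ) e ↔ ¬ Sat G φ e := .rfl
@[simp] lemma sat_and : Sat G (and φ ψ) e ↔ Sat G φ e ∧ Sat G ψ e := .rfl

@[simp] lemma sat_or : Sat G (or φ ψ) e ↔ Sat G φ e ∨ Sat G ψ e := by
  simp only [or, sat_neg, sat_and]; tauto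

@[simp] lemma sat_imp : Sat G (imp φ ψ) e ↔ (Sat G φ e → Sat G ψ e) := by
  simp only [imp, sat_neg, sat_and]; tauto

@[simp] lemma sat_eq : Sat G (eq i j) e ↔ e i = e j := by
  simp only [eq, sat_neg, sat_and, sat_lt, not_lt]
  exact ⟨fun h => le_antisymm h.2 h.1, fun h => by simp [h]⟩

@[simp] lemma sat_ex : Sat G (ex i φ) e ↔ ∃ v, Sat G φ (update e i v) := by
  constructor
  · rintro ⟨v, hv, -⟩
    exact ⟨v, hv⟩
  · intro h
    obtain ⟨v, hv, hmin⟩ := exists_least h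
    exact ⟨v, hv, hmin, trivial⟩

@[simp] lemma sat_all : Sat G (all i φ) e ↔ ∀ v, Sat G φ (update e i v) := by
  simp [all]

@[simp] lemma sat_cond {θ : Form N} :
    Sat G (cond θ φ ψ) e ↔ (Sat G θ e ∧ Sat G φ e) ∨ (¬ Sat G θ e ∧ Sat G ψ e) := by
  simp only [cond, sat_or, sat_and, sat_neg]

end Derived

end Form

/-! ### Formulas for the notions of the colouring -/

section Formulas

variable {n : ℕ} {G : SimpleGraph (Fin n)} {e : Fin 20 → Fin n} {i j : Fin 20}

open Form

lemma lt_ite_iff {p : Prop} [Decidable p] {x a b : ℕ} :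
    (x < if p then a else b) ↔ (p ∧ x < a) ∨ (¬ p ∧ x < b) := by
  split_ifs with h <;> simp [h]

lemma update_of_lt {α : Type*} {e : Fin 20 → α} {v : α} (h : j < i) : update e j v i = e i :=
  update_of_ne h.ne' _ _

/-- The formula for `Pend`. Each formula of this section binds variables that are smaller than its
free variables only. -/
def pendF (i : Fin 20) : Form 20 := ex 0 (and (adj i 0) (all 1 (imp (adj i 1) (eq 1 0))))

lemma sat_pendF (hi : 1 < i) : (pendF i).Sat G e ↔ Pend G (e i) := by
  have h0 : 0 < i := lt_trans (by decide) hi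
  simp [pendF, Pend, update_of_lt hi, update_of_lt h0]

/-- The formula for `InNbhd`. -/
def nbhdF (v x : Fin 20) : Form 20 := or (eq x v) (adj v x)

@[simp] lemma sat_nbhdF : (nbhdF i j).Sat G e ↔ InNbhd G (e i) (e j) := by
  simp [nbhdF, InNbhd]

/-- The formula for `IsSplitCentre`. -/
def centreF (v : Fin 20) : Form 20 :=
  and (all 2 (all 3 (imp (nbhdF v 2) (imp (nbhdF v 3) (imp (neg (eq 2 3)) (adj 2 3))))))
    (all 2 (all 3 (imp (neg (nbhdF v 2)) (imp (neg (nbhdF v 3)) (neg (adj 2 3))))))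

lemma sat_centreF (hi : 3 < i) : (centreF i).Sat G e ↔ IsSplitCentre G (e i) := by
  have h0 : 2 < i := lt_trans (by decide) hi
  simp [centreF, IsSplitCentre, update_of_lt hi, update_of_lt h0]

/-- The formula for `InCore`. -/
def coreF (u : Fin 20) : Form 20 :=
  and (neg (pendF u)) (or
    (ex 4 (and (centreF 4) (and (all 5 (imp (lt 5 4) (neg (centreF 5)))) (nbhdF 4 u))))
    (and (neg (ex 4 (centreF 4)))
      (ex 2 (ex 3 (and (adj u 2) (and (adj u 3) (and (neg (eq 2 3)) (neg (adj 2 3)))))))))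

lemma sat_coreF (hi : 5 < i) : (coreF i).Sat G e ↔ InCore G (e i) := by
  have h4 : 4 < i := lt_trans (by decide) hi
  have h3 : 3 < i := lt_trans (by decide) h4
  have h2 : 2 < i := lt_trans (by decide) h3
  have h1 : 1 < i := lt_trans (by decide) h2
  simp [coreF, InCore, update_of_lt h4, update_of_lt h3, update_of_lt h2,
    sat_pendF h1, sat_centreF]

/-- The formula for `FourPend`. -/
def fourF (s₁ s₂ s₃ s₄ : Fin 20) : Form 20 :=
  and (and (pendF s₁) (and (pendF s₂) (and (pendF s₃) (pendF s₄))))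
    (and (neg (eq s₁ s₂)) (and (neg (eq s₁ s₃)) (and (neg (eq s₁ s₄))
      (and (neg (eq s₂ s₃)) (and (neg (eq s₂ s₄)) (neg (eq s₃ s₄)))))))

/-- The formula for `WideTuple`, with the variables `11` to `17` as arguments. -/
def wideF : Form 20 :=
  and (fourF 11 12 13 14) (and (coreF 15) (and (coreF 16) (and (neg (eq 15 16))
    (and (ex 6 (and (coreF 6) (and (neg (eq 6 15)) (neg (eq 6 16))))) (and (eq 17 11)
      (or (and (adj 11 15) (and (adj 12 15) (adj 13 15)))
        (and (adj 13 15) (and (adj 12 16) (and (neg (adj 11 15)) (neg (adj 11 16)))))))))))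

/-- The formula for `NarrowTuple`, with the variables `11` to `17` as arguments. -/
def narrowF : Form 20 :=
  and (fourF 11 12 13 14) (and
    (all 6 (imp (pendF 6) (or (eq 6 11) (or (eq 6 12) (or (eq 6 13) (eq 6 14))))))
    (and (and (adj 11 15) (and (adj 13 15) (and (adj 12 16) (adj 14 16))))
      (and (and (coreF 15) (and (coreF 16) (neg (eq 15 16))))
        (and (and (coreF 17) (and (neg (eq 17 15)) (neg (eq 17 16))))
          (ex 6 (and (neg (eq 6 17)) (and (adj 6 15) (adj 6 16))))))))

lemma sat_wideF : wideF.Sat G e ↔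
    WideTuple G {u | InCore G u} (e 11) (e 12) (e 13) (e 14) (e 15) (e 16) (e 17) := by
  simp [wideF, WideTuple, fourF, FourPend, sat_pendF, sat_coreF]

lemma sat_narrowF : narrowF.Sat G e ↔
    NarrowTuple G {u | InCore G u} (e 11) (e 12) (e 13) (e 14) (e 15) (e 16) (e 17) := by
  simp [narrowF, NarrowTuple, fourF, FourPend, sat_pendF, sat_coreF]

/-- The formula for `Pref`, where `a` and `b` are the variables `15` and `16`. -/
def prefF (w u : Fin 20) : Form 20 :=
  and (adj w u) (or (and (adj w 16) (eq u 16))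
    (and (neg (adj w 16)) (and (neg (eq u 15)) (all 6 (imp (lt 6 u) (imp (adj w 6) (eq 6 15)))))))

lemma sat_prefF (hi : 6 < i) (hj : 6 < j) :
    (prefF i j).Sat G e ↔ Pref G (e 15) (e 16) (e i) (e j) := by
  simp [prefF, Pref, update_of_lt hi, update_of_lt hj]

/-- The formula saying that the variable `10` is smaller than `kcol u v`, where the other arguments
of `kcol` are the variables `11` to `17`. -/
def kcolF (u v : Fin 20) : Form 20 :=
  cond (or (and (eq u 15) (eq v 16)) (and (eq u 16) (eq v 15))) (lt 10 11)
    (cond (or (and (eq u 15) (eq v 17)) (and (eq u 17) (eq v 15))) (lt 10 14)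
      (cond (or (eq u 15) (eq v 15)) (lt 10 12) (lt 10 13)))

lemma sat_kcolF : (kcolF i j).Sat G e ↔
    (e 10 : ℕ) < kcol (e 11) (e 12) (e 13) (e 14) (e 15) (e 16) (e 17) (e i) (e j) := by
  simp only [kcolF, kcol, lt_ite_iff, sat_cond, sat_or, sat_and, sat_eq, sat_lt, Fin.lt_def]

/-- The formula saying that the variable `10` is smaller than `wcol w u`, where the other arguments
of `wcol` are the variables `11` to `17`. -/
def wcolF (w u : Fin 20) : Form 20 :=
  cond (and (coreF 17) (and (adj w 15) (adj w 16))) (cond (eq u 15) (lt 10 12) (lt 10 13))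
    (cond (prefF w u) (lt 10 11)
      (cond (or (eq u 17) (and (eq u 15) (prefF w 17))) (lt 10 12) (lt 10 14)))

lemma sat_wcolF (hi : 6 < i) (hj : 6 < j) : (wcolF i j).Sat G e ↔
    (e 10 : ℕ) < wcol G {u | InCore G u} (e 11) (e 12) (e 13) (e 14) (e 15) (e 16) (e 17)
      (e i) (e j) := by
  simp only [wcolF, wcol, lt_ite_iff, sat_cond, sat_or, sat_and, sat_eq, sat_lt,
    Fin.lt_def, sat_adj, Set.mem_ofPred_eq,
    sat_prefF hi hj, sat_prefF hi (show (6 : Fin 20) < 17 by decide),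
    sat_coreF (show (5 : Fin 20) < 17 by decide)]

/-- The formula saying that the variable `10` is smaller than `leastCol G σ τ w u`, where `σ` and
`τ` are the variables `18` and `19`. -/
def leastColF (w u : Fin 20) : Form 20 :=
  cond (all 6 (imp (lt 6 u) (neg (adj w 6)))) (lt 10 18) (lt 10 19)

lemma sat_leastColF (hi : 6 < i) (hj : 6 < j) : (leastColF i j).Sat G e ↔
    (e 10 : ℕ) < leastCol G (e 18) (e 19) (e i) (e j) := by
  simp only [leastColF, leastCol, lt_ite_iff, sat_cond, sat_all, sat_imp, sat_neg, sat_lt, sat_adj,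
    Fin.lt_def, update_of_lt hi, update_of_lt hj, update_self]

/-- The formula saying that the variable `10` is smaller than `paint u v`, given those for the
colours within the core and outside. -/
def paintF (κ ω : Fin 20 → Fin 20 → Form 20) (u v : Fin 20) : Form 20 :=
  cond (pendF u) (lt 10 u) (cond (pendF v) (lt 10 v)
    (cond (coreF u) (cond (coreF v) (κ u v) (ω v u)) (ω u v)))

/-- The formula that compares the variable `10` with the colour of the edge between the variables
`8` and `9`. -/
def paintingF (κ ω : Fin 20 → Fin 20 → Form 20) : Form 20 :=
  cond (lt 8 9) (paintF κ ω 8 9) (paintF κ ω 9 8)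

lemma sat_paintingF {κ ω : Fin 20 → Fin 20 → Form 20} {kcol wcol : Fin n → Fin n → ℕ}
    (hκ : ∀ i j, 7 < i → 7 < j → ((κ i j).Sat G e ↔ (e 10 : ℕ) < kcol (e i) (e j)))
    (hω : ∀ i j, 7 < i → 7 < j → ((ω i j).Sat G e ↔ (e 10 : ℕ) < wcol (e i) (e j)))
    (h : G.Adj (e 8) (e 9)) : (paintingF κ ω).Sat G e ↔
      (e 10 : ℕ) < painting G {u | InCore G u} kcol wcol ⟨s(e 8, e 9), h⟩ := by
  have key : ∀ i j, 7 < i → 7 < j → ((paintF κ ω i j).Sat G e ↔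
      (e 10 : ℕ) < paint G {u | InCore G u} kcol wcol (e i) (e j)) := by
    intro i j hi hj
    simp only [paintF, paint, lt_ite_iff, sat_cond, sat_pendF (lt_trans (by decide) hi),
      sat_pendF (lt_trans (by decide) hj), sat_coreF (lt_trans (by decide) hi),
      sat_coreF (lt_trans (by decide) hj), Set.mem_ofPred_eq, hκ i j hi hj, hω i j hi hj,
      hω j i hj hi, sat_lt, Fin.lt_def]
  have h89 := key 8 9 (by decide) (by decide)
  have h98 := key 9 8 (by decide) (by decide)
  rcases lt_or_ge (e 8) (e 9) with hlt | hle
  · simp [paintingF, painting, hlt, hlt.le, h89]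
  · simp [paintingF, painting, not_lt.2 hle, hle, h98]

end Formulas

/-! ### The least witnesses of a formula -/

namespace Form

section Choose

variable {N n : ℕ} {G : SimpleGraph (Fin n)} {φ ψ : Form N}

/-- Existential quantification over several variables. -/
def exs (is : List (Fin N)) (φ : Form N) : Form N := is.foldr ex φ

/-- The formula saying that `φ` holds for some values of the variables in the list, and that `ψ`
holds for the lexicographically least such values. -/
def choose : List (Fin N) → Form N → Form N → Form N
  | [], φ, ψ => and φ ψ
  | i :: is, φ, ψ => first i (exs is φ) (choose is φ ψ)

open Classical in
/-- The assignment `e`, with the values of the variables in the list replaced by the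
lexicographically least ones that satisfy `φ`. -/
noncomputable def pick (G : SimpleGraph (Fin n)) (φ : Form N) :
    List (Fin N) → (Fin N → Fin n) → Fin N → Fin n
  | [], e => e
  | i :: is, e =>
      if h : ∃ v, Sat G (exs is φ) (update e i v) then
        pick G φ is (update e i (exists_least h).choose)
      else e

lemma sat_exs_cons {i : Fin N} {is : List (Fin N)} {e : Fin N → Fin n} :
    Sat G (exs (i :: is) φ) e ↔ ∃ v, Sat G (exs is φ) (update e i v) := sat_ex

lemma sat_choose (is : List (Fin N)) (e : Fin N → Fin n) :
    Sat G (choose is φ ψ) e ↔ Sat G (exs is φ) e ∧ Sat G ψ (pick G φ is e) := by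
  induction is generalizing e with
  | nil => rfl
  | cons i is ih =>
    rw [sat_exs_cons]
    constructor
    · rintro ⟨v, hv, hmin, hψ⟩
      have hex : ∃ v, Sat G (exs is φ) (update e i v) := ⟨v, hv⟩
      refine ⟨hex, ?_⟩
      have hspec := (exists_least hex).choose_spec
      have : (exists_least hex).choose = v := by
        rcases lt_trichotomy (exists_least hex).choose v with h | h | h
        · exact absurd hspec.1 (hmin _ h)
        · exact h
        · exact absurd hv (hspec.2 _ h)
      rw [pick, dif_pos hex, this]
      exact ((ih _).1 hψ).2
    · rintro ⟨hex, hψ⟩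
      have hspec := (exists_least hex).choose_spec
      rw [pick, dif_pos hex] at hψ
      exact ⟨_, hspec.1, hspec.2, (ih _).2 ⟨hspec.1, hψ⟩⟩

lemma sat_pick {is : List (Fin N)} {e : Fin N → Fin n} (h : Sat G (exs is φ) e) :
    Sat G φ (pick G φ is e) := by
  induction is generalizing e with
  | nil => exact h
  | cons i is ih =>
    rw [sat_exs_cons] at h
    rw [pick, dif_pos h]
    exact ih (exists_least h).choose_spec.1

lemma pick_of_notMem {is : List (Fin N)} {e : Fin N → Fin n} {j : Fin N} (hj : j ∉ is) :
    pick G φ is e j = e j := by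
  induction is generalizing e with
  | nil => rfl
  | cons i is ih =>
    rw [List.mem_cons, not_or] at hj
    rw [pick]
    split_ifs with h
    · rw [ih hj.2, update_of_ne hj.1]
    · rfl

variable {A : Set (Fin N)} (hφ : ∀ e e' : Fin N → Fin n, Set.EqOn e e' A → (Sat G φ e ↔ Sat G φ e'))
include hφ

lemma sat_exs_congr {is : List (Fin N)} {e e' : Fin N → Fin n}
    (h : Set.EqOn e e' (A \ {j | j ∈ is})) : Sat G (exs is φ) e ↔ Sat G (exs is φ) e' := by
  induction is generalizing e e' with
  | nil => exact hφ e e' fun j hj => h ⟨hj, by simp⟩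
  | cons i is ih =>
    rw [sat_exs_cons, sat_exs_cons]
    refine exists_congr fun v => ih fun j hj => ?_
    by_cases hji : j = i
    · subst hji; simp
    · rw [update_of_ne hji, update_of_ne hji]
      exact h ⟨hj.1, by simpa [hji] using hj.2⟩

/-- The least witnesses depend only on the other variables of the formula. -/
lemma pick_congr {is : List (Fin N)} {e e' : Fin N → Fin n}
    (h : Set.EqOn e e' (A \ {j | j ∈ is})) (hex : Sat G (exs is φ) e) :
    Set.EqOn (pick G φ is e) (pick G φ is e') A := by
  induction is generalizing e e' with
  | nil => exact fun j hj => h ⟨hj, by simp⟩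
  | cons i is ih =>
    have key : ∀ v, Set.EqOn (update e i v) (update e' i v) (A \ {j | j ∈ is}) := by
      intro v j hj
      by_cases hji : j = i
      · subst hji; simp
      · rw [update_of_ne hji, update_of_ne hji]
        exact h ⟨hj.1, by simpa [hji] using hj.2⟩
    have hP : (fun v => Sat G (exs is φ) (update e i v)) =
        fun v => Sat G (exs is φ) (update e' i v) :=
      funext fun v => propext (sat_exs_congr hφ (key v))
    rw [sat_exs_cons] at hex
    have hex' : ∃ v, Sat G (exs is φ) (update e' i v) := by
      obtain ⟨v, hv⟩ := hex
      exact ⟨v, (sat_exs_congr hφ (key v)).1 hv⟩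
    rw [pick, dif_pos hex, pick, dif_pos hex']
    have : (exists_least hex).choose = (exists_least hex').choose := by
      congr 1
      funext u
      simp only [sat_exs_congr hφ (key _)]
    rw [this]
    exact ih (key _) (this ▸ (exists_least hex).choose_spec.1)

end Choose

end Form

/-! ### Sentences about pendant vertices -/

section Counting

variable {n : ℕ} {G : SimpleGraph (Fin n)}

open Form

/-- At least `m` pendant vertices are larger than `i`. The variable `j` is used alternately. -/
def manyF : ℕ → Fin 20 → Fin 20 → Form 20
  | 0, _, _ => tt
  | m + 1, i, j => ex j (and (lt i j) (and (pendF j) (manyF m j i)))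

/-- There are at least `m` pendant vertices. -/
def atLeastF : ℕ → Form 20
  | 0 => tt
  | m + 1 => ex 2 (and (pendF 2) (manyF m 2 3))

/-- In a linear order, a finite set has more than `m` elements if and only if some element has at
least `m` larger ones. -/
lemma exists_le_card_filter_lt {α : Type*} [LinearOrder α] (s : Finset α) (m : ℕ) :
    (∃ x ∈ s, m ≤ (s.filter (x < ·)).card) ↔ m + 1 ≤ s.card := by
  constructor
  · rintro ⟨x, hx, h⟩
    have hsub : s.filter (x < ·) ⊆ s.erase x := by
      intro y hy
      rw [Finset.mem_filter] at hy
      exact Finset.mem_erase.2 ⟨hy.2.ne', hy.1⟩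
    have := Finset.card_le_card hsub
    rw [Finset.card_erase_of_mem hx] at this
    have := Finset.card_pos.2 ⟨x, hx⟩
    omega
  · intro h
    have hne : s.Nonempty := Finset.card_pos.1 (by omega)
    refine ⟨s.min' hne, s.min'_mem hne, ?_⟩
    have hsub : s.erase (s.min' hne) ⊆ s.filter (s.min' hne < ·) := by
      intro y hy
      exact Finset.mem_filter.2 ⟨Finset.mem_of_mem_erase hy, s.min'_lt_of_mem_erase_min' hne hy⟩
    have := Finset.card_le_card hsub
    rw [Finset.card_erase_of_mem (s.min'_mem hne)] at this
    omega

lemma sat_manyF {m : ℕ} {e : Fin 20 → Fin n} {i j : Fin 20} (hi : 1 < i) (hj : 1 < j)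
    (hij : i ≠ j) : (manyF m i j).Sat G e ↔ m ≤ ((pendants G).filter (e i < ·)).card := by
  induction m generalizing e i j with
  | zero => simp [manyF]
  | succ m ih =>
    rw [← exists_le_card_filter_lt]
    simp only [manyF, sat_ex, sat_and, sat_lt, sat_pendF hj, ih hj hi hij.symm, update_self,
      update_of_ne hij, Finset.mem_filter, mem_pendants, Finset.filter_filter]
    refine exists_congr fun v => ?_
    rw [← and_assoc, and_comm (a := e i < v)]
    refine and_congr_right fun hv => ?_
    have : (fun a => e i < a ∧ v < a) = fun a => v < a :=
      funext fun a => propext ⟨fun h => h.2, fun h => ⟨hv.2.trans h, h⟩⟩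
    simp only [this]

lemma sat_atLeastF {m : ℕ} {e : Fin 20 → Fin n} :
    (atLeastF m).Sat G e ↔ m ≤ (pendants G).card := by
  cases m with
  | zero => simp [atLeastF]
  | succ m =>
    rw [← exists_le_card_filter_lt]
    simp [atLeastF, sat_pendF, sat_manyF, mem_pendants]

/-- The formula for `IsStar`. -/
def starF : Form 20 := ex 2 (all 3 (imp (neg (eq 3 2)) (pendF 3)))

lemma sat_starF {e : Fin 20 → Fin n} : starF.Sat G e ↔ IsStar G := by
  simp [starF, IsStar, sat_pendF]

/-- The variables of a tuple. -/
def tupleVars : List (Fin 20) := [11, 12, 13, 14, 15, 16, 17]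

/-- The formula for the tuples that make up `HasTuple`. -/
def tupleF : Form 20 := or wideF narrowF

lemma sat_tupleF {e : Fin 20 → Fin n} : tupleF.Sat G e ↔
    WideTuple G {u | InCore G u} (e 11) (e 12) (e 13) (e 14) (e 15) (e 16) (e 17) ∨
    NarrowTuple G {u | InCore G u} (e 11) (e 12) (e 13) (e 14) (e 15) (e 16) (e 17) := by
  rw [tupleF, sat_or, sat_wideF, sat_narrowF]

lemma sat_tupleF_congr (e e' : Fin 20 → Fin n) (h : Set.EqOn e e' {j | j ∈ tupleVars}) :
    tupleF.Sat G e ↔ tupleF.Sat G e' := by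
  have key : ∀ j ∈ tupleVars, e j = e' j := fun j hj => h hj
  simp only [tupleVars, List.forall_mem_cons] at key
  obtain ⟨h1, h2, h3, h4, h5, h6, h7, -⟩ := key
  rw [sat_tupleF, sat_tupleF, h1, h2, h3, h4, h5, h6, h7]

lemma sat_exs_tupleF {e : Fin 20 → Fin n} :
    (exs tupleVars tupleF).Sat G e ↔ HasTuple G {u | InCore G u} := by
  simp [exs, tupleVars, HasTuple, sat_tupleF]

/-- The formula saying that the variables `18` and `19` are different pendant vertices. -/
def pairF : Form 20 := and (pendF 18) (and (pendF 19) (neg (eq 18 19)))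

lemma sat_pairF {e : Fin 20 → Fin n} :
    pairF.Sat G e ↔ Pend G (e 18) ∧ Pend G (e 19) ∧ e 18 ≠ e 19 := by
  simp [pairF, sat_pendF]

lemma sat_pairF_congr (e e' : Fin 20 → Fin n) (h : Set.EqOn e e' {j | j ∈ [18, 19]}) :
    pairF.Sat G e ↔ pairF.Sat G e' := by
  have key : ∀ j ∈ [18, 19], e j = e' j := fun j hj => h hj
  simp only [List.forall_mem_cons] at key
  rw [sat_pairF, sat_pairF, key.1, key.2.1]

lemma sat_exs_pairF {e : Fin 20 → Fin n} :
    (exs [18, 19] pairF).Sat G e ↔ ∃ s t, Pend G s ∧ Pend G t ∧ s ≠ t := by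
  simp [exs, sat_pairF]

end Counting

/-! ### The rainbow connection number of a connected split graph -/

section Characterization

lemma rc_le {V : Type*} {G : SimpleGraph V} {c : EdgeColouring G} (hc : IsRainbowColouring c) :
    rc G ≤ numColours c := Nat.sInf_le ⟨c, hc, rfl⟩

lemma exists_numColours_eq_rc {V : Type*} [Finite V] {G : SimpleGraph V} (hG : G.Connected) :
    ∃ c : EdgeColouring G, IsRainbowColouring c ∧ numColours c = rc G := by
  obtain ⟨c, hc⟩ := exists_isRainbowColouring G hG
  exact Nat.sInf_mem (s := {m : ℕ | ∃ c : EdgeColouring G, IsRainbowColouring c ∧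
    numColours c = m}) ⟨_, c, hc, rfl⟩

lemma numColours_le {V : Type*} {G : SimpleGraph V} {c : EdgeColouring G} {S : Finset ℕ}
    (h : ∀ e, c e ∈ S) : numColours c ≤ S.card := by
  rw [numColours, ← Set.ncard_coe_finset]
  exact Set.ncard_le_ncard (by rintro _ ⟨e, rfl⟩; exact h e) S.finite_toSet

variable {n : ℕ} {G : SimpleGraph (Fin n)} {K : Set (Fin n)}

/-- On at most two vertices, the constant colouring is a rainbow colouring. -/
lemma rc_le_one (hconn : G.Connected) (hn : n ≤ 2) : rc G ≤ 1 := by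
  have hc : IsRainbowColouring (fun _ => 0 : EdgeColouring G) := by
    intro u v
    by_cases huv : u = v
    · subst huv
      exact ⟨.nil, .nil, by simp⟩
    have hadj : G.Adj u v := by
      obtain ⟨p⟩ := hconn.preconnected u v
      cases p with
      | nil => exact absurd rfl huv
      | @cons _ w _ h _ =>
        have h1 := h.ne
        have : w = v := by
          rw [ne_eq, Fin.ext_iff] at h1
          rw [Fin.ext_iff] at huv
          rw [Fin.ext_iff]
          omega
        exact this ▸ h
    refine ⟨hadj.toWalk, SimpleGraph.Walk.IsPath.of_adj hadj, fun e f he hf _ => ?_⟩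
    simp only [SimpleGraph.Walk.edges_cons, SimpleGraph.Walk.edges_nil, List.mem_singleton] at he hf
    exact Subtype.ext (he.trans hf.symm)
  exact (rc_le hc).trans (numColours_le (S := {0}) (by simp))

lemma card_pendants_le_rc (hconn : G.Connected) (hn : 3 ≤ n) : (pendants G).card ≤ rc G := by
  obtain ⟨c, hc, h⟩ := exists_numColours_eq_rc hconn
  exact h ▸ hc.card_pendants_le hconn hn

/-- If there are four pendant vertices that cannot be used as colours, and not all vertices but
one are pendant, then one more colour is needed. -/
lemma IsCore.card_pendants_lt_rc (hK : IsCore G K) (hconn : G.Connected) (hn : 3 ≤ n)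
    (h4 : 4 ≤ (pendants G).card) (hT : ¬ HasTuple G K) (hS : ¬ IsStar G) :
    (pendants G).card < rc G := by
  obtain ⟨c, hc, h⟩ := exists_numColours_eq_rc hconn
  obtain ⟨q₁, h1, q₂, h2, q₃, h3, q₄, h4, h12, h13, h14, h23, h24, h34⟩ := Finset.three_lt_card.1 h4
  rw [mem_pendants] at h1 h2 h3 h4
  rcases hK.hasTuple_or hconn ⟨⟨h1, h2, h3, h4⟩, h12, h13, h14, h23, h24, h34⟩ with k | k | k | k
  · exact absurd k hT
  · exact absurd k hS
  · exact h ▸ k.lt_numColours hconn hn hc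
  · exact h ▸ k.lt_numColours hconn hn hc

lemma FourPend.numColours_painting_le (hK : IsCore G K) {s₁ s₂ s₃ s₄ a b x₀ : Fin n}
    (h : FourPend G s₁ s₂ s₃ s₄) : numColours (painting G K (kcol s₁ s₂ s₃ s₄ a b x₀)
      (wcol G K s₁ s₂ s₃ s₄ a b x₀)) ≤ (pendants G).card := by
  refine (numColours_le (S := (pendants G).image (↑)) fun e => ?_).trans Finset.card_image_le
  obtain ⟨s, hs, h⟩ := h.painting_mem hK (a := a) (b := b) (x₀ := x₀) e
  exact Finset.mem_image.2 ⟨s, mem_pendants.2 hs, h⟩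

/-- A valid tuple yields a rainbow colouring whose colours are pendant vertices. -/
lemma IsCore.painting_of_tuple (hK : IsCore G K) (hconn : G.Connected)
    {s₁ s₂ s₃ s₄ a b x₀ : Fin n}
    (h : WideTuple G K s₁ s₂ s₃ s₄ a b x₀ ∨ NarrowTuple G K s₁ s₂ s₃ s₄ a b x₀) :
    IsRainbowColouring (painting G K (kcol s₁ s₂ s₃ s₄ a b x₀) (wcol G K s₁ s₂ s₃ s₄ a b x₀)) ∧
      numColours (painting G K (kcol s₁ s₂ s₃ s₄ a b x₀) (wcol G K s₁ s₂ s₃ s₄ a b x₀)) ≤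
        (pendants G).card := by
  rcases h with h | h
  · exact ⟨h.isRainbowColouring hK hconn, h.1.numColours_painting_le hK⟩
  · exact ⟨h.isRainbowColouring hK hconn, h.1.numColours_painting_le hK⟩

/-- The colouring with the extra colour `n`, if the other colours are taken from a set that
contains the pendant vertices. -/
lemma IsCore.painting_extra (hK : IsCore G K) (hconn : G.Connected) {σ τ : Fin n} (hστ : σ ≠ τ)
    {S : Finset (Fin n)} (hS : pendants G ⊆ S) (hσ : σ ∈ S) (hτ : τ ∈ S) :
    IsRainbowColouring (painting G K (fun _ _ => n) (leastCol G σ τ)) ∧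
      numColours (painting G K (fun _ _ => n) (leastCol G σ τ)) ≤ S.card + 1 := by
  refine ⟨hK.isRainbowColouring_extra hconn (fun h => hστ (Fin.ext h)) σ.2.ne τ.2.ne
    fun s _ => s.2.ne, (numColours_le (S := insert n (S.image (↑))) fun e => ?_).trans
    ((Finset.card_insert_le _ _).trans (Nat.add_le_add_right Finset.card_image_le 1))⟩
  refine hK.painting_mem (S := ((insert n (S.image (↑)) : Finset ℕ) : Set ℕ)) (kcol := fun _ _ => n)
    (fun _ _ => rfl)
    ?_ ?_ ?_ e
  · exact fun s hs => Finset.mem_insert_of_mem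
      (Finset.mem_image_of_mem _ (hS (mem_pendants.2 hs)))
  · exact fun _ _ _ _ _ => Finset.mem_insert_self _ _
  · intro w _ _ u _
    unfold leastCol
    split_ifs
    · exact Finset.mem_insert_of_mem (Finset.mem_image_of_mem _ hσ)
    · exact Finset.mem_insert_of_mem (Finset.mem_image_of_mem _ hτ)

lemma IsCore.rc_le_max (hK : IsCore G K) (hconn : G.Connected) (hn : 3 ≤ n) :
    rc G ≤ max (pendants G).card 2 + 1 := by
  obtain ⟨S, hS, hcard⟩ := Finset.exists_superset_card_eq (s := pendants G)
    (n := max (pendants G).card 2) (le_max_left _ _) (by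
      have := Finset.card_le_univ (pendants G)
      rw [Fintype.card_fin] at this ⊢
      omega)
  obtain ⟨σ, hσ, τ, hτ, hστ⟩ := Finset.one_lt_card.1 (show 1 < S.card by omega)
  obtain ⟨h1, h2⟩ := hK.painting_extra hconn hστ hS hσ hτ
  exact hcard ▸ (rc_le h1).trans h2

/-- In a star all edges are pendant, so the extra colour does not occur. -/
lemma IsCore.numColours_painting_of_isStar (hK : IsCore G K) (hstar : IsStar G)
    (kcol wcol : Fin n → Fin n → ℕ) (hsymm : ∀ u v, kcol u v = kcol v u) :
    numColours (painting G K kcol wcol) ≤ (pendants G).card := by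
  obtain ⟨a, ha⟩ := hstar
  have heq : ∀ v, ¬ Pend G v → v = a := fun v hv => by_contra fun h => hv (ha v h)
  refine (numColours_le (S := (pendants G).image (↑)) fun e => ?_).trans Finset.card_image_le
  refine hK.painting_mem (S := (((pendants G).image (↑) : Finset ℕ) : Set ℕ)) hsymm ?_ ?_ ?_ e
  · exact fun s hs => Finset.mem_image_of_mem _ (mem_pendants.2 hs)
  · exact fun u hu v hv huv =>
      absurd ((heq u (hK.not_pend u hu)).trans (heq v (hK.not_pend v hv)).symm) huv
  · intro w hw hp u _
    obtain ⟨x, hx, -⟩ := hK.maximal w hw hp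
    rw [heq w hp, ← heq x (hK.not_pend x hx)] at hw
    exact absurd hx hw

lemma IsStar.two_le_card_pendants (hstar : IsStar G) (hn : 3 ≤ n) : 2 ≤ (pendants G).card := by
  obtain ⟨a, ha⟩ := hstar
  have : Finset.univ.erase a ⊆ pendants G := fun v hv =>
    mem_pendants.2 (ha v (Finset.ne_of_mem_erase hv))
  have := Finset.card_le_card this
  rw [Finset.card_erase_of_mem (Finset.mem_univ a), Finset.card_univ, Fintype.card_fin] at this
  omega

/-- With at least four colours available, the number of pendant vertices decides, except where it
equals the number of colours. -/
lemma IsCore.rc_le_iff (hK : IsCore G K) (hconn : G.Connected) (hn : 3 ≤ n) {k : ℕ} (hk : 4 ≤ k) :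
    rc G ≤ k ↔ (pendants G).card ≤ k ∧ ((pendants G).card < k ∨ IsStar G ∨ HasTuple G K) := by
  constructor
  · intro h
    have h1 := card_pendants_le_rc hconn hn
    refine ⟨h1.trans h, ?_⟩
    by_contra! hcon
    have := hK.card_pendants_lt_rc hconn hn (by omega) hcon.2.2 hcon.2.1
    omega
  · rintro ⟨h, hlt | hstar | ⟨s₁, s₂, s₃, s₄, a, b, x₀, hT⟩⟩
    · have := hK.rc_le_max hconn hn
      omega
    · obtain ⟨σ, hσ, τ, hτ, hστ⟩ := Finset.one_lt_card.1 (hstar.two_le_card_pendants hn)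
      exact (rc_le (hK.painting_extra hconn hστ subset_rfl hσ hτ).1).trans
        ((hK.numColours_painting_of_isStar hstar _ _ fun _ _ => rfl).trans h)
    · obtain ⟨h1, h2⟩ := hK.painting_of_tuple hconn hT
      exact (rc_le h1).trans (h2.trans h)

end Characterization

/-! ### The decision problem and the computed colouring -/

section Algorithms

open Form

/-- The sentence that decides whether the rainbow connection number is at most `k`. -/
def rcLeF (k : ℕ) : Form 20 :=
  and (neg (atLeastF (k + 1))) (or (neg (atLeastF k)) (or starF (exs tupleVars tupleF)))

lemma sat_rcLeF (G : ConnectedSplitGraph) {k : ℕ} (hk : 4 ≤ k) (e : Fin 20 → Fin G.n) :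
    (rcLeF k).Sat G.graph e ↔ rc G.graph ≤ k := by
  have hsat : (rcLeF k).Sat G.graph e ↔ (pendants G.graph).card ≤ k ∧
      ((pendants G.graph).card < k ∨ IsStar G.graph ∨ HasTuple G.graph {u | InCore G.graph u}) := by
    rw [rcLeF, sat_and, sat_neg, sat_or, sat_neg, sat_or, sat_atLeastF, sat_atLeastF, sat_starF,
      sat_exs_tupleF, not_le, not_le, Nat.lt_succ_iff]
  rw [hsat]
  by_cases hn : 3 ≤ G.n
  · rw [(isCore_inCore G.isSplit G.connected hn).rc_le_iff G.connected hn hk]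
  · have h1 := rc_le_one G.connected (show G.n ≤ 2 by omega)
    have h2 := Finset.card_le_univ (pendants G.graph)
    rw [Fintype.card_fin] at h2
    exact iff_of_true ⟨by omega, Or.inl (by omega)⟩ (by omega)

/-- The chosen tuple, as the values of the variables `tupleVars`. -/
noncomputable def chosenTuple (G : ConnectedSplitGraph) : Fin 20 → Fin G.n :=
  pick G.graph tupleF tupleVars fun _ => ⟨0, G.pos⟩

/-- The chosen pair of pendant vertices, as the values of the variables `18` and `19`. -/
noncomputable def chosenPair (G : ConnectedSplitGraph) : Fin 20 → Fin G.n :=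
  pick G.graph pairF [18, 19] fun _ => ⟨0, G.pos⟩

open Classical in
/-- The colouring that is computed. It uses pendant vertices only if they can be used, and the extra
colour `n` otherwise; if there are fewer than two pendant vertices, it is constant. -/
noncomputable def splitColouring (G : ConnectedSplitGraph) : EdgeColouring G.graph :=
  if HasTuple G.graph {u | InCore G.graph u} then
    painting G.graph {u | InCore G.graph u}
      (kcol (chosenTuple G 11) (chosenTuple G 12) (chosenTuple G 13) (chosenTuple G 14)
        (chosenTuple G 15) (chosenTuple G 16) (chosenTuple G 17))
      (wcol G.graph {u | InCore G.graph u} (chosenTuple G 11) (chosenTuple G 12)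
        (chosenTuple G 13) (chosenTuple G 14) (chosenTuple G 15) (chosenTuple G 16)
        (chosenTuple G 17))
  else if ∃ s t, Pend G.graph s ∧ Pend G.graph t ∧ s ≠ t then
    painting G.graph {u | InCore G.graph u} (fun _ _ => G.n)
      (leastCol G.graph (chosenPair G 18) (chosenPair G 19))
  else fun _ => 0

/-- The formula that compares the variable `10` with the colour of the edge between the variables
`8` and `9`. -/
def colourF : Form 20 :=
  or (choose tupleVars tupleF (paintingF kcolF wcolF)) (and (neg (exs tupleVars tupleF))
    (choose [18, 19] pairF (paintingF (fun _ _ => tt) leastColF)))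

lemma eqOn_of_diff_self {N : ℕ} {α : Type*} {is : List (Fin N)} (e e' : Fin N → α) :
    Set.EqOn e e' ({j | j ∈ is} \ {j | j ∈ is}) := by simp

lemma sat_colourF (G : ConnectedSplitGraph) (e : Fin 20 → Fin G.n)
    (h : G.graph.Adj (e 8) (e 9)) :
    colourF.Sat G.graph e ↔ (e 10 : ℕ) < splitColouring G ⟨s(e 8, e 9), h⟩ := by
  rw [colourF, sat_or, sat_and, sat_neg, sat_choose, sat_choose, sat_exs_tupleF, sat_exs_pairF,
    splitColouring]
  split_ifs with hT hP
  · have hpick := pick_congr sat_tupleF_congr (eqOn_of_diff_self e fun _ => ⟨0, G.pos⟩)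
      (sat_exs_tupleF.2 hT)
    have k : ∀ j ∈ tupleVars, pick G.graph tupleF tupleVars e j = chosenTuple G j :=
      fun j hj => hpick hj
    have k8 : pick G.graph tupleF tupleVars e 8 = e 8 := pick_of_notMem (by decide)
    have k9 : pick G.graph tupleF tupleVars e 9 = e 9 := pick_of_notMem (by decide)
    have k10 : pick G.graph tupleF tupleVars e 10 = e 10 := pick_of_notMem (by decide)
    simp only [hT, true_and, not_true_eq_false, false_and, or_false]
    rw [sat_paintingF (fun _ _ _ _ => sat_kcolF)
      (fun i j hi hj => sat_wcolF (lt_trans (by decide) hi) (lt_trans (by decide) hj))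
      (by rwa [k8, k9])]
    simp only [k 11 (by decide), k 12 (by decide), k 13 (by decide), k 14 (by decide),
      k 15 (by decide), k 16 (by decide), k 17 (by decide), k8, k9, k10]
  · have hpick := pick_congr sat_pairF_congr (eqOn_of_diff_self e fun _ => ⟨0, G.pos⟩)
      (sat_exs_pairF.2 hP)
    have k : ∀ j ∈ [18, 19], pick G.graph pairF [18, 19] e j = chosenPair G j :=
      fun j hj => hpick hj
    have k8 : pick G.graph pairF [18, 19] e 8 = e 8 := pick_of_notMem (by decide)
    have k9 : pick G.graph pairF [18, 19] e 9 = e 9 := pick_of_notMem (by decide)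
    have k10 : pick G.graph pairF [18, 19] e 10 = e 10 := pick_of_notMem (by decide)
    simp only [hT, hP, true_and, not_false_eq_true, false_and, false_or]
    rw [sat_paintingF (kcol := fun _ _ => G.n) (fun _ _ _ _ => by simp)
      (fun i j hi hj => sat_leastColF (lt_trans (by decide) hi) (lt_trans (by decide) hj))
      (by rwa [k8, k9])]
    simp only [k 18 (by decide), k 19 (by decide), k8, k9, k10]
  · simp only [hT, hP, false_and, and_false, or_false, Nat.not_lt_zero]

lemma splitColouring_le (G : ConnectedSplitGraph) (e : G.graph.edgeSet) :
    splitColouring G e ≤ G.n := by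
  have key : ∀ kcol wcol : Fin G.n → Fin G.n → ℕ, (∀ u v, kcol u v ≤ G.n) →
      (∀ u v, wcol u v ≤ G.n) →
      painting G.graph {u | InCore G.graph u} kcol wcol e ≤ G.n := by
    intro kcol wcol hk hw
    unfold painting paint
    split_ifs
    · exact Fin.is_le'
    · exact Fin.is_le'
    · exact hk _ _
    · exact hw _ _
    · exact hw _ _
  unfold splitColouring
  split_ifs
  · refine key _ _ (fun u v => ?_) (fun w u => ?_)
    · unfold kcol
      split_ifs <;> exact Fin.is_le'
    · unfold wcol
      split_ifs <;> exact Fin.is_le'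
  · refine key _ _ (fun u v => le_rfl) (fun w u => ?_)
    unfold leastCol
    split_ifs <;> exact Fin.is_le'
  · exact Nat.zero_le _

open Classical in
lemma splitColouring_eq_card (G : ConnectedSplitGraph) (e : Fin 20 → Fin G.n) (u v : Fin G.n)
    (h : G.graph.Adj u v) : splitColouring G ⟨s(u, v), h⟩ = (Finset.univ.filter fun t =>
      colourF.Sat G.graph (update (update (update e 8 u) 9 v) 10 t)).card := by
  have key : ∀ t, colourF.Sat G.graph (update (update (update e 8 u) 9 v) 10 t) ↔
      (t : ℕ) < splitColouring G ⟨s(u, v), h⟩ := by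
    intro t
    have := sat_colourF G (update (update (update e 8 u) 9 v) 10 t) (by simpa using h)
    simpa using this
  simp only [key]
  rw [Fin.card_filter_val_lt, min_eq_right (splitColouring_le G _)]

lemma isOptimal_splitColouring (G : ConnectedSplitGraph) (h4 : 4 ≤ rc G.graph) :
    IsOptimalRainbowColouring (splitColouring G) := by
  have hn : 3 ≤ G.n := by
    by_contra hn
    have := rc_le_one G.connected (show G.n ≤ 2 by omega)
    omega
  have hK := isCore_inCore G.isSplit G.connected hn
  have hp := card_pendants_le_rc G.connected hn
  have hmax := hK.rc_le_max G.connected hn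
  have hcrit : ∀ {c : EdgeColouring G.graph}, IsRainbowColouring c → numColours c ≤ rc G.graph →
      IsOptimalRainbowColouring c := fun hc h => ⟨hc, le_antisymm h (rc_le hc)⟩
  have hP : ∃ s t, Pend G.graph s ∧ Pend G.graph t ∧ s ≠ t := by
    obtain ⟨s, hs, t, ht, hst⟩ := Finset.one_lt_card.1 (show 1 < (pendants G.graph).card by omega)
    exact ⟨s, t, mem_pendants.1 hs, mem_pendants.1 ht, hst⟩
  unfold splitColouring
  split_ifs with hT
  · obtain ⟨h1, h2⟩ := hK.painting_of_tuple G.connected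
      (sat_tupleF.1 (sat_pick (sat_exs_tupleF.2 hT)) : _ ∨ _)
    exact hcrit h1 (h2.trans hp)
  · obtain ⟨hs, ht, hst⟩ := sat_pairF.1 (sat_pick (sat_exs_pairF.2 hP))
    obtain ⟨h1, h2⟩ := hK.painting_extra G.connected hst subset_rfl (mem_pendants.2 hs)
      (mem_pendants.2 ht)
    refine hcrit h1 ?_
    by_cases hS : IsStar G.graph
    · exact (hK.numColours_painting_of_isStar hS _ _ fun _ _ => rfl).trans hp
    by_cases hp4 : 4 ≤ (pendants G.graph).card
    · exact h2.trans (hK.card_pendants_lt_rc G.connected hn hp4 hT hS)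
    · exact h2.trans (by omega)

end Algorithms

end RainbowSplit

theorem mainTheorem4 :
    (∀ k : ℕ, 4 ≤ k →
      Nonempty (Turing.TM2ComputableInPolyTime
        RainbowSplit.ConnectedSplitGraph.encode Computability.encodeBool
        (fun G : RainbowSplit.ConnectedSplitGraph => decide (RainbowSplit.rc G.graph ≤ k)))) ∧
    (∃ c : (G : RainbowSplit.ConnectedSplitGraph) → RainbowSplit.EdgeColouring G.graph,
      Nonempty (Turing.TM2ComputableInPolyTime
        RainbowSplit.ConnectedSplitGraph.encode (id : List (Option Bool) → List (Option Bool))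
        (fun G : RainbowSplit.ConnectedSplitGraph => RainbowSplit.encodeColouring (c G))) ∧
      ∀ G : RainbowSplit.ConnectedSplitGraph, 4 ≤ RainbowSplit.rc G.graph →
        RainbowSplit.IsOptimalRainbowColouring (c G)) := by
  refine ⟨fun k hk => ?_, RainbowSplit.splitColouring, ?_, RainbowSplit.isOptimal_splitColouring⟩
  · refine RainbowSplit.polyTime_sentence (RainbowSplit.rcLeF k) _ fun G e => ?_
    rw [RainbowSplit.sat_rcLeF G hk, decide_eq_true_iff]
  · exact RainbowSplit.polyTime_colouring 8 9 10 RainbowSplit.colourF _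
      RainbowSplit.splitColouring_eq_card (by decide)
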